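/- **Notation.** For $t\in\mathbb R$ let $u_t=(\cos t,\sin t)$, $v_t=(-\sin t,\cos t)$. A convex body is a nonempty compact convex subset $K\subset\mathbb R^2$ (possibly with empty interior), $|K|$ is its area, $h_K(t)=\max_{p\in K}p\cdot u_t$ its support function, $e_K(t)=\{p\in K: p\cdot u_t=h_K(t)\}$ its edge of normal angle $t$, and $v_K^{+}(t)$, $v_K^-(t)$ are the endpoints of $e_K(t)$ farthest in the directions $v_t$, $-v_t$. For a set $X$ of angles, $\sigma_K(X)$ is the surface area measure, i.e. the one-dimensional Hausdorff measure of $\bigcup_{t\in X}e_K(t)$. Put $\mathbf x_K(t)=(h_K(t)-1)u_t+(h_K(t+\pi/2)-1)v_t$. For points $p,q$ let $p\times q=p_1q_2-p_2q_1$ and $\mathcal J(p,q)=\frac12\,p\times q$. For a continuous curve $\mathbf x:[a,b]\to\mathbb R^2$ of bounded variation let $\mathcal J(\mathbf x)=\frac12\int_a^b\mathbf x(t)\times d\mathbf x(t)$ (Lebesgue–Stieltjes integral); for a rectifiable oriented Jordan arc, $\mathcal J$ is the common value on its parametrizations (one-point arcs are allowed). For $a<b<a+\pi$ let $\mathbf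 u_K^{a,b}=\{v_K^+(a)\}\cup\bigcup_{t\in(a,b)}e_K(t)\cup\{v_K^-(b)\}$, an arc of $\partial K$ from $v_K^+(a)$ to $v_K^-(b)$. **The domain.** Let $\mathcal K^{\mathrm i}$ be the set of convex bodies $K$ with $|K|\ge 2.2$ such that * $h_K(\pi/2)=1$, $h_K(3\pi/2)=0$, and $K$ is an intersection of closed half-planes with outer normal angles in $[0,\pi]\cup\{3\pi/2\}$; * $\sigma_K$ has a nonnegative measurable density with respect to Lebesgue measure on $[0,\pi/2)$ and on $(\pi/2,\pi]$; * $\mathbf x_K$ is continuously differentiable on $[0,\pi/2]$, with $\mathbf x_K'(t)\cdot u_t<0$ and $\mathbf x_K'(t)\cdot v_t>0$ for all $t\in(0,\pi/2)$. Let $0<\varphi<\pi/4$, $\varphi^{\mathrm R}=\varphi$, $\varphi^{\mathrm L}=\pi/2-\varphi$ (for instance, $\varphi$ may be the angle constant $\varphi\in[0.039,0.040]$ of Gerver's sofa). Let $\mathcal L$ be the set of triples $(K,B,D)$ of convex bodies such that $K\in\mathcal K^{\mathrm i}$, $B\subseteq K$, $D\subseteq K$; $h_K(t)+h_B(\pi+t)\le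 1$ for all $t\in[\varphi^{\mathrm R},\pi/2]$, with equality at $t=\varphi^{\mathrm R}$ and $t=\pi/2$; and $h_K(\pi/2+t)+h_D(3\pi/2+t)\le 1$ for all $t\in[0,\varphi^{\mathrm L}]$, with equality at $t=0$ and $t=\varphi^{\mathrm L}$. **The functional.** For $(K,B,D)\in\mathcal L$ put $X_B=v_B^+(\pi+\varphi^{\mathrm R})$, $Y_D=v_D^-(3\pi/2+\varphi^{\mathrm L})$ and $$\mathcal Q(K,B,D)=|K|+\mathcal J\big(\mathbf u_D^{3\pi/2,\,3\pi/2+\varphi^{\mathrm L}}\big)+\mathcal J\big(Y_D,\mathbf x_K(\varphi^{\mathrm L})\big)-\mathcal J\big(\mathbf x_K|_{[\varphi^{\mathrm R},\varphi^{\mathrm L}]}\big)+\mathcal J\big(\mathbf x_K(\varphi^{\mathrm R}),X_B\big)+\mathcal J\big(\mathbf u_B^{\pi+\varphi^{\mathrm R},\,3\pi/2}\big).$$ **Theorem.** $\mathcal L$ is closed under the componentwise Minkowski combinations $$c_\lambda\big((K_1,B_1,D_1),(K_2,B_2,D_2)\big)=\big((1-\lambda)K_1+\lambda K_2,\ (1-\lambda)B_1+\lambda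 B_2,\ (1-\lambda)D_1+\lambda D_2\big),\qquad \lambda\in[0,1],$$ and with these operations it is a convex domain: there is an injection $e$ of $\mathcal L$ into a real vector space with $e(c_\lambda(P,P'))=(1-\lambda)e(P)+\lambda e(P')$. The functional $\mathcal Q:\mathcal L\to\mathbb R$ is quadratic, i.e. $\mathcal Q(P)=g(P,P)$ for some $g:\mathcal L\times\mathcal L\to\mathbb R$ that preserves the operations $c_\lambda$ in each variable separately (with the usual convex combinations on $\mathbb R$), and it is concave: for all $P,P'\in\mathcal L$ and $\lambda\in[0,1]$, $$\mathcal Q(c_\lambda(P,P'))\ \ge\ (1-\lambda)\,\mathcal Q(P)+\lambda\,\mathcal Q(P').$$ -/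

import Mathlib

open Set MeasureTheory

noncomputable section

namespace Sofa

/-! ### Convex domains, convex-linear maps, quadratic and concave functionals -/

/-- A family of operations `c_l : V × V → V`, `l ∈ [0, 1]`. -/
abbrev BarycentricOp (V : Type*) := unitInterval → V → V → V

/-- `(V, c)` is a convex domain: some injection of `V` into a real vector space carries
`c_l (v, w)` to `(1 - l) v + l w`. -/
def IsConvexDomain.{w} {V : Type w} (c : BarycentricOp V) : Prop :=
  ∃ (E : Type w) (_ : AddCommGroup E) (_ : Module ℝ E) (e : V → E),
    Function.Injective e ∧
      ∀ (l : unitInterval) (v w : V), e (c l v w) = (1 - (l : ℝ)) • e v + (l : ℝ) • e w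

/-- Real-valued convex-linear maps, i.e. maps preserving the barycentric operations. -/
def IsConvexLinear {V : Type*} (c : BarycentricOp V) (f : V → ℝ) : Prop :=
  ∀ (l : unitInterval) (v w : V), f (c l v w) = (1 - (l : ℝ)) * f v + (l : ℝ) * f w

/-- Real-valued convex-bilinear maps: convex-linear in each variable separately. -/
def IsConvexBilinear {V : Type*} (c : BarycentricOp V) (g : V → V → ℝ) : Prop :=
  (∀ v, IsConvexLinear c fun w => g v w) ∧ ∀ w, IsConvexLinear c fun v => g v w

/-- Quadratic functionals: the diagonals of convex-bilinear maps. -/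
def IsQuadraticFunctional {V : Type*} (c : BarycentricOp V) (f : V → ℝ) : Prop :=
  ∃ g : V → V → ℝ, IsConvexBilinear c g ∧ ∀ v, f v = g v v

/-- Concave functionals on a convex domain. -/
def IsConcaveFunctional {V : Type*} (c : BarycentricOp V) (f : V → ℝ) : Prop :=
  ∀ (l : unitInterval) (v w : V), (1 - (l : ℝ)) * f v + (l : ℝ) * f w ≤ f (c l v w)

/-! ### Planar convex bodies -/

/-- The Euclidean plane. -/
abbrev Plane := EuclideanSpace ℝ (Fin 2)

/-- Planar convex bodies: nonempty compact convex sets, possibly with empty interior. -/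
abbrev Body := ConvexBody Plane

/-- `u_t = (cos t, sin t)`. -/
def u (t : ℝ) : Plane := !₂[Real.cos t, Real.sin t]

/-- `v_t = (-sin t, cos t)`. -/
def v (t : ℝ) : Plane := !₂[-Real.sin t, Real.cos t]

/-- The closed half-plane `{p | p · u_t ≤ h}` of normal angle `t`. -/
def halfPlane (t h : ℝ) : Set Plane := {p | inner ℝ p (u t) ≤ h}

/-- The support function `h_K(t) = sup {p · u_t | p ∈ K}`. -/
def supp (K : Body) (t : ℝ) : ℝ := sSup ((fun p => inner ℝ p (u t)) '' (K : Set Plane))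

/-- The edge `e_K(t)`: the part of `K` on its supporting line of normal angle `t`. -/
def edge (K : Body) (t : ℝ) : Set Plane := {p | p ∈ K ∧ inner ℝ p (u t) = supp K t}

/-- `v_K^+(t)`: the endpoint of the edge `e_K(t)` farthest in the direction `v_t`
(all points of the edge have `u_t`-coordinate `h_K(t)`). -/
def vertexPos (K : Body) (t : ℝ) : Plane :=
  supp K t • u t + sSup ((fun p => inner ℝ p (v t)) '' edge K t) • v t

/-- `v_K^-(t)`: the endpoint of the edge `e_K(t)` farthest in the direction `-v_t`. -/
def vertexNeg (K : Body) (t : ℝ) : Plane :=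
  supp K t • u t + sInf ((fun p => inner ℝ p (v t)) '' edge K t) • v t

/-- The area `|K|`. -/
def area (K : Body) : ℝ := volume.real (K : Set Plane)

/-- The surface area measure `σ_K` as a function of a set `X` of normal angles: the total length
(one-dimensional Hausdorff measure) of the edges of `K` with normal angle in `X`. It is evaluated
below only on sets of angles contained in a half-open interval of length `π / 2`. -/
def surfaceArea (K : Body) (X : Set ℝ) : ENNReal := Measure.hausdorffMeasure 1 (⋃ t ∈ X, edge K t)

/-! ### The curve area functional -/

/-- The cross product `p × q = p₀ q₁ - p₁ q₀` as a continuous bilinear map. -/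
def cross : Plane →L[ℝ] Plane →L[ℝ] ℝ :=
  (EuclideanSpace.proj (𝕜 := ℝ) (0 : Fin 2)).smulRight (EuclideanSpace.proj (𝕜 := ℝ) (1 : Fin 2)) -
    (EuclideanSpace.proj (𝕜 := ℝ) (1 : Fin 2)).smulRight (EuclideanSpace.proj (𝕜 := ℝ) (0 : Fin 2))

theorem cross_apply (p q : Plane) : cross p q = p 0 * q 1 - p 1 * q 0 := by
  simp [cross]

/-- The restriction of `x` to `[a, b]`, extended to the whole line by constants. -/
def clamp (a b : ℝ) (x : ℝ → Plane) (t : ℝ) : Plane := x (max a (min b t))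

open scoped Classical in
/-- The curve area functional `J(x) = (1/2) ∫_a^b x(t) × dx(t)` of a continuous curve
`x : [a, b] → ℝ²` of bounded variation, where `dx` is the Lebesgue–Stieltjes (vector) measure
of `x`. The measure of the extension of `x` by constants lives on `[a, b]`. -/
def curveArea (a b : ℝ) (x : ℝ → Plane) : ℝ :=
  if h : BoundedVariationOn (clamp a b x) univ then
    (1 / 2) * h.vectorMeasure.integral (clamp a b x) cross
  else 0

/-- `J(p, q) = (p × q) / 2`, the curve area functional of the segment from `p` to `q`. -/
def segArea (p q : Plane) : ℝ := cross p q / 2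

/-- `x : [a, b] → ℝ²` is a rectifiable parametrization of the Jordan arc `Γ` oriented
from `p` to `q`. One-point arcs are allowed (`a = b`). -/
def IsArcParam (Γ : Set Plane) (p q : Plane) (a b : ℝ) (x : ℝ → Plane) : Prop :=
  a ≤ b ∧ ContinuousOn x (Icc a b) ∧ InjOn x (Icc a b) ∧ BoundedVariationOn x (Icc a b) ∧
    x '' Icc a b = Γ ∧ x a = p ∧ x b = q

open scoped Classical in
/-- `J(Γ)` for a rectifiable Jordan arc `Γ` oriented from `p` to `q`: the value of `J` on any
parametrization (all parametrizations give the same value). -/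
def arcArea (Γ : Set Plane) (p q : Plane) : ℝ :=
  if h : ∃ P : ℝ × ℝ × (ℝ → Plane), IsArcParam Γ p q P.1 P.2.1 P.2.2 then
    curveArea h.choose.1 h.choose.2.1 h.choose.2.2
  else 0

/-- The segment `𝐮_K^{a,b}` of the boundary of `K`, for `a < b < a + π`: a rectifiable Jordan arc
from `v_K^+(a)` to `v_K^-(b)`. -/
def convexArc (K : Body) (a b : ℝ) : Set Plane :=
  {vertexPos K a} ∪ (⋃ t ∈ Ioo a b, edge K t) ∪ {vertexNeg K b}

/-- `J(𝐮_K^{a,b})`. -/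
def convexArcArea (K : Body) (a b : ℝ) : ℝ :=
  arcArea (convexArc K a b) (vertexPos K a) (vertexNeg K b)

/-! ### Caps and the injectivity condition -/

/-- Caps with rotation angle `π / 2`. -/
def IsCap (K : Body) : Prop :=
  supp K (Real.pi / 2) = 1 ∧ supp K (3 * Real.pi / 2) = 0 ∧
    ∃ S : Set (ℝ × ℝ), (∀ s ∈ S, s.1 ∈ Icc 0 Real.pi ∪ {3 * Real.pi / 2}) ∧
      (K : Set Plane) = ⋂ s ∈ S, halfPlane s.1 s.2

/-- The inner corner `𝐱_K(t)` of the supporting hallway of `K` with angle `t`. -/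
def innerCorner (K : Body) (t : ℝ) : Plane :=
  (supp K t - 1) • u t + (supp K (t + Real.pi / 2) - 1) • v t

/-- The injectivity condition on a cap `K` with rotation angle `π / 2`: (1) `σ_K` has a density on
`[0, π/2)` and on `(π/2, π]`; (2) the inner corner is continuously differentiable on `[0, π/2]`;
(3) on `(0, π/2)` its derivative has negative `u_t`- and positive `v_t`-component. -/
structure InjectivityCondition (K : Body) : Prop where
  density_right : ∃ r : ℝ → NNReal, Measurable r ∧
    ∀ X ⊆ Ico 0 (Real.pi / 2), MeasurableSet X → surfaceArea K X = ∫⁻ t in X, r t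
  density_left : ∃ s : ℝ → NNReal, Measurable s ∧
    ∀ X ⊆ Ioc (Real.pi / 2) Real.pi, MeasurableSet X →
      surfaceArea K X = ∫⁻ t in X, s (t - Real.pi / 2)
  contDiff_corner : ContDiffOn ℝ 1 (innerCorner K) (Icc 0 (Real.pi / 2))
  deriv_corner : ∀ t ∈ Ioo 0 (Real.pi / 2),
    inner ℝ (deriv (innerCorner K) t) (u t) < 0 ∧ 0 < inner ℝ (deriv (innerCorner K) t) (v t)

/-- The space `𝒦ⁱ`: caps with rotation angle `π / 2` satisfying the injectivity condition
and having area at least `2.2`. -/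
def IsInjectiveCap (K : Body) : Prop := IsCap K ∧ InjectivityCondition K ∧ 2.2 ≤ area K

/-! ### The domain `ℒ` and the functional `𝒬`

The angle `φ ∈ (0, π/4)` is `φ^R`, and `π / 2 - φ` is `φ^L`. -/

/-- Triples of convex bodies. -/
abbrev Triple := Body × Body × Body

/-- The Minkowski combination `(1 - l) P + l P'`, taken in each component. -/
def minkowskiComb (l : ℝ) (P P' : Triple) : Triple :=
  ((1 - l) • P.1 + l • P'.1, (1 - l) • P.2.1 + l • P'.2.1, (1 - l) • P.2.2 + l • P'.2.2)

/-- The conditions on a triple `(K, B, D)` of convex bodies that define `ℒ`. -/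
structure IsAdmissible (φ : ℝ) (K B D : Body) : Prop where
  injectiveCap : IsInjectiveCap K
  B_subset : (B : Set Plane) ⊆ K
  D_subset : (D : Set Plane) ⊆ K
  B_le : ∀ t ∈ Icc φ (Real.pi / 2), supp K t + supp B (Real.pi + t) ≤ 1
  B_eq_start : supp K φ + supp B (Real.pi + φ) = 1
  B_eq_end : supp K (Real.pi / 2) + supp B (Real.pi + Real.pi / 2) = 1
  D_le : ∀ t ∈ Icc 0 (Real.pi / 2 - φ),
    supp K (Real.pi / 2 + t) + supp D (3 * Real.pi / 2 + t) ≤ 1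
  D_eq_start : supp K (Real.pi / 2) + supp D (3 * Real.pi / 2) = 1
  D_eq_end : supp K (Real.pi / 2 + (Real.pi / 2 - φ)) +
    supp D (3 * Real.pi / 2 + (Real.pi / 2 - φ)) = 1

/-- The space `ℒ` of admissible triples `(K, B, D)`. -/
def Domain (φ : ℝ) := {P : Triple // IsAdmissible φ P.1 P.2.1 P.2.2}

/-- `𝒬(K, B, D) = |K| + J(𝐝_D) + J(Y_D, 𝐱_K(φ^L)) - J(𝐱_K|[φ^R, φ^L]) + J(𝐱_K(φ^R), X_B) + J(𝐛_B)`,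
where `𝐝_D = 𝐮_D^{3π/2, 3π/2 + φ^L}` ends at `Y_D = v_D^-(3π/2 + φ^L)` and
`𝐛_B = 𝐮_B^{π + φ^R, 3π/2}` starts at `X_B = v_B^+(π + φ^R)`. -/
def Q (φ : ℝ) (P : Domain φ) : ℝ :=
  let K := P.1.1
  let B := P.1.2.1
  let D := P.1.2.2
  area K
    + convexArcArea D (3 * Real.pi / 2) (3 * Real.pi / 2 + (Real.pi / 2 - φ))
    + segArea (vertexNeg D (3 * Real.pi / 2 + (Real.pi / 2 - φ))) (innerCorner K (Real.pi / 2 - φ))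
    - curveArea φ (Real.pi / 2 - φ) (innerCorner K)
    + segArea (innerCorner K φ) (vertexPos B (Real.pi + φ))
    + convexArcArea B (Real.pi + φ) (3 * Real.pi / 2)

end Sofa

end

open Set MeasureTheory

noncomputable section

namespace Sofa

open Filter Topology

/-! ### The rotating frame -/

/-! Everything is expressed through the support function h of a body and its right derivative h',
the tangential coordinate of v⁺. Both are linear under Minkowski combinations and h determines the
body, so passing to support functions embeds ℒ in a vector space.

Twice the area of a cap is ∫ (h² - h'²) over [0, π] (`two_mul_area`). Twice the area functional of a
convex arc is the integral of the same expression plus end terms (`two_mul_convexArcArea`). For the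
inner corner it is the integral of a quadratic expression in h - 1 and h'
(`two_mul_curveArea_innerCorner`). The equalities imposed at the extreme angles make the one-sided
derivatives in the end terms cancel against the two segments, so 2𝒬 is a quadratic form in the
profiles, `energy` (`two_mul_Q`).

For a quadratic form, concavity along segments means nonpositivity on differences
(`IsQuadratic.apply_comb`). Let k, b, d be the differences of the support functions of K, B, D for
two triples. Then k(π/2) = b(3π/2) = d(3π/2) = 0, b(π + φ) = -k(φ) and d(2π - φ) = -k(π - φ). If w'
= 1 + w², then (w k²)' = k² - k'² + (w k + k')², so ∫ (k² - k'²) is at most the increment of w k².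
Shifted tangents and negative cotangents serve as w: - the bound tan φ · k(φ)² over [0, φ] is
cancelled by the bound for b, and tan φ · k(π - φ)² over [π - φ, π] by the bound for d; - over [φ,
π/2 - φ], with l(t) = k(t + π/2), the area integrand minus the corner integrand plus (k l)' is -(k'
- l)²; - over [π/2 - φ, π - φ], with x = k(π/2 - φ) and y = k(π - φ), the bound is -cot φ · x² - tan
φ · y². The end terms add -2xy, and the total is -tan φ (cot φ · x + y)². This is `energy_nonpos`.

In the closure of ℒ, two conditions need an argument. The densities survive because the surface area
measure is Minkowski-linear (`surfaceMeasure_comb`). The bound on the area survives because area is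
concave on caps, which all have height 1 (`IsCap.le_area_comb`). The area formulas and the linearity
of the measure compare increments over short intervals by means of `eq_of_forall_abs_sub_le`. -/

theorem inner_u (p : Plane) (t : ℝ) : inner ℝ p (u t) = p 0 * Real.cos t + p 1 * Real.sin t := by
  simp [u, PiLp.inner_apply, Fin.sum_univ_two]; ring

theorem inner_v (p : Plane) (t : ℝ) : inner ℝ p (v t) = -(p 0 * Real.sin t) + p 1 * Real.cos t := by
  simp [v, PiLp.inner_apply, Fin.sum_univ_two]; ring

theorem inner_u_rotate (p : Plane) (s t : ℝ) :
    inner ℝ p (u t) = Real.cos (t - s) * inner ℝ p (u s) + Real.sin (t - s) * inner ℝ p (v s) := by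
  have h := Real.sin_sq_add_cos_sq s
  rw [inner_u, inner_u, inner_v, Real.cos_sub, Real.sin_sub]
  linear_combination (-(p 0 * Real.cos t + p 1 * Real.sin t)) * h

theorem inner_u_u (s t : ℝ) : inner ℝ (u s) (u t) = Real.cos (t - s) := by
  rw [inner_u, Real.cos_sub]; simp [u]; ring

theorem inner_v_u (s t : ℝ) : inner ℝ (v s) (u t) = Real.sin (t - s) := by
  rw [inner_u, Real.sin_sub]; simp [v]; ring

theorem inner_u_v (s t : ℝ) : inner ℝ (u s) (v t) = -Real.sin (t - s) := by
  rw [inner_v, Real.sin_sub]; simp [u]; ring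

theorem inner_v_v (s t : ℝ) : inner ℝ (v s) (v t) = Real.cos (t - s) := by
  rw [inner_v, Real.cos_sub]; simp [v]; ring

theorem eq_frame (p : Plane) (t : ℝ) : p = inner ℝ p (u t) • u t + inner ℝ p (v t) • v t := by
  have h := Real.sin_sq_add_cos_sq t
  ext i
  rw [inner_u, inner_v]
  fin_cases i <;> simp [u, v]
  · linear_combination (-p 0) * h
  · linear_combination (-p 1) * h

theorem ext_frame {p q : Plane} (t : ℝ) (hu : inner ℝ p (u t) = inner ℝ q (u t))
    (hv : inner ℝ p (v t) = inner ℝ q (v t)) : p = q := by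
  rw [eq_frame p t, eq_frame q t, hu, hv]

theorem norm_sq_frame (p : Plane) (t : ℝ) :
    ‖p‖ ^ 2 = inner ℝ p (u t) ^ 2 + inner ℝ p (v t) ^ 2 := by
  have h := Real.sin_sq_add_cos_sq t
  rw [EuclideanSpace.norm_sq_eq, Fin.sum_univ_two, inner_u, inner_v]
  simp only [Real.norm_eq_abs, sq_abs]
  linear_combination (-(p 0 ^ 2 + p 1 ^ 2)) * h

theorem cross_frame (p q : Plane) (t : ℝ) :
    cross p q = inner ℝ p (u t) * inner ℝ q (v t) - inner ℝ p (v t) * inner ℝ q (u t) := by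
  have h := Real.sin_sq_add_cos_sq t
  rw [cross_apply, inner_u, inner_v, inner_u, inner_v]
  linear_combination (-(p 0 * q 1 - p 1 * q 0)) * h

theorem norm_u (t : ℝ) : ‖u t‖ = 1 := by
  have h : ‖u t‖ ^ 2 = 1 := by
    rw [norm_sq_frame _ t, inner_u_u, inner_u_v]; simp
  nlinarith [norm_nonneg (u t)]

theorem norm_v (t : ℝ) : ‖v t‖ = 1 := by
  have h : ‖v t‖ ^ 2 = 1 := by
    rw [norm_sq_frame _ t, inner_v_u, inner_v_v]; simp
  nlinarith [norm_nonneg (v t)]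

theorem abs_inner_u_le (p : Plane) (t : ℝ) : |inner ℝ p (u t)| ≤ ‖p‖ := by
  simpa [norm_u] using abs_real_inner_le_norm p (u t)

theorem abs_inner_v_le (p : Plane) (t : ℝ) : |inner ℝ p (v t)| ≤ ‖p‖ := by
  simpa [norm_v] using abs_real_inner_le_norm p (v t)

theorem hasDerivAt_inner_u (p : Plane) (t : ℝ) :
    HasDerivAt (fun t => inner ℝ p (u t)) (inner ℝ p (v t)) t := by
  simp only [inner_u, inner_v]
  convert! ((Real.hasDerivAt_cos t).const_mul (p 0)).add ((Real.hasDerivAt_sin t).const_mul (p 1))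
    using 1
  ring

theorem hasDerivAt_inner_v (p : Plane) (t : ℝ) :
    HasDerivAt (fun t => inner ℝ p (v t)) (-inner ℝ p (u t)) t := by
  simp only [inner_u, inner_v]
  convert! ((Real.hasDerivAt_sin t).const_mul (p 0)).neg.add
    ((Real.hasDerivAt_cos t).const_mul (p 1)) using 1
  ring

theorem continuous_inner_u (p : Plane) : Continuous fun t => inner ℝ p (u t) :=
  continuous_iff_continuousAt.2 fun t => (hasDerivAt_inner_u p t).continuousAt

theorem continuous_inner_v (p : Plane) : Continuous fun t => inner ℝ p (v t) :=
  continuous_iff_continuousAt.2 fun t => (hasDerivAt_inner_v p t).continuousAt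

theorem hasDerivAt_u (t : ℝ) : HasDerivAt u (v t) t := by
  have h : HasDerivAt (fun t => ![Real.cos t, Real.sin t]) ![-Real.sin t, Real.cos t] t := by
    refine hasDerivAt_pi.2 fun i => ?_
    fin_cases i
    · simpa using Real.hasDerivAt_cos t
    · simpa using Real.hasDerivAt_sin t
  exact ((PiLp.continuousLinearEquiv 2 ℝ (fun _ : Fin 2 => ℝ)).symm
    |>.hasFDerivAt.comp_hasDerivAt t h)

theorem hasDerivAt_v (t : ℝ) : HasDerivAt v (-u t) t := by
  have h : HasDerivAt (fun t => ![-Real.sin t, Real.cos t]) ![-Real.cos t, -Real.sin t] t := by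
    refine hasDerivAt_pi.2 fun i => ?_
    fin_cases i
    · simpa using (Real.hasDerivAt_sin t).fun_neg
    · simpa using Real.hasDerivAt_cos t
  convert! ((PiLp.continuousLinearEquiv 2 ℝ (fun _ : Fin 2 => ℝ)).symm
    |>.hasFDerivAt.comp_hasDerivAt t h) using 1
  ext i
  fin_cases i <;> simp [u]

theorem continuous_u : Continuous u := by
  unfold u; fun_prop

theorem continuous_v : Continuous v := by
  unfold v; fun_prop

theorem abs_inner_u_sub_le (p : Plane) (s t : ℝ) :
    |inner ℝ p (u t) - inner ℝ p (u s)| ≤ ‖p‖ * |t - s| := by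
  have := Convex.norm_image_sub_le_of_norm_hasDerivWithin_le (f := fun t => inner ℝ p (u t))
    (f' := fun t => inner ℝ p (v t)) (s := univ) (x := s) (y := t) (C := ‖p‖)
    (fun x _ => (hasDerivAt_inner_u p x).hasDerivWithinAt)
    (fun x _ => abs_inner_v_le p x) convex_univ (mem_univ _) (mem_univ _)
  simpa using this

theorem abs_inner_v_sub_le (p : Plane) (s t : ℝ) :
    |inner ℝ p (v t) - inner ℝ p (v s)| ≤ ‖p‖ * |t - s| := by
  have := Convex.norm_image_sub_le_of_norm_hasDerivWithin_le (f := fun t => inner ℝ p (v t))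
    (f' := fun t => -inner ℝ p (u t)) (s := univ) (x := s) (y := t) (C := ‖p‖)
    (fun x _ => (hasDerivAt_inner_v p x).hasDerivWithinAt)
    (fun x _ => by simpa using abs_inner_u_le p x) convex_univ (mem_univ _) (mem_univ _)
  simpa using this

/-! ### Support functions and edges -/

theorem bddAbove_inner_u (K : Body) (t : ℝ) :
    BddAbove ((fun p => inner ℝ p (u t)) '' (K : Set Plane)) :=
  (K.isCompact.image (by fun_prop)).bddAbove

theorem inner_le_supp {K : Body} {p : Plane} (hp : p ∈ K) (t : ℝ) : inner ℝ p (u t) ≤ supp K t :=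
  le_csSup (bddAbove_inner_u K t) ⟨p, hp, rfl⟩

theorem supp_le {K : Body} {t c : ℝ} (h : ∀ p ∈ K, inner ℝ p (u t) ≤ c) : supp K t ≤ c :=
  csSup_le (K.nonempty.image _) (by rintro _ ⟨p, hp, rfl⟩; exact h p hp)

theorem edge_nonempty (K : Body) (t : ℝ) : (edge K t).Nonempty := by
  obtain ⟨p, hp, h⟩ := (K.isCompact.image (f := fun p => inner ℝ p (u t)) (by fun_prop)).sSup_mem
    (K.nonempty.image _)
  exact ⟨p, hp, h⟩

theorem isCompact_edge (K : Body) (t : ℝ) : IsCompact (edge K t) :=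
  K.isCompact.inter_right
    (isClosed_eq (f := fun p : Plane => inner ℝ p (u t)) (by fun_prop) continuous_const)

theorem convex_edge (K : Body) (t : ℝ) : Convex ℝ (edge K t) := by
  rintro p ⟨hp, hp'⟩ q ⟨hq, hq'⟩ a b ha hb hab
  refine ⟨K.convex hp hq ha hb hab, ?_⟩
  rw [inner_add_left, inner_smul_left, inner_smul_left, hp', hq']
  simp [← add_mul, hab]

/-- The coordinate of `v_K^+(t)` along `v_t`, which is the right derivative of the support
function at `t`. -/
def suppDeriv (K : Body) (t : ℝ) : ℝ := sSup ((fun p => inner ℝ p (v t)) '' edge K t)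

/-- The coordinate of `v_K^-(t)` along `v_t`. -/
def suppDerivNeg (K : Body) (t : ℝ) : ℝ := sInf ((fun p => inner ℝ p (v t)) '' edge K t)

theorem vertexPos_eq (K : Body) (t : ℝ) :
    vertexPos K t = supp K t • u t + suppDeriv K t • v t := rfl

theorem vertexNeg_eq (K : Body) (t : ℝ) :
    vertexNeg K t = supp K t • u t + suppDerivNeg K t • v t := rfl

theorem isCompact_inner_v_edge (K : Body) (t : ℝ) :
    IsCompact ((fun p => inner ℝ p (v t)) '' edge K t) :=
  (isCompact_edge K t).image (by fun_prop)

theorem le_suppDeriv {K : Body} {t : ℝ} {p : Plane} (hp : p ∈ edge K t) :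
    inner ℝ p (v t) ≤ suppDeriv K t :=
  le_csSup (isCompact_inner_v_edge K t).bddAbove ⟨p, hp, rfl⟩

theorem suppDerivNeg_le {K : Body} {t : ℝ} {p : Plane} (hp : p ∈ edge K t) :
    suppDerivNeg K t ≤ inner ℝ p (v t) :=
  csInf_le (isCompact_inner_v_edge K t).bddBelow ⟨p, hp, rfl⟩

theorem inner_frame_u (a b t : ℝ) : inner ℝ (a • u t + b • v t) (u t) = a := by
  rw [inner_add_left, inner_smul_left, inner_smul_left, inner_u_u, inner_v_u]; simp

theorem inner_frame_v (a b t : ℝ) : inner ℝ (a • u t + b • v t) (v t) = b := by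
  rw [inner_add_left, inner_smul_left, inner_smul_left, inner_u_v, inner_v_v]; simp

theorem vertexPos_mem (K : Body) (t : ℝ) : vertexPos K t ∈ edge K t := by
  obtain ⟨p, hp, h⟩ := (isCompact_inner_v_edge K t).sSup_mem ((edge_nonempty K t).image _)
  have : vertexPos K t = p := by
    refine ext_frame t ?_ ?_
    · rw [vertexPos_eq, inner_frame_u, hp.2]
    · rw [vertexPos_eq, inner_frame_v]; exact h.symm
  rwa [this]

theorem vertexNeg_mem (K : Body) (t : ℝ) : vertexNeg K t ∈ edge K t := by
  obtain ⟨p, hp, h⟩ := (isCompact_inner_v_edge K t).sInf_mem ((edge_nonempty K t).image _)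
  have : vertexNeg K t = p := by
    refine ext_frame t ?_ ?_
    · rw [vertexNeg_eq, inner_frame_u, hp.2]
    · rw [vertexNeg_eq, inner_frame_v]; exact h.symm
  rwa [this]

@[simp] theorem inner_vertexPos_u (K : Body) (t : ℝ) :
    inner ℝ (vertexPos K t) (u t) = supp K t := inner_frame_u _ _ _

@[simp] theorem inner_vertexPos_v (K : Body) (t : ℝ) :
    inner ℝ (vertexPos K t) (v t) = suppDeriv K t := inner_frame_v _ _ _

@[simp] theorem inner_vertexNeg_v (K : Body) (t : ℝ) :
    inner ℝ (vertexNeg K t) (v t) = suppDerivNeg K t := inner_frame_v _ _ _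

theorem exists_norm_le (K : Body) : ∃ R, 0 < R ∧ ∀ p ∈ K, ‖p‖ ≤ R := by
  obtain ⟨R, hR⟩ := K.isCompact.isBounded.exists_norm_le
  exact ⟨max R 1, by positivity, fun p hp => (hR p hp).trans (le_max_left _ _)⟩

theorem abs_supp_le {K : Body} {R : ℝ} (hR : ∀ p ∈ K, ‖p‖ ≤ R) (t : ℝ) : |supp K t| ≤ R := by
  rw [← inner_vertexPos_u]
  exact (abs_inner_u_le _ _).trans (hR _ (vertexPos_mem K t).1)

theorem abs_suppDeriv_le {K : Body} {R : ℝ} (hR : ∀ p ∈ K, ‖p‖ ≤ R) (t : ℝ) :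
    |suppDeriv K t| ≤ R := by
  rw [← inner_vertexPos_v]
  exact (abs_inner_v_le _ _).trans (hR _ (vertexPos_mem K t).1)

theorem supp_sub_le {K : Body} {R : ℝ} (hR : ∀ p ∈ K, ‖p‖ ≤ R) (s t : ℝ) :
    supp K s - supp K t ≤ R * |s - t| := by
  have hm := (vertexPos_mem K s).1
  have h1 := inner_le_supp hm t
  have h2 := (le_abs_self _).trans (abs_inner_u_sub_le (vertexPos K s) t s)
  have h3 := mul_le_mul_of_nonneg_right (hR _ hm) (abs_nonneg (s - t))
  rw [inner_vertexPos_u] at h2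
  linarith

theorem continuous_supp (K : Body) : Continuous (supp K) := by
  obtain ⟨R, hR0, hR⟩ := exists_norm_le K
  refine (LipschitzWith.of_dist_le_mul (K := R.toNNReal) fun s t => ?_).continuous
  rw [Real.dist_eq, Real.dist_eq, Real.coe_toNNReal _ hR0.le, abs_le]
  have h1 := supp_sub_le hR s t
  have h2 := supp_sub_le hR t s
  rw [abs_sub_comm t s] at h2
  constructor <;> linarith

/-- The part of the boundary between two edges is spanned by the edge directions. -/
theorem exists_sub_eq_of_lt {K : Body} {r r' : ℝ} {z w : Plane} (hz : z ∈ edge K r)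
    (hw : w ∈ edge K r') (h : r < r') (h' : r' < r + Real.pi) :
    ∃ α β : ℝ, 0 ≤ α ∧ 0 ≤ β ∧ w - z = α • v r + β • v r' := by
  have hs : 0 < Real.sin (r' - r) := Real.sin_pos_of_pos_of_lt_pi (by linarith) (by linarith)
  have h1 : inner ℝ (w - z) (u r) ≤ 0 := by
    rw [inner_sub_left, hz.2]; linarith [inner_le_supp hw.1 r]
  have h2 : 0 ≤ inner ℝ (w - z) (u r') := by
    rw [inner_sub_left, hw.2]; linarith [inner_le_supp hz.1 r']
  -- Cramer's rule: `u r'` is orthogonal to `v r'` and `u r` to `v r`, so each pairing isolates one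
  -- coefficient, up to the factor ± sin (r' - r).
  refine ⟨inner ℝ (w - z) (u r') / Real.sin (r' - r), -inner ℝ (w - z) (u r) / Real.sin (r' - r),
    div_nonneg h2 hs.le, div_nonneg (by linarith) hs.le, ?_⟩
  have e := inner_u_rotate (w - z) r r'
  refine ext_frame r ?_ ?_
  · rw [inner_add_left, inner_smul_left, inner_smul_left, inner_v_u, inner_v_u]
    rw [← neg_sub r' r, Real.sin_neg]
    simp
    field_simp
  · rw [inner_add_left, inner_smul_left, inner_smul_left, inner_v_v, inner_v_v]
    rw [← neg_sub r' r, Real.cos_neg]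
    simp only [sub_self, Real.cos_zero, map_div₀, map_neg, conj_trivial]
    rw [e]
    field_simp
    ring

theorem sub_eq_of_mem_edge {K : Body} {r : ℝ} {z w : Plane} (hz : z ∈ edge K r)
    (hw : w ∈ edge K r) : w - z = (inner ℝ w (v r) - inner ℝ z (v r)) • v r := by
  refine ext_frame r ?_ ?_
  · rw [inner_smul_left, inner_v_u, inner_sub_left, hz.2, hw.2]; simp
  · rw [inner_smul_left, inner_v_v, inner_sub_left]; simp

/-- Boundary points move forward with the normal angle, measured along any direction `v m` that
makes an acute angle with all edges in between, at a definite rate. -/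
theorem norm_sub_le_of_edge_lt {K : Body} {r r' m c : ℝ} {z w : Plane} (hz : z ∈ edge K r)
    (hw : w ∈ edge K r') (h : r < r') (h' : r' < r + Real.pi) (hc : 0 ≤ c)
    (h1 : c ≤ Real.cos (m - r)) (h2 : c ≤ Real.cos (m - r')) :
    c * ‖w - z‖ ≤ inner ℝ (w - z) (v m) := by
  obtain ⟨α, β, hα, hβ, e⟩ := exists_sub_eq_of_lt hz hw h h'
  have hn : ‖w - z‖ ≤ α + β := by
    rw [e]
    refine (norm_add_le _ _).trans ?_
    rw [norm_smul, norm_smul, norm_v, norm_v, Real.norm_of_nonneg hα, Real.norm_of_nonneg hβ]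
    linarith
  rw [e, inner_add_left, inner_smul_left, inner_smul_left, inner_v_v, inner_v_v, ← e]
  simp only [conj_trivial]
  nlinarith [mul_le_mul_of_nonneg_left h1 hα, mul_le_mul_of_nonneg_left h2 hβ,
    mul_le_mul_of_nonneg_left hn hc]

theorem inner_sub_nonneg_of_edge_lt {K : Body} {r r' m : ℝ} {z w : Plane} (hz : z ∈ edge K r)
    (hw : w ∈ edge K r') (h : r < r') (h' : r' < r + Real.pi)
    (h1 : 0 ≤ Real.cos (m - r)) (h2 : 0 ≤ Real.cos (m - r')) :
    0 ≤ inner ℝ (w - z) (v m) := by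
  simpa using norm_sub_le_of_edge_lt hz hw h h' le_rfl h1 h2

/-- Two boundary points, over normal angles within a short interval, are at a distance comparable
to their distance along `v m`. -/
theorem norm_sub_le_of_mem_edge {K : Body} {r r' m c : ℝ} {z w : Plane} (hz : z ∈ edge K r)
    (hw : w ∈ edge K r') (h : |r' - r| < Real.pi) (hc : 0 ≤ c)
    (h1 : c ≤ Real.cos (m - r)) (h2 : c ≤ Real.cos (m - r')) :
    c * ‖w - z‖ ≤ |inner ℝ w (v m) - inner ℝ z (v m)| := by
  rw [abs_lt] at h
  rw [← inner_sub_left]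
  rcases lt_trichotomy r r' with hlt | heq | hgt
  · exact (norm_sub_le_of_edge_lt hz hw hlt (by linarith) hc h1 h2).trans (le_abs_self _)
  · subst heq
    rw [sub_eq_of_mem_edge hz hw, norm_smul, norm_v, inner_smul_left, inner_v_v, conj_trivial,
      abs_mul, Real.norm_eq_abs, abs_of_nonneg (hc.trans h1), mul_one, mul_comm]
    exact mul_le_mul_of_nonneg_left h1 (abs_nonneg _)
  · rw [← neg_sub z w, norm_neg, inner_neg_left, abs_neg]
    exact (norm_sub_le_of_edge_lt hw hz hgt (by linarith) hc h2 h1).trans (le_abs_self _)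

/-! ### The right derivative of the support function -/

/-- By compactness it suffices to identify cluster points. Such a point lies on the edge at t
because the support function is continuous, and not behind v⁺(t) because boundary points move
forward with the angle; v⁺(t) is the only such point. -/
theorem tendsto_vertexPos (K : Body) (t : ℝ) :
    Tendsto (vertexPos K) (𝓝[>] t) (𝓝 (vertexPos K t)) := by
  have hpi := Real.pi_pos
  refine K.isCompact.tendsto_nhds_of_unique_mapClusterPt
    (Eventually.of_forall fun s => (vertexPos_mem K s).1) fun q hq hcl => ?_
  obtain ⟨U, hU, hUq⟩ := mapClusterPt_iff_ultrafilter.1 hcl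
  have hid : Tendsto id (U : Filter ℝ) (𝓝 t) := hU.trans inf_le_left
  have e1 : inner ℝ q (u t) = supp K t := by
    have a1 : Tendsto (fun s => inner ℝ (vertexPos K s) (u s)) U (𝓝 (inner ℝ q (u t))) :=
      hUq.inner ((continuous_u.tendsto t).comp hid)
    have a2 : Tendsto (fun s => supp K s) U (𝓝 (supp K t)) :=
      ((continuous_supp K).tendsto t).comp hid
    simp only [inner_vertexPos_u] at a1
    exact tendsto_nhds_unique a1 a2
  have e2 : suppDeriv K t ≤ inner ℝ q (v t) := by
    have a1 : Tendsto (fun s => inner ℝ (vertexPos K s) (v t)) U (𝓝 (inner ℝ q (v t))) :=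
      hUq.inner tendsto_const_nhds
    refine ge_of_tendsto a1 (hU ?_)
    filter_upwards [Ioo_mem_nhdsGT (show t < t + Real.pi / 2 by linarith)] with s hs
    have := inner_sub_nonneg_of_edge_lt (m := t) (vertexPos_mem K t) (vertexPos_mem K s) hs.1
      (by linarith [hs.2]) (by simp)
      (Real.cos_nonneg_of_mem_Icc ⟨by linarith [hs.2], by linarith [hs.1]⟩)
    rw [inner_sub_left, inner_vertexPos_v] at this
    linarith
  refine ext_frame t (by rw [e1, inner_vertexPos_u]) ?_
  rw [inner_vertexPos_v]
  exact le_antisymm (le_suppDeriv ⟨hq, e1⟩) e2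

/-- The difference quotient of h between t and s > t lies between the pairings of the slope of `u`
with v⁺(t) and with v⁺(s), each vertex being a competitor in the other's maximum. Both bounds
converge by `tendsto_vertexPos`. -/
theorem hasDerivWithinAt_supp (K : Body) (t : ℝ) :
    HasDerivWithinAt (supp K) (suppDeriv K t) (Ioi t) t := by
  have hv : suppDeriv K t = inner ℝ (vertexPos K t) (v t) := (inner_vertexPos_v K t).symm
  have hslope : Tendsto (slope u t) (𝓝[>] t) (𝓝 (v t)) := by
    exact (hasDerivAt_iff_tendsto_slope.1 (hasDerivAt_u t)).mono_left
      (nhdsWithin_mono _ fun x hx => ne_of_gt hx)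
  rw [hasDerivWithinAt_iff_tendsto_slope' (by simp), hv]
  have key : ∀ p : Plane, ∀ s, inner ℝ p (slope u t s) =
      (inner ℝ p (u s) - inner ℝ p (u t)) / (s - t) := by
    intro p s
    rw [slope_def_module, inner_smul_right, inner_sub_right]; ring
  refine tendsto_of_tendsto_of_tendsto_of_le_of_le'
    (tendsto_const_nhds.inner hslope) ((tendsto_vertexPos K t).inner hslope) ?_ ?_
  · filter_upwards [self_mem_nhdsWithin] with s hs
    have hs' : 0 < s - t := sub_pos.2 hs
    rw [key, slope_def_field, inner_vertexPos_u]
    gcongr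
    exact inner_le_supp (vertexPos_mem K t).1 s
  · filter_upwards [self_mem_nhdsWithin] with s hs
    have hs' : 0 < s - t := sub_pos.2 hs
    rw [key, slope_def_field, inner_vertexPos_u]
    gcongr
    exact inner_le_supp (vertexPos_mem K s).1 t

theorem measurable_suppDeriv (K : Body) : Measurable (suppDeriv K) := by
  refine measurable_of_tendsto_metrizable
    (f := fun (n : ℕ) t => (supp K (t + 1 / ((n : ℝ) + 1)) - supp K t) / (1 / ((n : ℝ) + 1)))
    (fun n => ?_) (tendsto_pi_nhds.2 fun t => ?_)
  · have := continuous_supp K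
    exact Continuous.measurable (by fun_prop)
  · have h := (hasDerivWithinAt_iff_tendsto_slope' (by simp)).1 (hasDerivWithinAt_supp K t)
    have h1 : Tendsto (fun n : ℕ => t + 1 / ((n : ℝ) + 1)) atTop (𝓝[>] t) := by
      refine tendsto_nhdsWithin_iff.2 ⟨?_, Eventually.of_forall fun n => ?_⟩
      · simpa using tendsto_one_div_add_atTop_nhds_zero_nat.const_add t
      · simp only [mem_Ioi, lt_add_iff_pos_right]; positivity
    refine (h.comp h1).congr fun n => ?_
    simp [slope_def_field]

/-! ### Minkowski combinations -/

theorem supp_add (K L : Body) (t : ℝ) : supp (K + L) t = supp K t + supp L t := by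
  refine le_antisymm (supp_le fun p hp => ?_) ?_
  · rw [← SetLike.mem_coe, ConvexBody.coe_add] at hp
    obtain ⟨a, ha, b, hb, rfl⟩ := Set.mem_add.1 hp
    rw [inner_add_left]
    exact add_le_add (inner_le_supp ha t) (inner_le_supp hb t)
  · have : vertexPos K t + vertexPos L t ∈ K + L := by
      rw [← SetLike.mem_coe, ConvexBody.coe_add]
      exact add_mem_add (vertexPos_mem K t).1 (vertexPos_mem L t).1
    simpa [inner_add_left] using inner_le_supp this t

theorem supp_smul {c : ℝ} (hc : 0 ≤ c) (K : Body) (t : ℝ) : supp (c • K) t = c * supp K t := by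
  refine le_antisymm (supp_le fun p hp => ?_) ?_
  · rw [← SetLike.mem_coe, ConvexBody.coe_smul] at hp
    obtain ⟨a, ha, rfl⟩ := mem_smul_set.1 hp
    rw [inner_smul_left]
    exact mul_le_mul_of_nonneg_left (inner_le_supp ha t) hc
  · have : c • vertexPos K t ∈ c • K := by
      rw [← SetLike.mem_coe, ConvexBody.coe_smul]
      exact smul_mem_smul_set (vertexPos_mem K t).1
    simpa [inner_smul_left] using inner_le_supp this t

/-- The Minkowski combination `(1 - l) K + l L` of convex bodies. -/
abbrev comb (l : ℝ) (K L : Body) : Body := (1 - l) • K + l • L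

theorem supp_comb {l : ℝ} (hl : l ∈ Icc (0 : ℝ) 1) (K L : Body) (t : ℝ) :
    supp (comb l K L) t = (1 - l) * supp K t + l * supp L t := by
  rw [supp_add, supp_smul (by linarith [hl.2]), supp_smul hl.1]

/-- Uniqueness of right derivatives transfers linearity from h to h', with no need to describe the
edges of a Minkowski sum. -/
theorem suppDeriv_comb {l : ℝ} (hl : l ∈ Icc (0 : ℝ) 1) (K L : Body) (t : ℝ) :
    suppDeriv (comb l K L) t = (1 - l) * suppDeriv K t + l * suppDeriv L t := by
  have h1 := hasDerivWithinAt_supp (comb l K L) t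
  have h2 := ((hasDerivWithinAt_supp K t).const_mul (1 - l)).add
    ((hasDerivWithinAt_supp L t).const_mul l)
  have e : supp (comb l K L) = fun t => (1 - l) * supp K t + l * supp L t :=
    funext fun t => supp_comb hl K L t
  rw [e] at h1
  exact (uniqueDiffWithinAt_Ioi t).eq_deriv _ h1 h2

theorem vertexPos_comb {l : ℝ} (hl : l ∈ Icc (0 : ℝ) 1) (K L : Body) (t : ℝ) :
    vertexPos (comb l K L) t = (1 - l) • vertexPos K t + l • vertexPos L t := by
  simp only [vertexPos_eq, supp_comb hl, suppDeriv_comb hl]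
  module

theorem mem_comb {l : ℝ} {K L : Body} {p : Plane} :
    p ∈ comb l K L ↔ ∃ a ∈ K, ∃ b ∈ L, (1 - l) • a + l • b = p := by
  rw [← SetLike.mem_coe, ConvexBody.coe_add, ConvexBody.coe_smul, ConvexBody.coe_smul, Set.mem_add]
  simp [mem_smul_set]

theorem mem_of_inner_le_supp {K : Body} {p : Plane} (h : ∀ t, inner ℝ p (u t) ≤ supp K t) :
    p ∈ K := by
  by_contra hp
  obtain ⟨f, c, h1, h2⟩ := geometric_hahn_banach_closed_point K.convex K.isClosed hp
  obtain ⟨a, ha⟩ : ∃ a : Plane, ∀ x, f x = inner ℝ x a := by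
    refine ⟨(InnerProductSpace.toDual ℝ Plane).symm f, fun x => ?_⟩
    rw [real_inner_comm]; simp
  -- The separating functional is ‖z‖ times the pairing with `u` at the polar angle of z, so the
  -- hypothesis at that single angle contradicts the separation.
  set z : ℂ := ⟨a 0, a 1⟩ with hz
  have key : ∀ x : Plane, f x = ‖z‖ * inner ℝ x (u z.arg) := by
    intro x
    have e0 : ‖z‖ * Real.cos z.arg = a 0 := Complex.norm_mul_cos_arg z
    have e1 : ‖z‖ * Real.sin z.arg = a 1 := Complex.norm_mul_sin_arg z
    have e2 : inner ℝ x a = x 0 * a 0 + x 1 * a 1 := by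
      simp [PiLp.inner_apply, Fin.sum_univ_two]; ring
    rw [ha, inner_u, e2]
    linear_combination (-x 0) * e0 - x 1 * e1
  have h3 := h1 _ (vertexPos_mem K z.arg).1
  rw [key, inner_vertexPos_u] at h3
  rw [key] at h2
  have := mul_le_mul_of_nonneg_left (h z.arg) (norm_nonneg z)
  linarith

theorem eq_of_supp_eq {K L : Body} (h : ∀ t, supp K t = supp L t) : K = L := by
  refine ConvexBody.ext (Set.ext fun p => ⟨fun hp => ?_, fun hp => ?_⟩)
  · exact mem_of_inner_le_supp fun t => (inner_le_supp hp t).trans_eq (h t)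
  · exact mem_of_inner_le_supp fun t => (inner_le_supp hp t).trans_eq (h t).symm

/-! ### A comparison principle for additive interval functions -/

/-- Cutting [a, b] into short pieces and summing gives |ψ b - ψ a| ≤ ε (ω b - ω a) for every ε. This
is a form of "zero derivative implies constant" that allows the reference ω to be any function, even
a discontinuous one, such as a variation or a tangential coordinate. -/
theorem eq_of_forall_abs_sub_le {ψ ω : ℝ → ℝ} {a b : ℝ} (hab : a ≤ b)
    (h : ∀ ε > 0, ∃ δ > 0, ∀ s t, a ≤ s → s ≤ t → t ≤ b → t - s ≤ δ →
      |ψ t - ψ s| ≤ ε * (ω t - ω s)) : ψ b = ψ a := by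
  have key : ∀ ε > 0, |ψ b - ψ a| ≤ ε * (ω b - ω a) := by
    intro ε hε
    obtain ⟨δ, hδ, H⟩ := h ε hε
    obtain ⟨n, hn⟩ := exists_nat_gt ((b - a) / δ)
    have hn0 : (0 : ℝ) < n := (div_nonneg (by linarith) hδ.le).trans_lt hn
    set τ : ℕ → ℝ := fun k => a + k * ((b - a) / n) with hτ
    have hd : 0 ≤ (b - a) / n := div_nonneg (by linarith) hn0.le
    have hd' : (b - a) / n ≤ δ := by
      rw [div_lt_iff₀ hδ] at hn
      rw [div_le_iff₀ hn0]; linarith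
    have step : ∀ k : ℕ, k ≤ n → |ψ (τ k) - ψ a| ≤ ε * (ω (τ k) - ω a) := by
      intro k
      induction k with
      | zero => intro _; simp [hτ]
      | succ k ih =>
        intro hk
        have hk' : ((k + 1 : ℕ) : ℝ) ≤ n := by exact_mod_cast hk
        have e : τ (k + 1) = τ k + (b - a) / n := by simp only [hτ]; push_cast; ring
        have hb : τ (k + 1) ≤ b := by
          have := mul_le_mul_of_nonneg_right hk' hd
          rw [mul_div_cancel₀ _ hn0.ne'] at this
          simp only [hτ]; linarith
        have h1 := H (τ k) (τ (k + 1)) (by simp only [hτ]; nlinarith [Nat.cast_nonneg (α := ℝ) k])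
          (by linarith) hb (by linarith)
        have h2 := ih (by omega)
        have h3 := abs_add_le (ψ (τ (k + 1)) - ψ (τ k)) (ψ (τ k) - ψ a)
        rw [sub_add_sub_cancel] at h3
        nlinarith
    have e : τ n = b := by simp only [hτ]; field_simp; ring
    simpa [e] using step n le_rfl
  have h0 : |ψ b - ψ a| ≤ 0 := by
    have hlim : Tendsto (fun ε : ℝ => ε * (ω b - ω a)) (𝓝[>] 0) (𝓝 0) := by
      have : Tendsto (fun ε : ℝ => ε * (ω b - ω a)) (𝓝 0) (𝓝 (0 * (ω b - ω a))) :=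
        tendsto_id.mul_const _
      rw [zero_mul] at this
      exact this.mono_left inf_le_left
    exact ge_of_tendsto hlim (by filter_upwards [self_mem_nhdsWithin] with ε hε using key ε hε)
  exact sub_eq_zero.1 (abs_eq_zero.1 (le_antisymm h0 (abs_nonneg _)))

/-! ### The area under the upper boundary of a convex body -/

theorem integral_affine (c d X₁ X₂ : ℝ) :
    ∫ x in X₁..X₂, (c + d * x) = c * (X₂ - X₁) + d * (X₂ ^ 2 - X₁ ^ 2) / 2 := by
  rw [intervalIntegral.integral_add (by simp) (Continuous.intervalIntegrable (by fun_prop) _ _),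
    intervalIntegral.integral_const_mul, integral_id]
  simp; ring

theorem two_mul_integral_le_trapezoid {U : ℝ → ℝ} {X₁ X₂ Y₁ Y₂ : ℝ} (h : X₁ ≤ X₂)
    (hU : IntervalIntegrable U volume X₁ X₂)
    (hle : ∀ x ∈ Ioo X₁ X₂, (X₂ - X₁) * U x ≤ Y₁ * (X₂ - x) + Y₂ * (x - X₁)) :
    2 * ∫ x in X₁..X₂, U x ≤ (Y₁ + Y₂) * (X₂ - X₁) := by
  rcases h.eq_or_lt with rfl | hlt
  · simp
  have hd : 0 < X₂ - X₁ := sub_pos.2 hlt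
  have h1 := intervalIntegral.integral_mono_on_of_le_Ioo h hU
    (g := fun x => (Y₁ * X₂ - Y₂ * X₁) / (X₂ - X₁) + (Y₂ - Y₁) / (X₂ - X₁) * x)
    (Continuous.intervalIntegrable (by fun_prop) _ _) (fun x hx => by
      have := hle x hx
      rw [← mul_div_right_comm, ← add_div, le_div_iff₀ hd]
      linarith)
  rw [integral_affine] at h1
  have e : (Y₁ * X₂ - Y₂ * X₁) / (X₂ - X₁) * (X₂ - X₁) +
      (Y₂ - Y₁) / (X₂ - X₁) * (X₂ ^ 2 - X₁ ^ 2) / 2 = (Y₁ + Y₂) * (X₂ - X₁) / 2 := by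
    field_simp
    ring
  linarith

theorem trapezoid_le_two_mul_integral {U : ℝ → ℝ} {X₁ X₂ Y₁ Y₂ : ℝ} (h : X₁ ≤ X₂)
    (hU : IntervalIntegrable U volume X₁ X₂)
    (hle : ∀ x ∈ Ioo X₁ X₂, Y₁ * (X₂ - x) + Y₂ * (x - X₁) ≤ (X₂ - X₁) * U x) :
    (Y₁ + Y₂) * (X₂ - X₁) ≤ 2 * ∫ x in X₁..X₂, U x := by
  have := two_mul_integral_le_trapezoid (U := fun x => -U x) (Y₁ := -Y₁) (Y₂ := -Y₂) h hU.neg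
    (fun x hx => by have := hle x hx; linarith)
  rw [intervalIntegral.integral_neg] at this
  linarith

/-- `U` describes the upper boundary of `K` over the open interval `(X₁, X₂)`, in the coordinates
along `v m` and `u m`. -/
def IsUpperBoundary (K : Body) (m : ℝ) (U : ℝ → ℝ) (X₁ X₂ : ℝ) : Prop :=
  ∀ x ∈ Ioo X₁ X₂, U x • u m + x • v m ∈ K ∧ ∀ y : ℝ, y • u m + x • v m ∈ K → y ≤ U x

theorem half_le_cos {x : ℝ} (h : |x| ≤ Real.pi / 3) : 1 / 2 ≤ Real.cos x := by
  rw [← Real.cos_pi_div_three, ← Real.cos_abs x]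
  exact Real.cos_le_cos_of_nonneg_of_le_pi (abs_nonneg x) (by linarith [Real.pi_pos]) h

theorem intervalIntegrable_suppDeriv_sq (K : Body) (a b : ℝ) :
    IntervalIntegrable (fun t => suppDeriv K t ^ 2) volume a b := by
  obtain ⟨R, hR0, hR⟩ := exists_norm_le K
  refine (intervalIntegrable_const (c := R ^ 2)).mono_fun
    ((measurable_suppDeriv K).pow_const 2).aestronglyMeasurable (Eventually.of_forall fun t => ?_)
  have := abs_suppDeriv_le hR t
  beta_reduce
  rw [Real.norm_of_nonneg (by positivity), Real.norm_of_nonneg (by positivity), sq_le_sq,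
    abs_of_pos hR0]
  exact this

theorem intervalIntegrable_supp_sq_sub (K : Body) (a b : ℝ) :
    IntervalIntegrable (fun t => supp K t ^ 2 - suppDeriv K t ^ 2) volume a b :=
  (((continuous_supp K).pow 2).intervalIntegrable a b).sub (intervalIntegrable_suppDeriv_sq K a b)

theorem intervalIntegrable_inner_sq_sub (p : Plane) (s t : ℝ) :
    IntervalIntegrable (fun r => inner ℝ p (u r) ^ 2 - inner ℝ p (v r) ^ 2) volume s t :=
  (((continuous_inner_u p).pow 2).sub ((continuous_inner_v p).pow 2)).intervalIntegrable _ _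

theorem integral_inner_sq_sub (p : Plane) (s t : ℝ) :
    ∫ r in s..t, (inner ℝ p (u r) ^ 2 - inner ℝ p (v r) ^ 2) =
      inner ℝ p (u s) * inner ℝ p (v s) - inner ℝ p (u t) * inner ℝ p (v t) := by
  have hd : ∀ r ∈ uIcc s t, HasDerivAt (fun r => -(inner ℝ p (u r) * inner ℝ p (v r)))
      (inner ℝ p (u r) ^ 2 - inner ℝ p (v r) ^ 2) r := fun r _ => by
    convert! ((hasDerivAt_inner_u p r).mul (hasDerivAt_inner_v p r)).neg using 1
    ring
  rw [intervalIntegral.integral_eq_sub_of_hasDerivAt hd]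
  · ring
  · exact intervalIntegrable_inner_sq_sub p s t

/-- The boundary between p and q lies above the chord and below the two supporting lines. The chord
alone contributes exactly `cross p q`; the error is at most twice the area of the triangle cut off
by chord and supporting lines, α β sin (t - s), which is of second order. -/
theorem abs_two_mul_integral_upper_sub_le {K : Body} {m s t R : ℝ} {U : ℝ → ℝ} {p q : Plane}
    (hR : ∀ p ∈ K, ‖p‖ ≤ R) (hp : p ∈ edge K s) (hq : q ∈ edge K t) (hst : s < t)
    (hst' : t - s ≤ Real.pi / 3) (hs : m - Real.pi / 2 ≤ s) (ht : t ≤ m + Real.pi / 2)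
    (hU : IsUpperBoundary K m U (inner ℝ p (v m)) (inner ℝ q (v m)))
    (hint : IntervalIntegrable U volume (inner ℝ p (v m)) (inner ℝ q (v m))) :
    |2 * (∫ x in inner ℝ p (v m)..inner ℝ q (v m), U x) -
      (inner ℝ q (v m) * inner ℝ q (u m) - inner ℝ p (v m) * inner ℝ p (u m)) - cross p q| ≤
      8 * R * ((t - s) * ‖q - p‖) := by
  have hpi := Real.pi_pos
  obtain ⟨α, β, hα, hβ, e⟩ := exists_sub_eq_of_lt hp hq hst (by linarith)
  have hcs : 0 ≤ Real.cos (s - m) := Real.cos_nonneg_of_mem_Icc ⟨by linarith, by linarith⟩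
  have hct : 0 ≤ Real.cos (t - m) := Real.cos_nonneg_of_mem_Icc ⟨by linarith, by linarith⟩
  have hc : 1 / 2 ≤ Real.cos (t - s) := half_le_cos (by rw [abs_of_pos] <;> linarith)
  have hsin : Real.sin (t - s) ≤ t - s := Real.sin_le (by linarith)
  have hsin0 : 0 ≤ Real.sin (t - s) := Real.sin_nonneg_of_nonneg_of_le_pi (by linarith)
    (by linarith)
  have hn := norm_nonneg (q - p)
  have hvs : α + β * Real.cos (t - s) ≤ ‖q - p‖ := by
    have h1 := (le_abs_self _).trans (abs_inner_v_le (q - p) s)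
    have h2 : inner ℝ (q - p) (v s) = α + β * Real.cos (t - s) := by
      rw [e, inner_add_left, inner_smul_left, inner_smul_left, inner_v_v, inner_v_v,
        ← neg_sub t s, Real.cos_neg]
      simp
    linarith
  -- Projecting q - p = α v_s + β v_t on v_s, where cos (t - s) ≥ 1/2, bounds both coefficients.
  have hα' : α ≤ ‖q - p‖ := by nlinarith
  have hβ' : β ≤ 2 * ‖q - p‖ := by nlinarith
  have hnR : ‖q - p‖ ≤ 2 * R := by
    linarith [norm_sub_le q p, hR _ hp.1, hR _ hq.1]
  have key1 : ∀ (w : ℝ) (x y : ℝ), inner ℝ (y • u m + x • v m) (u w) =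
      y * Real.cos (w - m) + x * Real.sin (w - m) := by
    intro w x y
    rw [inner_add_left, inner_smul_left, inner_smul_left, inner_u_u, inner_v_u]; simp
  have eX : inner ℝ q (v m) = inner ℝ p (v m) + α * Real.cos (s - m) + β * Real.cos (t - m) := by
    have : q = p + (α • v s + β • v t) := by rw [← e]; abel
    conv_lhs => rw [this]
    rw [inner_add_left, inner_add_left, inner_smul_left, inner_smul_left, inner_v_v, inner_v_v,
      ← neg_sub s m, ← neg_sub t m, Real.cos_neg, Real.cos_neg]
    simp; ring
  have eY : inner ℝ q (u m) = inner ℝ p (u m) - α * Real.sin (s - m) - β * Real.sin (t - m) := by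
    have : q = p + (α • v s + β • v t) := by rw [← e]; abel
    conv_lhs => rw [this]
    rw [inner_add_left, inner_add_left, inner_smul_left, inner_smul_left, inner_v_u, inner_v_u,
      ← neg_sub s m, ← neg_sub t m, Real.sin_neg, Real.sin_neg]
    simp; ring
  have hps : supp K s = inner ℝ p (u m) * Real.cos (s - m) + inner ℝ p (v m) * Real.sin (s - m) := by
    rw [← hp.2, ← key1, ← eq_frame]
  have hqt : supp K t = inner ℝ q (u m) * Real.cos (t - m) + inner ℝ q (v m) * Real.sin (t - m) := by
    rw [← hq.2, ← key1, ← eq_frame]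
  have ecross : cross p q = inner ℝ p (u m) * inner ℝ q (v m) - inner ℝ p (v m) * inner ℝ q (u m) :=
    cross_frame p q m
  have esin : Real.sin (t - s) = Real.sin (t - m) * Real.cos (s - m) -
      Real.cos (t - m) * Real.sin (s - m) := by
    rw [← Real.sin_sub]; congr 1; ring
  set Xp := inner ℝ p (v m)
  set Yp := inner ℝ p (u m)
  set Xq := inner ℝ q (v m)
  set Yq := inner ℝ q (u m)
  have hαc := mul_nonneg hα hcs
  have hβc := mul_nonneg hβ hct
  have hXpq : Xp ≤ Xq := by linarith
  -- the chord
  have hlow : (Yp + Yq) * (Xq - Xp) ≤ 2 * ∫ x in Xp..Xq, U x := by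
    refine trapezoid_le_two_mul_integral hXpq hint fun x hx => ?_
    have hd : 0 < Xq - Xp := by linarith [hx.1, hx.2]
    have hmem : ((Xq - x) / (Xq - Xp)) • p + ((x - Xp) / (Xq - Xp)) • q ∈ K :=
      K.convex hp.1 hq.1 (div_nonneg (by linarith [hx.2]) hd.le)
        (div_nonneg (by linarith [hx.1]) hd.le) (by field_simp; ring)
    have e2 : ((Xq - x) / (Xq - Xp)) • p + ((x - Xp) / (Xq - Xp)) • q =
        ((Yp * (Xq - x) + Yq * (x - Xp)) / (Xq - Xp)) • u m + x • v m := by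
      refine ext_frame m ?_ ?_
      · rw [inner_frame_u, inner_add_left, inner_smul_left, inner_smul_left]
        simp only [conj_trivial]
        change _ * Yp + _ * Yq = _
        ring
      · rw [inner_frame_v, inner_add_left, inner_smul_left, inner_smul_left]
        simp only [conj_trivial]
        change _ * Xp + _ * Xq = _
        field_simp
        ring
    rw [e2] at hmem
    have := (hU x hx).2 _ hmem
    rw [div_le_iff₀ hd] at this
    linarith
  -- the supporting lines
  set Xz := Xp + α * Real.cos (s - m) with hXz
  set Yz := Yp - α * Real.sin (s - m) with hYz
  have hz1 : Xp ≤ Xz := by linarith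
  have hz2 : Xz ≤ Xq := by linarith
  have hint1 : IntervalIntegrable U volume Xp Xz := hint.mono_set (by
    rw [uIcc_of_le hz1, uIcc_of_le hXpq]; exact Icc_subset_Icc_right hz2)
  have hint2 : IntervalIntegrable U volume Xz Xq := hint.mono_set (by
    rw [uIcc_of_le hz2, uIcc_of_le hXpq]; exact Icc_subset_Icc_left hz1)
  have hup1 : 2 * ∫ x in Xp..Xz, U x ≤ (Yp + Yz) * (Xz - Xp) := by
    refine two_mul_integral_le_trapezoid hz1 hint1 fun x hx => ?_
    have h1 := mul_le_mul_of_nonneg_left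
      (inner_le_supp (hU x ⟨hx.1, hx.2.trans_le hz2⟩).1 s) hα
    rw [key1, hps] at h1
    rw [hXz, hYz]
    linarith
  have hup2 : 2 * ∫ x in Xz..Xq, U x ≤ (Yz + Yq) * (Xq - Xz) := by
    refine two_mul_integral_le_trapezoid hz2 hint2 fun x hx => ?_
    have h1 := mul_le_mul_of_nonneg_left
      (inner_le_supp (hU x ⟨hz1.trans_lt hx.1, hx.2⟩).1 t) hβ
    rw [key1, hqt] at h1
    have h2 : Xq - Xz = β * Real.cos (t - m) := by rw [eX, hXz]; ring
    have h3 : Yz = Yq + β * Real.sin (t - m) := by rw [eY, hYz]; ring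
    have h4 : Xz = Xq - β * Real.cos (t - m) := by linarith
    rw [h3, h4]
    linarith
  have hadd := intervalIntegral.integral_add_adjacent_intervals hint1 hint2
  have hprod : α * β * Real.sin (t - s) ≤ 8 * R * ((t - s) * ‖q - p‖) := by
    have h1 : α * β ≤ 2 * ‖q - p‖ ^ 2 := by
      calc α * β ≤ ‖q - p‖ * (2 * ‖q - p‖) := mul_le_mul hα' hβ' hβ hn
        _ = _ := by ring
    have h2 : α * β * Real.sin (t - s) ≤ 2 * ‖q - p‖ ^ 2 * (t - s) :=
      mul_le_mul h1 hsin hsin0 (by positivity)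
    have h3 := mul_le_mul_of_nonneg_left hnR (mul_nonneg (sub_pos.2 hst).le hn)
    have h4 : 0 ≤ (t - s) * ‖q - p‖ * R :=
      mul_nonneg (mul_nonneg (sub_pos.2 hst).le hn) ((norm_nonneg p).trans (hR _ hp.1))
    linarith
  rw [ecross, abs_le]
  constructor
  · have : 0 ≤ 8 * R * ((t - s) * ‖q - p‖) :=
      (mul_nonneg (mul_nonneg hα hβ) hsin0).trans hprod
    linarith
  · refine le_trans ?_ hprod
    have : (Yp + Yz) * (Xz - Xp) + (Yz + Yq) * (Xq - Xz) - (Yp + Yq) * (Xq - Xp) =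
        α * β * Real.sin (t - s) := by
      rw [esin, eX, eY, hXz, hYz]; ring
    linarith

/-- On a short interval the body is replaced by the point p, for which the integral is explicit
(`integral_inner_sq_sub`). The vertices in between are within 2‖q - p‖ of p, so the replacement
costs O((t - s)‖q - p‖). -/
theorem abs_integral_supp_sq_sub_le {K : Body} {s t R : ℝ} {p q : Plane}
    (hR : ∀ p ∈ K, ‖p‖ ≤ R) (hp : p ∈ edge K s) (hq : q ∈ edge K t) (hst : s < t)
    (hst' : t - s ≤ Real.pi / 3) :
    |(∫ r in s..t, (supp K r ^ 2 - suppDeriv K r ^ 2)) +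
      (supp K t * inner ℝ q (v t) - supp K s * inner ℝ p (v s)) - cross p q| ≤
      12 * R * ((t - s) * ‖q - p‖) := by
  have hpi := Real.pi_pos
  have hn := norm_nonneg (q - p)
  have hpR := hR _ hp.1
  have hqR := hR _ hq.1
  have hR0 : 0 ≤ R := (norm_nonneg p).trans hpR
  have hvs : inner ℝ (q - p) (v s) ≤ ‖q - p‖ := (le_abs_self _).trans (abs_inner_v_le (q - p) s)
  have h1 : |∫ r in s..t, ((supp K r ^ 2 - suppDeriv K r ^ 2) -
      (inner ℝ p (u r) ^ 2 - inner ℝ p (v r) ^ 2))| ≤ 8 * R * ‖q - p‖ * (t - s) := by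
    rw [← Real.norm_eq_abs]
    refine (intervalIntegral.norm_integral_le_of_norm_le_const_ae (C := 8 * R * ‖q - p‖) ?_).trans_eq
      (by rw [abs_of_pos (sub_pos.2 hst)])
    -- The angle r = t is discarded: v⁺(t) may lie beyond q on the edge at t, so it need not be
    -- close to p.
    filter_upwards [compl_mem_ae_iff.2 (measure_singleton (μ := volume) t)] with r hrt hr
    rw [uIoc_of_le hst.le] at hr
    have hrt' : r < t := lt_of_le_of_ne hr.2 hrt
    set z := vertexPos K r
    have hz := vertexPos_mem K r
    have hzR := hR _ hz.1
    have a1 := norm_sub_le_of_edge_lt (m := s) hp hz hr.1 (by linarith) (c := 1 / 2) (by norm_num)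
      (by simp; norm_num) (half_le_cos (by rw [abs_sub_comm, abs_of_pos] <;> linarith [hr.1]))
    have a2 := inner_sub_nonneg_of_edge_lt (m := s) hz hq hrt' (by linarith [hr.1])
      ((half_le_cos (by rw [abs_sub_comm, abs_of_pos] <;> linarith [hr.1])).trans' (by norm_num))
      ((half_le_cos (by rw [abs_sub_comm, abs_of_pos] <;> linarith)).trans' (by norm_num))
    have a3 : ‖z - p‖ ≤ 2 * ‖q - p‖ := by
      rw [inner_sub_left] at a1 a2 hvs
      linarith
    have b1 : |supp K r ^ 2 - inner ℝ p (u r) ^ 2| ≤ 2 * ‖q - p‖ * (2 * R) := by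
      have : supp K r ^ 2 - inner ℝ p (u r) ^ 2 =
          inner ℝ (z - p) (u r) * inner ℝ (z + p) (u r) := by
        rw [inner_sub_left, inner_add_left, inner_vertexPos_u]; ring
      rw [this, abs_mul]
      refine mul_le_mul ((abs_inner_u_le _ _).trans a3) ?_ (abs_nonneg _) (by positivity)
      linarith [abs_inner_u_le (z + p) r, norm_add_le z p]
    have b2 : |suppDeriv K r ^ 2 - inner ℝ p (v r) ^ 2| ≤ 2 * ‖q - p‖ * (2 * R) := by
      have : suppDeriv K r ^ 2 - inner ℝ p (v r) ^ 2 =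
          inner ℝ (z - p) (v r) * inner ℝ (z + p) (v r) := by
        rw [inner_sub_left, inner_add_left, inner_vertexPos_v]; ring
      rw [this, abs_mul]
      refine mul_le_mul ((abs_inner_v_le _ _).trans a3) ?_ (abs_nonneg _) (by positivity)
      linarith [abs_inner_v_le (z + p) r, norm_add_le z p]
    rw [Real.norm_eq_abs]
    rw [abs_le] at b1 b2 ⊢
    constructor <;> linarith
  rw [intervalIntegral.integral_sub (intervalIntegrable_supp_sq_sub K s t)
    (intervalIntegrable_inner_sq_sub p s t),
    integral_inner_sq_sub] at h1
  obtain ⟨α, β, hα, hβ, e⟩ := exists_sub_eq_of_lt hp hq hst (by linarith)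
  have hc : 1 / 2 ≤ Real.cos (t - s) := half_le_cos (by rw [abs_of_pos] <;> linarith)
  have hsin : Real.sin (t - s) ≤ t - s := Real.sin_le (by linarith)
  have hsin0 : 0 ≤ Real.sin (t - s) := Real.sin_nonneg_of_nonneg_of_le_pi (by linarith)
    (by linarith)
  have hα' : α ≤ ‖q - p‖ := by
    have h2 : inner ℝ (q - p) (v s) = α + β * Real.cos (t - s) := by
      rw [e, inner_add_left, inner_smul_left, inner_smul_left, inner_v_v, inner_v_v,
        ← neg_sub t s, Real.cos_neg]
      simp
    nlinarith
  have h2 : inner ℝ (q - p) (u t) = α * Real.sin (t - s) := by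
    rw [e, inner_add_left, inner_smul_left, inner_smul_left, inner_v_u, inner_v_u]; simp
  -- This product is exactly what remains once p replaces the body. It is small because q - p has `u
  -- t`-coordinate α sin (t - s).
  have h3 : |inner ℝ (q - p) (u t) * inner ℝ (q + p) (v t)| ≤ (t - s) * ‖q - p‖ * (2 * R) := by
    rw [abs_mul]
    refine mul_le_mul ?_ ?_ (abs_nonneg _) (mul_nonneg (by linarith) hn)
    · rw [h2, abs_of_nonneg (mul_nonneg hα hsin0)]
      nlinarith [mul_le_mul hα' hsin hsin0 hn]
    · linarith [abs_inner_v_le (q + p) t, norm_add_le q p]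
  have h4 : (0 : ℝ) ≤ (t - s) * ‖q - p‖ * R :=
    mul_nonneg (mul_nonneg (by linarith) hn) hR0
  rw [inner_sub_left, inner_add_left] at h3
  rw [← hq.2, ← hp.2, cross_frame p q t]
  rw [abs_le] at h1 h3 ⊢
  constructor <;> nlinarith

/-- The area under the upper boundary of a convex body, in terms of its support function. -/
theorem two_mul_integral_upper {K : Body} {m a b : ℝ} {U : ℝ → ℝ} {P : ℝ → Plane} (hab : a ≤ b)
    (hP : ∀ t, P t ∈ edge K t) (ha : m - Real.pi / 2 ≤ a) (hb : b ≤ m + Real.pi / 2)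
    (hU : IsUpperBoundary K m U (inner ℝ (P a) (v m)) (inner ℝ (P b) (v m)))
    (hint : IntervalIntegrable U volume (inner ℝ (P a) (v m)) (inner ℝ (P b) (v m))) :
    2 * ∫ x in inner ℝ (P a) (v m)..inner ℝ (P b) (v m), U x =
      inner ℝ (P b) (v m) * inner ℝ (P b) (u m) - inner ℝ (P a) (v m) * inner ℝ (P a) (u m) +
      (supp K b * inner ℝ (P b) (v b) - supp K a * inner ℝ (P a) (v a)) +
      ∫ t in a..b, (supp K t ^ 2 - suppDeriv K t ^ 2) := by
  have hpi := Real.pi_pos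
  obtain ⟨R, hR0, hR⟩ := exists_norm_le K
  have hmono : ∀ s t, a ≤ s → s ≤ t → t ≤ b → inner ℝ (P s) (v m) ≤ inner ℝ (P t) (v m) := by
    intro s t has hst htb
    rcases hst.eq_or_lt with rfl | hlt
    · rfl
    rcases lt_or_ge t (s + Real.pi) with hlt' | hge
    · have := inner_sub_nonneg_of_edge_lt (m := m) (hP s) (hP t) hlt hlt'
        (Real.cos_nonneg_of_mem_Icc ⟨by linarith, by linarith⟩)
        (Real.cos_nonneg_of_mem_Icc ⟨by linarith, by linarith⟩)
      rw [inner_sub_left] at this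
      linarith
    -- An angular distance of π forces s and t to be the two extreme angles. Then u_t = v_m, and P t
    -- maximizes the coordinate along v_m.
    · have e1 : s = m - Real.pi / 2 := by linarith
      have e2 : t = m + Real.pi / 2 := by linarith
      have hv : ∀ p : Plane, inner ℝ p (u t) = inner ℝ p (v m) := fun p => by
        rw [inner_u_rotate p m t, e2]; simp
      rw [← hv (P t), (hP t).2, ← hv (P s)]
      exact inner_le_supp (hP s).1 t
  have hsub : ∀ s t, a ≤ s → s ≤ t → t ≤ b →
      IntervalIntegrable U volume (inner ℝ (P s) (v m)) (inner ℝ (P t) (v m)) := by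
    intro s t has hst htb
    refine hint.mono_set ?_
    rw [uIcc_of_le (hmono s t has hst htb), uIcc_of_le (hmono a b le_rfl hab le_rfl)]
    exact Icc_subset_Icc (hmono a s le_rfl has (hst.trans htb))
      (hmono t b (has.trans hst) htb le_rfl)
  have key := eq_of_forall_abs_sub_le (a := a) (b := b)
    (ψ := fun t => 2 * (∫ x in inner ℝ (P a) (v m)..inner ℝ (P t) (v m), U x) -
      inner ℝ (P t) (v m) * inner ℝ (P t) (u m) - supp K t * inner ℝ (P t) (v t) -
      ∫ r in a..t, (supp K r ^ 2 - suppDeriv K r ^ 2))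
    -- The tangential coordinate of P t can decrease only through the rotation of the frame, at rate
    -- at most R. Adding R t compensates for this, so the increments of ω dominate ‖P t - P s‖.
    (ω := fun t => 2 * (inner ℝ (P t) (v t) + R * t)) hab ?_
  · simp only [intervalIntegral.integral_same] at key
    linarith
  intro ε hε
  -- 20 = 8 + 12 adds the constants of the two local estimates, both of which compare with `cross (P
  -- s) (P t)`.
  refine ⟨min (Real.pi / 3) (ε / (20 * R)), by positivity, fun s t has hst htb hδ => ?_⟩
  rcases hst.eq_or_lt with rfl | hlt
  · simp
  have hδ1 := hδ.trans (min_le_left _ _)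
  have hδ2 := hδ.trans (min_le_right _ _)
  have h1 := abs_two_mul_integral_upper_sub_le hR (hP s) (hP t) hlt hδ1 (by linarith)
    (by linarith) (m := m) (U := U) (fun x hx => hU x
      ⟨(hmono a s le_rfl has (by linarith)).trans_lt hx.1,
        hx.2.trans_le (hmono t b (by linarith) htb le_rfl)⟩) (hsub s t has hst htb)
  have h2 := abs_integral_supp_sq_sub_le hR (hP s) (hP t) hlt hδ1
  have h3 : 1 / 2 * ‖P t - P s‖ ≤ inner ℝ (P t - P s) (v t) :=
    norm_sub_le_of_edge_lt (hP s) (hP t) hlt (by linarith) (by norm_num)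
      (half_le_cos (by rwa [abs_of_pos (sub_pos.2 hlt)])) (by simp; norm_num)
  have h4 : ‖P t - P s‖ ≤ 2 * (inner ℝ (P t) (v t) + R * t) - 2 * (inner ℝ (P s) (v s) + R * s) := by
    have a1 := (abs_le.1 (abs_inner_v_sub_le (P s) s t)).1
    have a2 := mul_le_mul_of_nonneg_right (hR _ (hP s).1) (abs_nonneg (t - s))
    rw [abs_of_pos (sub_pos.2 hlt)] at a1 a2
    rw [inner_sub_left] at h3
    linarith
  have e1 := intervalIntegral.integral_add_adjacent_intervals
    (hsub a s le_rfl has (by linarith)) (hsub s t has hst htb)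
  have e2 := intervalIntegral.integral_add_adjacent_intervals
    (intervalIntegrable_supp_sq_sub K a s) (intervalIntegrable_supp_sq_sub K s t)
  have h5 : 20 * R * (t - s) ≤ ε := by
    rw [le_div_iff₀ (by positivity)] at hδ2
    linarith
  have h6 : 20 * R * ((t - s) * ‖P t - P s‖) ≤
      ε * (2 * (inner ℝ (P t) (v t) + R * t) - 2 * (inner ℝ (P s) (v s) + R * s)) := by
    rw [← mul_assoc]
    exact mul_le_mul h5 h4 (norm_nonneg _) hε.le
  refine le_trans ?_ h6
  simp only [← e1, ← e2]
  rw [abs_le] at h1 h2 ⊢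
  constructor <;> linarith

/-! ### The curve area functional as an additive interval function -/

/-- The variation is dominated by the sum of the total variations of the two coordinate signed
measures, which are finite. -/
theorem isFiniteMeasure_variation (μ : VectorMeasure ℝ Plane) : IsFiniteMeasure μ.variation := by
  let π (i : Fin 2) : Plane →+ ℝ := ((EuclideanSpace.proj i : Plane →L[ℝ] ℝ) : Plane →+ ℝ)
  have hπ (i : Fin 2) : Continuous (π i) := (EuclideanSpace.proj i : Plane →L[ℝ] ℝ).continuous
  let ν (i : Fin 2) : SignedMeasure ℝ := μ.mapRange (π i) (hπ i)
  refine isFiniteMeasure_of_le ((ν 0).totalVariation + (ν 1).totalVariation)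
    (VectorMeasure.variation_le_of_forall_enorm_le fun E _ => ?_)
  have h1 : ‖μ E‖ₑ ≤ ‖ν 0 E‖ₑ + ‖ν 1 E‖ₑ := by
    have h2 : ‖μ E‖ ≤ ‖ν 0 E‖ + ‖ν 1 E‖ := by
      rw [EuclideanSpace.norm_eq, Fin.sum_univ_two]
      change √(‖ν 0 E‖ ^ 2 + ‖ν 1 E‖ ^ 2) ≤ _
      rw [Real.sqrt_le_left (by positivity)]
      nlinarith [norm_nonneg (ν 0 E), norm_nonneg (ν 1 E)]
    rw [← ofReal_norm, ← ofReal_norm, ← ofReal_norm, ← ENNReal.ofReal_add (norm_nonneg _)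
      (norm_nonneg _)]
    exact ENNReal.ofReal_le_ofReal h2
  rw [Measure.add_apply]
  exact h1.trans (add_le_add (SignedMeasure.enorm_le_totalVariation _ _)
    (SignedMeasure.enorm_le_totalVariation _ _))

theorem continuous_clamp {a b : ℝ} {x : ℝ → Plane} (hab : a ≤ b) (hx : ContinuousOn x (Icc a b)) :
    Continuous (clamp a b x) :=
  hx.comp_continuous (by fun_prop) fun t => ⟨le_max_left _ _, max_le hab (min_le_left _ _)⟩

theorem boundedVariationOn_clamp {a b : ℝ} {x : ℝ → Plane} (hab : a ≤ b)
    (hx : BoundedVariationOn x (Icc a b)) : BoundedVariationOn (clamp a b x) univ := by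
  refine ne_top_of_le_ne_top hx (eVariationOn.comp_le_of_monotoneOn x
    (fun t => max a (min b t)) (fun s _ t _ hst => ?_)
    fun t _ => ⟨le_max_left _ _, max_le hab (min_le_left _ _)⟩)
  exact max_le_max le_rfl (min_le_min le_rfl hst)

theorem clamp_of_mem {a b t : ℝ} {x : ℝ → Plane} (ht : t ∈ Icc a b) : clamp a b x t = x t := by
  simp [clamp, ht.1, ht.2]

/-- The curve area functional is determined by its behaviour on short arcs. -/
theorem two_mul_curveArea_eq {a b : ℝ} {x : ℝ → Plane} {F : ℝ → ℝ} (hab : a ≤ b)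
    (hx : ContinuousOn x (Icc a b)) (hbv : BoundedVariationOn x (Icc a b))
    (hF : ∀ ε > 0, ∃ δ > 0, ∀ s t, a ≤ s → s ≤ t → t ≤ b → t - s ≤ δ →
      |F t - F s - cross (x s) (x t)| ≤ ε * (‖x t - x s‖ + (t - s))) :
    2 * curveArea a b x = F b - F a := by
  have hy := boundedVariationOn_clamp hab hbv
  have hyc := continuous_clamp hab hx
  rw [curveArea, dif_pos hy]
  set y := clamp a b x with hy_def
  set μ := hy.vectorMeasure with hμ
  have hfin : IsFiniteMeasure μ.variation := isFiniteMeasure_variation μ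
  have hright : ∀ t, Function.rightLim y t = y t := fun t =>
    hyc.continuousAt.continuousWithinAt.rightLim_eq
  have hIoc : ∀ s t, s ≤ t → μ (Ioc s t) = y t - y s := fun s t hst => by
    rw [hμ, hy.vectorMeasure_Ioc hst, hright, hright]
  obtain ⟨M, hM⟩ : ∃ M, ∀ t, ‖y t‖ ≤ M := by
    obtain ⟨M, hM⟩ := (isCompact_Icc.image_of_continuousOn hx).isBounded.exists_norm_le
    exact ⟨M, fun t => hM _ ⟨_, ⟨le_max_left _ _, max_le hab (min_le_left _ _)⟩, rfl⟩⟩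
  have hint : μ.Integrable y :=
    Integrable.of_bound hyc.aestronglyMeasurable M (Eventually.of_forall hM)
  have hconst : ∀ c : Plane, μ.Integrable fun _ => c := fun c => integrable_const c
  have hsetconst : ∀ (S : Set ℝ) (c : Plane),
      (μ.restrict S).integral (fun _ => c) cross = cross c (μ S) := fun S c => by
    rw [VectorMeasure.integral_const, VectorMeasure.restrict_apply_univ]
  set I : ℝ → ℝ := fun t => (μ.restrict (Iic t)).integral y cross with hI
  have hIsub : ∀ s t, s ≤ t → I t - I s = (μ.restrict (Ioc s t)).integral y cross := by
    intro s t hst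
    simp only [hI]
    rw [← Iic_union_Ioc_eq_Iic hst, VectorMeasure.setIntegral_union
      (by rw [Set.disjoint_left]; intro r hr hr'; exact absurd hr (not_le.2 hr'.1))
      measurableSet_Iic measurableSet_Ioc hint.restrict hint.restrict]
    ring
  -- The clamped curve is constant up to a and continuous there, so `Iic a` carries no net
  -- increment; the same holds beyond b.
  have hIa : I a = 0 := by
    have h1 : (μ.restrict (Iic a)).integral y cross =
        (μ.restrict (Iic a)).integral (fun _ => x a) cross :=
      VectorMeasure.setIntegral_congr_fun fun r hr => by
        simp [clamp, (show r ≤ a from hr).trans hab, show r ≤ a from hr]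
    simp only [hI]
    rw [h1, hsetconst, hμ, hy.vectorMeasure_Iic, hright]
    have h2 : limUnder atBot y = x a := by
      refine Tendsto.limUnder_eq (tendsto_const_nhds.congr' ?_)
      filter_upwards [eventually_le_atBot a] with r hr
      simp [hy_def, clamp, hr.trans hab, hr]
    have h3 : y a = x a := clamp_of_mem ⟨le_rfl, hab⟩
    rw [h2, h3, sub_self, map_zero]
  have hIb : I b = μ.integral y cross := by
    rw [← VectorMeasure.setIntegral_add_compl (s := Iic b) measurableSet_Iic hint, compl_Iic]
    have h1 : (μ.restrict (Ioi b)).integral y cross =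
        (μ.restrict (Ioi b)).integral (fun _ => x b) cross :=
      VectorMeasure.setIntegral_congr_fun fun r hr => by
        simp [clamp, (show b < r from hr).le, hab]
    rw [h1, hsetconst, hμ, hy.vectorMeasure_Ioi, hright]
    have h2 : limUnder atTop y = x b := by
      refine Tendsto.limUnder_eq (tendsto_const_nhds.congr' ?_)
      filter_upwards [eventually_ge_atTop b] with r hr
      simp [hy_def, clamp, hr, hab]
    have h3 : y b = x b := clamp_of_mem ⟨hab, le_rfl⟩
    rw [h2, h3, sub_self, map_zero, add_zero]
  set V : ℝ → ℝ := fun t => μ.variation.real (Iic t) with hV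
  have hVsub : ∀ s t, s ≤ t → V t - V s = μ.variation.real (Ioc s t) := by
    intro s t hst
    simp only [hV]
    rw [← Iic_union_Ioc_eq_Iic hst, measureReal_union
      (by rw [Set.disjoint_left]; intro r hr hr'; exact absurd hr (not_le.2 hr'.1))
      measurableSet_Ioc]
    ring
  have hnorm : ∀ s t, s ≤ t → ‖y t - y s‖ ≤ V t - V s := by
    intro s t hst
    rw [hVsub s t hst, ← hIoc s t hst]
    exact VectorMeasure.norm_measure_le_variation
  have hcross_y : ∀ c : Plane, cross c c = 0 := fun c => by rw [cross_apply]; ring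
  have key := eq_of_forall_abs_sub_le (ψ := fun t => I t - F t)
    (ω := fun t => (‖cross‖ + 1) * V t + (V t + t)) hab ?_
  · rw [hIb, hIa] at key
    linarith
  intro ε hε
  obtain ⟨δ₁, hδ₁, H₁⟩ := hF ε hε
  have huc := isCompact_Icc.uniformContinuousOn_of_continuous hx
  rw [Metric.uniformContinuousOn_iff] at huc
  obtain ⟨δ₂, hδ₂, H₂⟩ := huc ε hε
  refine ⟨min δ₁ (δ₂ / 2), by positivity, fun s t has hst htb hδ => ?_⟩
  have hs : y s = x s := clamp_of_mem ⟨has, hst.trans htb⟩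
  have ht : y t = x t := clamp_of_mem ⟨has.trans hst, htb⟩
  have h1 := H₁ s t has hst htb (hδ.trans (min_le_left _ _))
  have hn := hnorm s t hst
  rw [hs, ht] at hn
  -- Freezing the integrand at s produces x(s) × (x(t) - x(s)) = x(s) × x(t). The remainder is small
  -- by uniform continuity, relative to the variation of the measure.
  have e1 : (μ.restrict (Ioc s t)).integral y cross =
      (μ.restrict (Ioc s t)).integral (fun r => y r - y s) cross + cross (x s) (x t) := by
    rw [VectorMeasure.integral_fun_sub hint.restrict (hconst _).restrict, hsetconst,
      hIoc s t hst, hs, ht, map_sub, hcross_y]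
    ring
  have h2 : ‖(μ.restrict (Ioc s t)).integral (fun r => y r - y s) cross‖ ≤
      ε * ‖cross‖ * (V t - V s) := by
    refine (VectorMeasure.norm_integral_le_of_norm_le_const (C := ε) ?_).trans_eq ?_
    · rw [VectorMeasure.variation_restrict measurableSet_Ioc]
      refine (ae_restrict_iff' measurableSet_Ioc).2 (Eventually.of_forall fun r hr => ?_)
      have hr' : y r = x r := clamp_of_mem ⟨has.trans hr.1.le, hr.2.trans htb⟩
      rw [hr', hs, ← dist_eq_norm]
      refine (H₂ r ⟨has.trans hr.1.le, hr.2.trans htb⟩ s ⟨has, hst.trans htb⟩ ?_).le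
      rw [Real.dist_eq, abs_of_nonneg (by linarith [hr.1])]
      linarith [hr.2, min_le_right δ₁ (δ₂ / 2)]
    · rw [VectorMeasure.variation_restrict measurableSet_Ioc, hVsub s t hst,
        measureReal_restrict_apply MeasurableSet.univ, univ_inter]
  have h3 := hIsub s t hst
  rw [e1] at h3
  rw [Real.norm_eq_abs] at h2
  have h4 : 0 ≤ V t - V s := (norm_nonneg _).trans hn
  have h5 := mul_le_mul_of_nonneg_left hn hε.le
  have h6 : 0 ≤ ε * (V t - V s) := mul_nonneg hε.le h4
  beta_reduce
  rw [abs_le] at h1 h2 ⊢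
  constructor <;> linarith

/-! ### Arcs of the boundary of a convex body -/

/-- The graph of r ↦ `edge K r` is closed because the support function is continuous; the set in
question is a projection of a compact part of it. -/
theorem isCompact_setOf_exists_mem_edge (K : Body) (a b : ℝ) {C : Set Plane} (hC : IsClosed C) :
    IsCompact {r | r ∈ Icc a b ∧ ∃ p ∈ edge K r, p ∈ C} := by
  have h1 : IsClosed {z : ℝ × Plane | inner ℝ z.2 (u z.1) = supp K z.1 ∧ z.2 ∈ C} :=
    (isClosed_eq (continuous_snd.inner (continuous_u.comp continuous_fst))
      ((continuous_supp K).comp continuous_fst)).inter (hC.preimage continuous_snd)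
  have h2 := (((isCompact_Icc (a := a) (b := b)).prod K.isCompact).inter_right h1).image
    continuous_fst
  convert h2 using 1
  ext r
  simp only [edge, mem_ofPred_eq, mem_image, mem_inter_iff, mem_prod, Prod.exists, exists_and_right,
    exists_eq_right, SetLike.mem_coe]
  constructor
  · rintro ⟨hr, p, ⟨h, h'⟩, hp⟩
    exact ⟨p, ⟨hr, h⟩, h', hp⟩
  · rintro ⟨p, ⟨hr, h⟩, h', hp⟩
    exact ⟨hr, p, ⟨h, h'⟩, hp⟩

/-- Intermediate value property of the boundary of a convex body. -/
theorem exists_mem_edge_inner_eq {K : Body} {a b x : ℝ} {z w e : Plane} (hab : a ≤ b)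
    (hz : z ∈ edge K a) (hw : w ∈ edge K b) (hzx : inner ℝ z e ≤ x) (hxw : x ≤ inner ℝ w e) :
    ∃ r ∈ Icc a b, ∃ y ∈ edge K r, inner ℝ y e = x := by
  have hc : Continuous fun p : Plane => inner ℝ p e := by fun_prop
  -- The angles whose edge has a point with coordinate ≤ x, and those whose edge has one with
  -- coordinate ≥ x, form closed sets covering [a, b]. Connectedness gives a common angle, and
  -- convexity of its edge gives the value x.
  have h := isPreconnected_closed_iff.1 (isPreconnected_Icc (a := a) (b := b)) _ _
    (isCompact_setOf_exists_mem_edge K a b (isClosed_Iic.preimage hc (t := Iic x))).isClosed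
    (isCompact_setOf_exists_mem_edge K a b (isClosed_Ici.preimage hc (t := Ici x))).isClosed
    (fun r hr => by
      obtain ⟨p, hp⟩ := edge_nonempty K r
      rcases le_total (inner ℝ p e) x with h | h
      · exact Or.inl ⟨hr, p, hp, h⟩
      · exact Or.inr ⟨hr, p, hp, h⟩)
    ⟨a, ⟨le_rfl, hab⟩, ⟨le_rfl, hab⟩, z, hz, hzx⟩ ⟨b, ⟨hab, le_rfl⟩, ⟨hab, le_rfl⟩, w, hw, hxw⟩
  obtain ⟨r, hr, ⟨-, p, hp, hpx⟩, -, q, hq, hqx⟩ := h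
  obtain ⟨y, hy, hyx⟩ := ((convex_edge K r).isPreconnected.image _ hc.continuousOn).ordConnected.out
    (mem_image_of_mem _ hp) (mem_image_of_mem _ hq) ⟨hpx, hqx⟩
  exact ⟨r, hr, y, hy, hyx⟩

theorem exists_mem_edge_of_mem_convexArc {K : Body} {a b : ℝ} (hab : a ≤ b) {z : Plane}
    (hz : z ∈ convexArc K a b) : ∃ r ∈ Icc a b, z ∈ edge K r := by
  rcases hz with (rfl | hz) | rfl
  · exact ⟨a, ⟨le_rfl, hab⟩, vertexPos_mem K a⟩
  · obtain ⟨r, hr, hz⟩ := mem_iUnion₂.1 hz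
    exact ⟨r, ⟨hr.1.le, hr.2.le⟩, hz⟩
  · exact ⟨b, ⟨hab, le_rfl⟩, vertexNeg_mem K b⟩

/-! ### Arcs whose normal turns by at most a right angle, as graphs over the middle direction. -/

section Arc

variable {K : Body} {a b : ℝ}

theorem half_le_cos_mid (hab : a < b) (hb : b ≤ a + Real.pi / 2) {r : ℝ} (hr : r ∈ Icc a b) :
    1 / 2 ≤ Real.cos ((a + b) / 2 - r) :=
  half_le_cos (by rw [abs_le]; constructor <;> linarith [hr.1, hr.2, Real.pi_pos])

/-- All normals of the arc are within π/4 of the middle angle (a + b)/2, so the coordinate along the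
middle tangent direction determines points of the arc with Lipschitz constant 2. -/
theorem norm_sub_le_of_mem_convexArc (hab : a < b) (hb : b ≤ a + Real.pi / 2) {z w : Plane}
    (hz : z ∈ convexArc K a b) (hw : w ∈ convexArc K a b) :
    ‖w - z‖ ≤ 2 * |inner ℝ w (v ((a + b) / 2)) - inner ℝ z (v ((a + b) / 2))| := by
  obtain ⟨r, hr, hz⟩ := exists_mem_edge_of_mem_convexArc hab.le hz
  obtain ⟨r', hr', hw⟩ := exists_mem_edge_of_mem_convexArc hab.le hw
  have := norm_sub_le_of_mem_edge (m := (a + b) / 2) (c := 1 / 2) hz hw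
    (by rw [abs_lt]; constructor <;> linarith [hr.1, hr.2, hr'.1, hr'.2, Real.pi_pos])
    (by norm_num) (half_le_cos_mid hab hb hr) (half_le_cos_mid hab hb hr')
  linarith

theorem inner_vertexPos_le_of_mem_convexArc (hab : a < b) (hb : b ≤ a + Real.pi / 2) {z : Plane}
    (hz : z ∈ convexArc K a b) :
    inner ℝ (vertexPos K a) (v ((a + b) / 2)) ≤ inner ℝ z (v ((a + b) / 2)) := by
  rcases hz with (rfl | hz) | rfl
  · rfl
  · obtain ⟨r, hr, hz⟩ := mem_iUnion₂.1 hz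
    have := inner_sub_nonneg_of_edge_lt (m := (a + b) / 2) (vertexPos_mem K a) hz hr.1
      (by linarith [hr.2, Real.pi_pos])
      ((half_le_cos_mid hab hb ⟨le_rfl, hab.le⟩).trans' (by norm_num))
      ((half_le_cos_mid hab hb ⟨hr.1.le, hr.2.le⟩).trans' (by norm_num))
    rw [inner_sub_left] at this
    linarith
  · have := inner_sub_nonneg_of_edge_lt (m := (a + b) / 2) (vertexPos_mem K a) (vertexNeg_mem K b)
      hab (by linarith [Real.pi_pos])
      ((half_le_cos_mid hab hb ⟨le_rfl, hab.le⟩).trans' (by norm_num))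
      ((half_le_cos_mid hab hb ⟨hab.le, le_rfl⟩).trans' (by norm_num))
    rw [inner_sub_left] at this
    linarith

theorem le_inner_vertexNeg_of_mem_convexArc (hab : a < b) (hb : b ≤ a + Real.pi / 2) {z : Plane}
    (hz : z ∈ convexArc K a b) :
    inner ℝ z (v ((a + b) / 2)) ≤ inner ℝ (vertexNeg K b) (v ((a + b) / 2)) := by
  rcases hz with (rfl | hz) | rfl
  · exact inner_vertexPos_le_of_mem_convexArc hab hb (Or.inr rfl)
  · obtain ⟨r, hr, hz⟩ := mem_iUnion₂.1 hz
    have := inner_sub_nonneg_of_edge_lt (m := (a + b) / 2) hz (vertexNeg_mem K b) hr.2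
      (by linarith [hr.1, Real.pi_pos])
      ((half_le_cos_mid hab hb ⟨hr.1.le, hr.2.le⟩).trans' (by norm_num))
      ((half_le_cos_mid hab hb ⟨hab.le, le_rfl⟩).trans' (by norm_num))
    rw [inner_sub_left] at this
    linarith
  · rfl

theorem exists_mem_convexArc_inner_eq (hab : a < b) (hb : b ≤ a + Real.pi / 2) {x : ℝ}
    (hx : x ∈ Icc (inner ℝ (vertexPos K a) (v ((a + b) / 2)))
      (inner ℝ (vertexNeg K b) (v ((a + b) / 2)))) :
    ∃ z ∈ convexArc K a b, inner ℝ z (v ((a + b) / 2)) = x := by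
  obtain ⟨r, hr, y, hy, hyx⟩ := exists_mem_edge_inner_eq hab.le (vertexPos_mem K a)
    (vertexNeg_mem K b) hx.1 hx.2
  -- At an extreme angle the intermediate value may be attained off the arc, on the part of the edge
  -- beyond the end vertex. The bounds on x then force that vertex itself to have coordinate x.
  rcases hr.1.eq_or_lt with rfl | har
  · have hc := half_le_cos_mid hab hb ⟨le_rfl, hab.le⟩
    have h1 : inner ℝ y (v ((a + b) / 2)) - inner ℝ (vertexPos K a) (v ((a + b) / 2)) =
        (inner ℝ y (v a) - suppDeriv K a) * Real.cos ((a + b) / 2 - a) := by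
      rw [← inner_sub_left, sub_eq_of_mem_edge (vertexPos_mem K a) hy, inner_smul_left, inner_v_v,
        inner_vertexPos_v]
      simp
    have h2 := le_suppDeriv hy
    refine ⟨vertexPos K a, Or.inl (Or.inl rfl), le_antisymm hx.1 ?_⟩
    nlinarith
  rcases hr.2.eq_or_lt with rfl | hrb
  · have hc := half_le_cos_mid hab hb ⟨hab.le, le_rfl⟩
    have h1 : inner ℝ y (v ((a + r) / 2)) - inner ℝ (vertexNeg K r) (v ((a + r) / 2)) =
        (inner ℝ y (v r) - suppDerivNeg K r) * Real.cos ((a + r) / 2 - r) := by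
      rw [← inner_sub_left, sub_eq_of_mem_edge (vertexNeg_mem K r) hy, inner_smul_left, inner_v_v,
        inner_vertexNeg_v]
      simp
    have h2 := suppDerivNeg_le hy
    refine ⟨vertexNeg K r, Or.inr rfl, le_antisymm ?_ hx.2⟩
    nlinarith
  · exact ⟨y, Or.inl (Or.inr (mem_iUnion₂.2 ⟨r, ⟨har, hrb⟩, hy⟩)), hyx⟩

theorem exists_graph_convexArc (hab : a < b) (hb : b ≤ a + Real.pi / 2) :
    ∃ γ : ℝ → Plane, ∀ x ∈ Icc (inner ℝ (vertexPos K a) (v ((a + b) / 2)))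
      (inner ℝ (vertexNeg K b) (v ((a + b) / 2))),
      γ x ∈ convexArc K a b ∧ inner ℝ (γ x) (v ((a + b) / 2)) = x := by
  choose! γ hγ using fun x => exists_mem_convexArc_inner_eq (K := K) hab hb (x := x)
  exact ⟨γ, hγ⟩

theorem eq_of_mem_convexArc (hab : a < b) (hb : b ≤ a + Real.pi / 2) {z w : Plane}
    (hz : z ∈ convexArc K a b) (hw : w ∈ convexArc K a b)
    (h : inner ℝ z (v ((a + b) / 2)) = inner ℝ w (v ((a + b) / 2))) : z = w := by
  have := norm_sub_le_of_mem_convexArc hab hb hz hw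
  rw [h, sub_self, abs_zero, mul_zero] at this
  exact (sub_eq_zero.1 (norm_le_zero_iff.1 this)).symm

theorem exists_isArcParam_convexArc (K : Body) (hab : a < b) (hb : b ≤ a + Real.pi / 2) :
    ∃ P : ℝ × ℝ × (ℝ → Plane), IsArcParam (convexArc K a b) (vertexPos K a) (vertexNeg K b)
      P.1 P.2.1 P.2.2 := by
  obtain ⟨γ, hγ⟩ := exists_graph_convexArc (K := K) hab hb
  have hp : vertexPos K a ∈ convexArc K a b := Or.inl (Or.inl rfl)
  have hq : vertexNeg K b ∈ convexArc K a b := Or.inr rfl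
  have hpq := le_inner_vertexNeg_of_mem_convexArc hab hb hp
  have hlip : LipschitzOnWith 2 γ (Icc (inner ℝ (vertexPos K a) (v ((a + b) / 2)))
      (inner ℝ (vertexNeg K b) (v ((a + b) / 2)))) := by
    refine LipschitzOnWith.of_dist_le_mul fun x hx y hy => ?_
    have := norm_sub_le_of_mem_convexArc hab hb (hγ y hy).1 (hγ x hx).1
    rw [(hγ x hx).2, (hγ y hy).2] at this
    rw [dist_eq_norm, Real.dist_eq]
    exact_mod_cast this
  refine ⟨⟨_, _, γ⟩, hpq, hlip.continuousOn, fun x hx y hy h => ?_, ?_, Subset.antisymm ?_ ?_, ?_, ?_⟩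
  · rw [← (hγ x hx).2, ← (hγ y hy).2, show γ x = γ y from h]
  · have := hlip.locallyBoundedVariationOn _ _ (left_mem_Icc.2 hpq) (right_mem_Icc.2 hpq)
    rwa [inter_self] at this
  · rintro _ ⟨x, hx, rfl⟩
    exact (hγ x hx).1
  · intro z hz
    have hz' : inner ℝ z (v ((a + b) / 2)) ∈ Icc (inner ℝ (vertexPos K a) (v ((a + b) / 2)))
        (inner ℝ (vertexNeg K b) (v ((a + b) / 2))) :=
      ⟨inner_vertexPos_le_of_mem_convexArc hab hb hz, le_inner_vertexNeg_of_mem_convexArc hab hb hz⟩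
    exact ⟨_, hz', eq_of_mem_convexArc hab hb (hγ _ hz').1 hz (hγ _ hz').2⟩
  · exact eq_of_mem_convexArc hab hb (hγ _ (left_mem_Icc.2 hpq)).1 hp (hγ _ (left_mem_Icc.2 hpq)).2
  · exact eq_of_mem_convexArc hab hb (hγ _ (right_mem_Icc.2 hpq)).1 hq
      (hγ _ (right_mem_Icc.2 hpq)).2

/-- Proving this for every parametrization shows that the choice made in `arcArea` is harmless,
without comparing parametrizations. Along any of them, the primitive of the area functional is twice
the area under the graph minus the product of the coordinates. -/
theorem two_mul_curveArea_of_isArcParam (hab : a < b) (hb : b ≤ a + Real.pi / 2) {α β : ℝ}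
    {x : ℝ → Plane}
    (hx : IsArcParam (convexArc K a b) (vertexPos K a) (vertexNeg K b) α β x) :
    2 * curveArea α β x = supp K b * suppDerivNeg K b - supp K a * suppDeriv K a +
      ∫ t in a..b, (supp K t ^ 2 - suppDeriv K t ^ 2) := by
  obtain ⟨hαβ, hcont, -, hbv, himg, hxα, hxβ⟩ := hx
  obtain ⟨γ, hγ⟩ := exists_graph_convexArc (K := K) hab hb
  have hp : vertexPos K a ∈ convexArc K a b := Or.inl (Or.inl rfl)
  have hq : vertexNeg K b ∈ convexArc K a b := Or.inr rfl
  have hpq := le_inner_vertexNeg_of_mem_convexArc hab hb hp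
  set m := (a + b) / 2 with hm
  set x₀ := inner ℝ (vertexPos K a) (v m)
  set x₁ := inner ℝ (vertexNeg K b) (v m)
  set U : ℝ → ℝ := fun ξ => inner ℝ (γ ξ) (u m) with hU
  have hUlip : ∀ ξ ∈ Icc x₀ x₁, ∀ η ∈ Icc x₀ x₁, |U ξ - U η| ≤ 2 * |ξ - η| := by
    intro ξ hξ η hη
    have h1 := norm_sub_le_of_mem_convexArc hab hb (hγ η hη).1 (hγ ξ hξ).1
    rw [(hγ ξ hξ).2, (hγ η hη).2] at h1
    simp only [hU]
    rw [← inner_sub_left]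
    exact (abs_inner_u_le _ _).trans h1
  have hUc : ContinuousOn U (Icc x₀ x₁) := by
    refine (LipschitzOnWith.of_dist_le_mul (K := 2) fun ξ hξ η hη => ?_).continuousOn
    rw [Real.dist_eq, Real.dist_eq]
    exact_mod_cast hUlip ξ hξ η hη
  have hUint : ∀ ξ ∈ Icc x₀ x₁, ∀ η ∈ Icc x₀ x₁, IntervalIntegrable U volume ξ η :=
    fun ξ hξ η hη => (hUc.mono (ordConnected_Icc.uIcc_subset hξ hη)).intervalIntegrable
  have hΓ : ∀ t ∈ Icc α β, x t ∈ convexArc K a b := fun t ht => himg ▸ mem_image_of_mem x ht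
  have hf : ∀ t ∈ Icc α β, inner ℝ (x t) (v m) ∈ Icc x₀ x₁ := fun t ht =>
    ⟨inner_vertexPos_le_of_mem_convexArc hab hb (hΓ t ht),
      le_inner_vertexNeg_of_mem_convexArc hab hb (hΓ t ht)⟩
  have hg : ∀ t ∈ Icc α β, U (inner ℝ (x t) (v m)) = inner ℝ (x t) (u m) := fun t ht => by
    simp only [hU]
    rw [eq_of_mem_convexArc hab hb (hγ _ (hf t ht)).1 (hΓ t ht) (hγ _ (hf t ht)).2]
  have key := two_mul_curveArea_eq
    (F := fun t => 2 * (∫ ξ in x₀..inner ℝ (x t) (v m), U ξ) -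
      inner ℝ (x t) (v m) * inner ℝ (x t) (u m)) hαβ hcont hbv ?_
  · have harea := two_mul_integral_upper (K := K) (m := m) (a := a) (b := b) (U := U)
      -- The arc starts at v⁺(a) but ends at v⁻(b), so the selection of boundary points changes
      -- vertex at b.
      (P := fun t => if t < b then vertexPos K t else vertexNeg K t) hab.le
      (fun t => by
        split_ifs
        · exact vertexPos_mem K t
        · exact vertexNeg_mem K t)
      (by linarith [Real.pi_pos]) (by linarith [Real.pi_pos]) ?_ ?_
    · simp only [hab, lt_irrefl, if_true, if_false, inner_vertexPos_v, inner_vertexNeg_v] at harea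
      simp only [hxα, hxβ] at key
      rw [key, intervalIntegral.integral_same]
      linarith
    · simp only [hab, lt_irrefl, if_true, if_false]
      intro ξ hξ
      have hξ' : ξ ∈ Icc x₀ x₁ := ⟨hξ.1.le, hξ.2.le⟩
      obtain ⟨r, hr, hz⟩ := exists_mem_edge_of_mem_convexArc hab.le (hγ ξ hξ').1
      have e : U ξ • u m + ξ • v m = γ ξ := by
        rw [eq_frame (γ ξ) m, (hγ ξ hξ').2]
      rw [e]
      refine ⟨hz.1, fun y hy => ?_⟩
      have h1 := inner_le_supp hy r
      have h2 : U ξ * Real.cos (r - m) + ξ * Real.sin (r - m) = supp K r := by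
        rw [← hz.2, ← e, inner_add_left, inner_smul_left, inner_smul_left, inner_u_u, inner_v_u]
        simp
      rw [inner_add_left, inner_smul_left, inner_smul_left, inner_u_u, inner_v_u] at h1
      simp only [conj_trivial] at h1
      have h3 := half_le_cos_mid hab hb hr
      rw [← hm, ← neg_sub r m, Real.cos_neg] at h3
      by_contra hlt
      nlinarith
    · simp only [hab, lt_irrefl, if_true, if_false]
      exact hUint _ ⟨le_rfl, hpq⟩ _ ⟨hpq, le_rfl⟩
  · intro ε hε
    have huc := isCompact_Icc.uniformContinuousOn_of_continuous hcont
    rw [Metric.uniformContinuousOn_iff] at huc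
    obtain ⟨δ, hδ, H⟩ := huc (ε / 4) (by positivity)
    refine ⟨δ / 2, by positivity, fun s t hs hst ht hd => ?_⟩
    have hs' : s ∈ Icc α β := ⟨hs, hst.trans ht⟩
    have ht' : t ∈ Icc α β := ⟨hs.trans hst, ht⟩
    have h1 := H t ht' s hs' (by
      rw [Real.dist_eq, abs_of_nonneg (by linarith)]; linarith)
    rw [dist_eq_norm] at h1
    have hΔ : |inner ℝ (x t) (v m) - inner ℝ (x s) (v m)| ≤ ‖x t - x s‖ := by
      rw [← inner_sub_left]; exact abs_inner_v_le _ _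
    have hfs := hf s hs'
    have hft := hf t ht'
    have hgs := hg s hs'
    have hgt := hg t ht'
    have e1 := intervalIntegral.integral_add_adjacent_intervals (hUint x₀ ⟨le_rfl, hpq⟩ _ hfs)
      (hUint _ hfs _ hft)
    rw [cross_frame _ _ m]
    set fs := inner ℝ (x s) (v m)
    set ft := inner ℝ (x t) (v m)
    set gs := inner ℝ (x s) (u m)
    set gt := inner ℝ (x t) (u m)
    -- Trapezoid rule: gs and gt are the values of the 2-Lipschitz function U at the two ends, so
    -- the integrand is at most 4|ft - fs|.
    have h2 : ‖∫ ξ in fs..ft, (2 * U ξ - (gs + gt))‖ ≤ 4 * |ft - fs| * |ft - fs| := by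
      refine intervalIntegral.norm_integral_le_of_norm_le_const fun ξ hξ => ?_
      have hξ1 : ξ ∈ Icc x₀ x₁ := ordConnected_Icc.uIcc_subset hfs hft (uIoc_subset_uIcc hξ)
      have hξ2 := uIoc_subset_uIcc hξ
      have b1 := hUlip ξ hξ1 fs hfs
      have b2 := hUlip ξ hξ1 ft hft
      have b3 : |ξ - fs| ≤ |ft - fs| := abs_sub_left_of_mem_uIcc hξ2
      have b4 : |ξ - ft| ≤ |ft - fs| := by
        rw [abs_sub_comm]; exact abs_sub_right_of_mem_uIcc hξ2
      rw [hgs] at b1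
      rw [hgt] at b2
      rw [Real.norm_eq_abs, abs_le]
      rw [abs_le] at b1 b2
      constructor <;> linarith
    rw [intervalIntegral.integral_sub ((hUint _ hfs _ hft).const_mul 2) intervalIntegrable_const,
      intervalIntegral.integral_const_mul, intervalIntegral.integral_const, smul_eq_mul,
      Real.norm_eq_abs] at h2
    have h3 : 4 * |ft - fs| * |ft - fs| ≤ ε * (‖x t - x s‖ + (t - s)) := by
      have h4 := abs_nonneg (ft - fs)
      have h5 : 4 * |ft - fs| ≤ ε := by linarith
      have h6 : |ft - fs| ≤ ‖x t - x s‖ + (t - s) := by linarith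
      exact mul_le_mul h5 h6 h4 hε.le
    refine le_trans (le_of_eq ?_) (h2.trans h3)
    congr 1
    rw [← e1]
    ring

theorem two_mul_convexArcArea (K : Body) (hab : a < b) (hb : b ≤ a + Real.pi / 2) :
    2 * convexArcArea K a b = supp K b * suppDerivNeg K b - supp K a * suppDeriv K a +
      ∫ t in a..b, (supp K t ^ 2 - suppDeriv K t ^ 2) := by
  have h := exists_isArcParam_convexArc K hab hb
  rw [convexArcArea, arcArea, dif_pos h]
  exact two_mul_curveArea_of_isArcParam hab hb h.choose_spec

end Arc

/-! ### Caps -/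

theorem inner_u_pi_div_two (p : Plane) : inner ℝ p (u (Real.pi / 2)) = p 1 := by
  rw [inner_u]; simp

theorem inner_u_zero (p : Plane) : inner ℝ p (u 0) = p 0 := by
  rw [inner_u]; simp

theorem inner_u_pi (p : Plane) : inner ℝ p (u Real.pi) = -p 0 := by
  rw [inner_u]; simp

theorem inner_u_three_pi_div_two (p : Plane) : inner ℝ p (u (3 * Real.pi / 2)) = -p 1 := by
  rw [inner_u, show 3 * Real.pi / 2 = Real.pi / 2 + Real.pi by ring, Real.cos_add_pi,
    Real.sin_add_pi]
  simp

theorem u_arccos_cos {t : ℝ} (ht : 0 ≤ Real.sin t) : u (Real.arccos (Real.cos t)) = u t := by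
  have h : Real.sin (Real.arccos (Real.cos t)) = Real.sin t := by
    rw [Real.sin_arccos, ← Real.sin_sq, Real.sqrt_sq ht]
  rw [u, u, h, Real.cos_arccos (Real.neg_one_le_cos t) (Real.cos_le_one t)]

/-- A body in the closed upper half-plane is a cap exactly when it is closed under vertical
projection towards the horizontal axis. -/
theorem isCap_iff {K : Body} : IsCap K ↔ supp K (Real.pi / 2) = 1 ∧ supp K (3 * Real.pi / 2) = 0 ∧
    ∀ p ∈ K, ∀ y, 0 ≤ y → y ≤ p 1 → !₂[p 0, y] ∈ K := by
  have hpi := Real.pi_pos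
  constructor
  · rintro ⟨h1, h0, S, hS, hK⟩
    have hmem : ∀ p : Plane, p ∈ K ↔ ∀ s ∈ S, inner ℝ p (u s.1) ≤ s.2 := fun p => by
      rw [← SetLike.mem_coe, hK]; simp [halfPlane]
    refine ⟨h1, h0, fun p hp y hy0 hy => (hmem _).2 fun s hs => ?_⟩
    have h2 := (hmem p).1 hp s hs
    rcases hS s hs with hs' | hs'
    · refine le_trans ?_ h2
      rw [inner_u, inner_u]
      simp only [Matrix.cons_val_zero, Matrix.cons_val_one]
      have := mul_le_mul_of_nonneg_right hy (Real.sin_nonneg_of_mem_Icc hs')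
      linarith
    · rw [mem_singleton_iff] at hs'
      have h3 := (hmem _).1 (vertexPos_mem K (3 * Real.pi / 2)).1 s hs
      rw [hs', inner_vertexPos_u, h0] at h3
      rw [hs', inner_u_three_pi_div_two]
      simp only [Matrix.cons_val_one, Matrix.cons_val_zero]
      linarith
  · rintro ⟨h1, h0, hdown⟩
    have hnn : ∀ p ∈ K, 0 ≤ p 1 := fun p hp => by
      have := inner_le_supp hp (3 * Real.pi / 2)
      rw [h0, inner_u_three_pi_div_two] at this
      linarith
    refine ⟨h1, h0, {s | s.1 ∈ Icc 0 Real.pi ∪ {3 * Real.pi / 2} ∧ s.2 = supp K s.1},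
      fun s hs => hs.1, Subset.antisymm ?_ ?_⟩
    · intro p hp
      simp only [mem_iInter₂]
      rintro s ⟨-, hs⟩
      change inner ℝ p (u s.1) ≤ s.2
      rw [hs]
      exact inner_le_supp hp s.1
    · intro p hp
      simp only [mem_iInter₂] at hp
      have hp' : ∀ t ∈ Icc 0 Real.pi ∪ {3 * Real.pi / 2}, inner ℝ p (u t) ≤ supp K t :=
        fun t ht => hp (t, supp K t) ⟨ht, rfl⟩
      refine mem_of_inner_le_supp fun t => ?_
      rcases le_or_gt 0 (Real.sin t) with ht | ht
      · have hu := u_arccos_cos ht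
        have := hp' (Real.arccos (Real.cos t))
          (Or.inl ⟨Real.arccos_nonneg _, Real.arccos_le_pi _⟩)
        simp only [supp, hu] at this ⊢
        exact this
      · have hp1 : 0 ≤ p 1 := by
          have := hp' (3 * Real.pi / 2) (Or.inr rfl)
          rw [h0, inner_u_three_pi_div_two] at this
          linarith
        -- For a downward normal it is enough to compare p, which lies above the axis, with the foot
        -- on the axis of a point of K that is horizontally at least as far out as p.
        have key : ∀ q ∈ K, p 0 * Real.cos t ≤ q 0 * Real.cos t → inner ℝ p (u t) ≤ supp K t := by
          intro q hq hpq
          have hq' := inner_le_supp (hdown q hq 0 le_rfl (hnn q hq)) t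
          rw [inner_u] at hq' ⊢
          simp only [Matrix.cons_val_zero, Matrix.cons_val_one] at hq'
          nlinarith
        rcases le_total 0 (Real.cos t) with hc | hc
        · refine key _ (vertexPos_mem K 0).1 (mul_le_mul_of_nonneg_right ?_ hc)
          have := hp' 0 (Or.inl ⟨le_rfl, hpi.le⟩)
          rwa [← inner_vertexPos_u, inner_u_zero, inner_u_zero] at this
        · refine key _ (vertexPos_mem K Real.pi).1 (mul_le_mul_of_nonpos_right ?_ hc)
          have := hp' Real.pi (Or.inl ⟨hpi.le, le_rfl⟩)
          rw [← inner_vertexPos_u, inner_u_pi, inner_u_pi] at this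
          linarith

theorem IsCap.comb {K L : Body} (hK : IsCap K) (hL : IsCap L) {l : ℝ} (hl : l ∈ Icc (0 : ℝ) 1) :
    IsCap (comb l K L) := by
  rw [isCap_iff] at *
  obtain ⟨hK1, hK0, hK⟩ := hK
  obtain ⟨hL1, hL0, hL⟩ := hL
  refine ⟨by rw [supp_comb hl, hK1, hL1]; ring, by rw [supp_comb hl, hK0, hL0]; ring, ?_⟩
  have hnn : ∀ {M : Body}, supp M (3 * Real.pi / 2) = 0 → ∀ p ∈ M, 0 ≤ p 1 := fun h0 p hp => by
    have := inner_le_supp hp (3 * Real.pi / 2)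
    rw [h0, inner_u_three_pi_div_two] at this
    linarith
  rintro p hp y hy0 hy
  obtain ⟨a, ha, b, hb, rfl⟩ := mem_comb.1 hp
  have ha0 := hnn hK0 a ha
  have hb0 := hnn hL0 b hb
  simp only [PiLp.add_apply, PiLp.smul_apply, smul_eq_mul] at hy ⊢
  set d := (1 - l) * a 1 + l * b 1 with hd
  -- Lowering both summands by the same factor k lowers the combined height d to y. If d = 0 then y
  -- = 0 and any factor works.
  have hk : ∃ k : ℝ, 0 ≤ k ∧ k ≤ 1 ∧ k * d = y := by
    rcases (hy0.trans hy).eq_or_lt with h | h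
    · exact ⟨0, le_rfl, zero_le_one, by rw [zero_mul]; linarith⟩
    · exact ⟨y / d, div_nonneg hy0 h.le, div_le_one_of_le₀ hy h.le, div_mul_cancel₀ _ h.ne'⟩
  obtain ⟨k, hk0, hk1, hky⟩ := hk
  refine mem_comb.2 ⟨_, hK a ha (k * a 1) (mul_nonneg hk0 ha0) (mul_le_of_le_one_left ha0 hk1),
    _, hL b hb (k * b 1) (mul_nonneg hk0 hb0) (mul_le_of_le_one_left hb0 hk1), ?_⟩
  ext i
  fin_cases i
  · simp
  · simp
    rw [← hky, hd]; ring

/-! ### The area of a cap -/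

theorem measurePreserving_toPlane :
    MeasurePreserving (fun z : ℝ × ℝ => (!₂[z.1, z.2] : Plane)) volume volume := by
  have h := (PiLp.volume_preserving_toLp (Fin 2)).comp
    ((volume_preserving_finTwoArrow ℝ).symm MeasurableEquiv.finTwoArrow)
  exact h

/-- The length of the vertical slice of `K` with abscissa `x`. -/
def sliceLength (K : Body) (x : ℝ) : ℝ := (volume {y : ℝ | (!₂[x, y] : Plane) ∈ K}).toReal

theorem integrable_sliceLength_and_area_eq (K : Body) :
    Integrable (sliceLength K) ∧ area K = ∫ x, sliceLength K x := by
  set A : Set (ℝ × ℝ) := {z | (!₂[z.1, z.2] : Plane) ∈ K} with hA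
  have hAm : MeasurableSet A :=
    measurePreserving_toPlane.measurable K.isCompact.isClosed.measurableSet
  have h1 : volume (K : Set Plane) = volume A :=
    (measurePreserving_toPlane.measure_preimage
      K.isCompact.isClosed.measurableSet.nullMeasurableSet).symm
  have h2 : volume A = ∫⁻ x, volume {y : ℝ | (!₂[x, y] : Plane) ∈ K} := by
    rw [Measure.volume_eq_prod, Measure.prod_apply hAm]; rfl
  have hm : Measurable fun x : ℝ => volume {y : ℝ | (!₂[x, y] : Plane) ∈ K} :=
    measurable_measure_prodMk_left hAm
  have hfin : ∫⁻ x, volume {y : ℝ | (!₂[x, y] : Plane) ∈ K} ≠ ⊤ := by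
    rw [← h2, ← h1]
    exact K.isCompact.measure_ne_top
  refine ⟨integrable_toReal_of_lintegral_ne_top hm.aemeasurable hfin, ?_⟩
  rw [area, Measure.real, h1, h2]
  exact (integral_toReal hm.aemeasurable (ae_lt_top hm hfin)).symm

theorem inner_v_pi_div_two (p : Plane) : inner ℝ p (v (Real.pi / 2)) = -p 0 := by
  rw [inner_v]; simp

/-- A cap is the region between the axis and its upper boundary, so its area is the integral of
slice lengths and `two_mul_integral_upper` applies with m = π/2 over the full half turn. The
coordinate along v_{π/2} is -x, and the end terms at 0 and π cancel exactly. -/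
theorem two_mul_area {K : Body} (hK : IsCap K) :
    2 * area K = ∫ t in (0 : ℝ)..Real.pi, (supp K t ^ 2 - suppDeriv K t ^ 2) := by
  have hpi := Real.pi_pos
  obtain ⟨-, h0, hdown⟩ := isCap_iff.1 hK
  have hnn : ∀ p ∈ K, 0 ≤ p 1 := fun p hp => by
    have := inner_le_supp hp (3 * Real.pi / 2)
    rw [h0, inner_u_three_pi_div_two] at this
    linarith
  obtain ⟨hint, harea⟩ := integrable_sliceLength_and_area_eq K
  have hslice : ∀ x, {y : ℝ | (!₂[x, y] : Plane) ∈ K}.Nonempty →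
      (!₂[x, sliceLength K x] : Plane) ∈ K ∧ ∀ y, (!₂[x, y] : Plane) ∈ K → y ≤ sliceLength K x := by
    intro x hne
    have hbdd : BddAbove {y : ℝ | (!₂[x, y] : Plane) ∈ K} :=
      ⟨supp K (Real.pi / 2), fun y hy => by
        have := inner_le_supp (K := K) hy (Real.pi / 2)
        rwa [inner_u_pi_div_two] at this⟩
    have hcl : IsClosed {y : ℝ | (!₂[x, y] : Plane) ∈ K} :=
      K.isCompact.isClosed.preimage (f := fun y : ℝ => (!₂[x, y] : Plane)) (by fun_prop)
    have hmax := hcl.csSup_mem hne hbdd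
    set Y := sSup {y : ℝ | (!₂[x, y] : Plane) ∈ K}
    have hY0 : 0 ≤ Y := by simpa using hnn _ hmax
    have e : {y : ℝ | (!₂[x, y] : Plane) ∈ K} = Icc 0 Y := by
      refine Subset.antisymm (fun y hy => ⟨by simpa using hnn _ hy, le_csSup hbdd hy⟩) ?_
      intro y hy
      have := hdown _ hmax y hy.1 (by simpa using hy.2)
      simpa using this
    have e' : sliceLength K x = Y := by
      rw [sliceLength, e, Real.volume_Icc, sub_zero, ENNReal.toReal_ofReal hY0]
    rw [e']
    exact ⟨hmax, fun y hy => le_csSup hbdd hy⟩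
  have hempty : ∀ x, x ∉ Icc (-supp K Real.pi) (supp K 0) → sliceLength K x = 0 := by
    intro x hx
    have : {y : ℝ | (!₂[x, y] : Plane) ∈ K} = ∅ := by
      refine eq_empty_of_forall_notMem fun y hy => hx ⟨?_, ?_⟩
      · have := inner_le_supp (K := K) hy Real.pi
        rw [inner_u_pi] at this
        simp only [Matrix.cons_val_zero] at this
        linarith
      · have := inner_le_supp (K := K) hy 0
        rw [inner_u_zero] at this
        simpa using this
    rw [sliceLength, this]; simp
  have hle : -supp K Real.pi ≤ supp K 0 := by
    obtain ⟨p, hp⟩ := K.nonempty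
    have h1 := inner_le_supp hp Real.pi
    have h2 := inner_le_supp hp 0
    rw [inner_u_pi] at h1
    rw [inner_u_zero] at h2
    linarith
  have harea' : area K = ∫ x in (-supp K 0)..supp K Real.pi, sliceLength K (-x) := by
    rw [intervalIntegral.integral_comp_neg (fun x => sliceLength K x), neg_neg,
      intervalIntegral.integral_of_le hle, ← integral_Icc_eq_integral_Ioc, harea]
    exact (setIntegral_eq_integral_of_forall_compl_eq_zero hempty).symm
  have hX0 : inner ℝ (vertexPos K 0) (v (Real.pi / 2)) = -supp K 0 := by
    rw [inner_v_pi_div_two, ← inner_u_zero, inner_vertexPos_u]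
  have hX1 : inner ℝ (vertexPos K Real.pi) (v (Real.pi / 2)) = supp K Real.pi := by
    rw [inner_v_pi_div_two, ← inner_u_pi, inner_vertexPos_u]
  have hY0 : inner ℝ (vertexPos K 0) (u (Real.pi / 2)) = suppDeriv K 0 := by
    rw [inner_u_rotate _ 0, inner_vertexPos_u, inner_vertexPos_v]; simp
  have hY1 : inner ℝ (vertexPos K Real.pi) (u (Real.pi / 2)) = -suppDeriv K Real.pi := by
    rw [inner_u_rotate _ Real.pi, inner_vertexPos_u, inner_vertexPos_v,
      show Real.pi / 2 - Real.pi = -(Real.pi / 2) by ring]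
    simp
  have key := two_mul_integral_upper (K := K) (m := Real.pi / 2) (a := 0) (b := Real.pi)
    (U := fun x => sliceLength K (-x)) (P := vertexPos K) hpi.le (vertexPos_mem K) (by linarith)
    (by linarith) ?_ (hint.comp_neg.intervalIntegrable)
  · rw [hX0, hX1, hY0, hY1, inner_vertexPos_v, inner_vertexPos_v] at key
    rw [harea', key]
    ring
  · rw [hX0, hX1]
    intro x hx
    have e : ∀ y : ℝ, y • u (Real.pi / 2) + x • v (Real.pi / 2) = (!₂[-x, y] : Plane) := by
      intro y
      ext i
      fin_cases i <;> simp [u, v]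
    simp only [e]
    refine hslice (-x) ⟨0, ?_⟩
    -- The feet of the rightmost and leftmost points belong to K, hence so does the base segment,
    -- and every slice in between is nonempty.
    have hq0 : (!₂[supp K 0, 0] : Plane) ∈ K := by
      have := hdown _ (vertexPos_mem K 0).1 0 le_rfl (hnn _ (vertexPos_mem K 0).1)
      rwa [← inner_u_zero, inner_vertexPos_u] at this
    have hq1 : (!₂[-supp K Real.pi, 0] : Plane) ∈ K := by
      have := hdown _ (vertexPos_mem K Real.pi).1 0 le_rfl (hnn _ (vertexPos_mem K Real.pi).1)
      have h2 : vertexPos K Real.pi 0 = -supp K Real.pi := by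
        rw [← inner_vertexPos_u, inner_u_pi, neg_neg]
      rwa [h2] at this
    have hd : 0 < supp K 0 + supp K Real.pi := by linarith [hx.1, hx.2]
    have hc := K.convex hq0 hq1 (a := (supp K Real.pi - x) / (supp K 0 + supp K Real.pi))
      (b := (supp K 0 + x) / (supp K 0 + supp K Real.pi))
      (div_nonneg (by linarith [hx.2]) hd.le) (div_nonneg (by linarith [hx.1]) hd.le)
      (by field_simp; ring)
    have e2 : (!₂[-x, 0] : Plane) = ((supp K Real.pi - x) / (supp K 0 + supp K Real.pi)) •
        !₂[supp K 0, 0] + ((supp K 0 + x) / (supp K 0 + supp K Real.pi)) •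
        !₂[-supp K Real.pi, 0] := by
      ext i
      fin_cases i
      · simp
        field_simp
        ring
      · simp
    change (!₂[-x, 0] : Plane) ∈ K
    rw [e2]
    exact hc

open scoped ENNReal NNReal

/-! ### The surface area measure of Minkowski combinations -/

theorem inner_le_inner_vertexPos {K : Body} {r t m : ℝ} {z : Plane} (hz : z ∈ edge K r)
    (hrt : r ≤ t) (h : t < r + Real.pi) (h1 : 0 ≤ Real.cos (m - r)) (h2 : 0 ≤ Real.cos (m - t)) :
    inner ℝ z (v m) ≤ inner ℝ (vertexPos K t) (v m) := by
  rw [← sub_nonneg, ← inner_sub_left]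
  rcases hrt.eq_or_lt with rfl | hlt
  · rw [sub_eq_of_mem_edge hz (vertexPos_mem K r), inner_smul_left, inner_v_v, inner_vertexPos_v]
    exact mul_nonneg (sub_nonneg.2 (le_suppDeriv hz)) h1
  · exact inner_sub_nonneg_of_edge_lt hz (vertexPos_mem K t) hlt h h1 h2

theorem lipschitzWith_inner_v (m : ℝ) : LipschitzWith 1 fun p : Plane => inner ℝ p (v m) :=
  LipschitzWith.of_dist_le_mul fun p q => by
    rw [Real.dist_eq, ← inner_sub_left, dist_eq_norm, NNReal.coe_one, one_mul]
    exact abs_inner_v_le _ _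

/-! ### Length of a boundary arc bounded on both sides by its projection. -/

section Bounds

variable {K : Body} {s t m c : ℝ}

/-- Projection on v_m is 1-Lipschitz and, by the intermediate value property, covers the interval
between the two vertices. -/
theorem ofReal_le_surfaceArea_Ioc (hst : s ≤ t) (hc : 0 ≤ Real.cos (m - s)) :
    ENNReal.ofReal (inner ℝ (vertexPos K t) (v m) - inner ℝ (vertexPos K s) (v m)) ≤
      surfaceArea K (Ioc s t) := by
  set f : Plane → ℝ := fun p => inner ℝ p (v m) with hf
  have hsub : Ioc (f (vertexPos K s)) (f (vertexPos K t)) ⊆ f '' (⋃ r ∈ Ioc s t, edge K r) := by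
    intro x hx
    obtain ⟨r, hr, y, hy, hyx⟩ := exists_mem_edge_inner_eq (e := v m) hst (vertexPos_mem K s)
      (vertexPos_mem K t) hx.1.le hx.2
    rcases hr.1.eq_or_lt with rfl | hlt
    · have := inner_le_inner_vertexPos (m := m) hy le_rfl (by linarith [Real.pi_pos]) hc hc
      rw [hyx] at this
      exact absurd hx.1 (not_lt.2 this)
    · exact ⟨y, mem_iUnion₂.2 ⟨r, ⟨hlt, hr.2⟩, hy⟩, hyx⟩
  rw [← Real.volume_Ioc, ← hausdorffMeasure_real]
  refine (measure_mono hsub).trans ?_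
  have h := (lipschitzWith_inner_v m).hausdorffMeasure_image_le zero_le_one
    (⋃ r ∈ Ioc s t, edge K r)
  rw [ENNReal.coe_one, ENNReal.one_rpow, one_mul] at h
  exact h

/-- While cos (m - r) ≥ c, projection on v_m is injective on the arc with (1/c)-Lipschitz inverse,
and its image lies between the two vertices. -/
theorem surfaceArea_Ioc_le (hst : t < s + Real.pi) (hc : 0 < c)
    (hcos : ∀ r ∈ Icc s t, c ≤ Real.cos (m - r)) :
    surfaceArea K (Ioc s t) ≤
      ENNReal.ofReal ((inner ℝ (vertexPos K t) (v m) - inner ℝ (vertexPos K s) (v m)) / c) := by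
  set f : Plane → ℝ := fun p => inner ℝ p (v m) with hf
  set E := ⋃ r ∈ Ioc s t, edge K r with hE
  have hmem : ∀ z ∈ E, ∃ r ∈ Ioc s t, z ∈ edge K r := fun z hz => by simpa [hE] using hz
  have hanti : ∀ z ∈ E, ∀ w ∈ E, c * ‖w - z‖ ≤ |f w - f z| := by
    intro z hz w hw
    obtain ⟨r, hr, hz⟩ := hmem z hz
    obtain ⟨r', hr', hw⟩ := hmem w hw
    exact norm_sub_le_of_mem_edge hz hw
      (by rw [abs_lt]; constructor <;> linarith [hr.1, hr.2, hr'.1, hr'.2]) hc.le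
      (hcos r ⟨hr.1.le, hr.2⟩) (hcos r' ⟨hr'.1.le, hr'.2⟩)
  have hinj : InjOn f E := by
    intro z hz w hw hzw
    have := hanti z hz w hw
    rw [hzw, sub_self, abs_zero] at this
    have h0 : ‖w - z‖ ≤ 0 := by
      by_contra hpos
      rw [not_le] at hpos
      nlinarith
    exact (sub_eq_zero.1 (norm_le_zero_iff.1 h0)).symm
  have himg : f '' E ⊆ Icc (f (vertexPos K s)) (f (vertexPos K t)) := by
    rintro _ ⟨z, hz, rfl⟩
    obtain ⟨r, hr, hz⟩ := hmem z hz
    have hcr := hc.le.trans (hcos r ⟨hr.1.le, hr.2⟩)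
    constructor
    · have := inner_sub_nonneg_of_edge_lt (m := m) (vertexPos_mem K s) hz hr.1
        (by linarith [hr.2]) (hc.le.trans (hcos s ⟨le_rfl, hr.1.le.trans hr.2⟩)) hcr
      rw [inner_sub_left] at this
      simp only [hf]
      linarith
    · exact inner_le_inner_vertexPos hz hr.2 (by linarith [hr.1]) hcr
        (hc.le.trans (hcos t ⟨hr.1.le.trans hr.2, le_rfl⟩))
  have hlip : LipschitzOnWith (Real.toNNReal (1 / c)) (Function.invFunOn f E) (f '' E) := by
    refine LipschitzOnWith.of_dist_le_mul ?_
    rintro _ ⟨z, hz, rfl⟩ _ ⟨w, hw, rfl⟩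
    rw [hinj.leftInvOn_invFunOn hz, hinj.leftInvOn_invFunOn hw, dist_eq_norm, Real.dist_eq,
      Real.coe_toNNReal _ (by positivity), one_div_mul_eq_div, le_div_iff₀ hc, mul_comm]
    exact hanti w hw z hz
  have h1 := hlip.hausdorffMeasure_image_le (zero_le_one (α := ℝ))
  have h2 : Function.invFunOn f E '' (f '' E) = E := hinj.leftInvOn_invFunOn.image_image
  rw [h2, ENNReal.rpow_one] at h1
  refine h1.trans ?_
  rw [hausdorffMeasure_real, ← one_div_mul_eq_div c (inner ℝ _ _ - _),
    ENNReal.ofReal_mul (by positivity), ← Real.volume_Icc]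
  exact mul_le_mul_right (measure_mono himg) _

end Bounds

/-- The surface area measure, restricted to normal angles in `(c, c + 2]`, as an outer measure. -/
def surfaceOuter (K : Body) (c : ℝ) : OuterMeasure ℝ where
  measureOf X := surfaceArea K (X ∩ Ioc c (c + 2))
  empty := by simp [surfaceArea]
  mono {X Y} h := by
    refine measure_mono (biUnion_subset_biUnion_left ?_)
    exact inter_subset_inter_left _ h
  iUnion_nat X _ := by
    refine (measure_mono ?_).trans (measure_iUnion_le _)
    intro z hz
    obtain ⟨t, ⟨ht, ht'⟩, hz⟩ := mem_iUnion₂.1 hz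
    obtain ⟨n, hn⟩ := mem_iUnion.1 ht
    exact mem_iUnion.2 ⟨n, mem_iUnion₂.2 ⟨t, ⟨hn, ht'⟩, hz⟩⟩

theorem surfaceOuter_apply (K : Body) (c : ℝ) (X : Set ℝ) :
    surfaceOuter K c X = surfaceArea K (X ∩ Ioc c (c + 2)) := rfl

/-- A window of length 2 is longer than π/2, so it holds the angle sets of interest, while its
half-length 1 is below π/3 and keeps the cosine to the middle angle at least 1/2. -/
theorem half_le_cos_of_mem {c r : ℝ} (hr : r ∈ Icc c (c + 2)) : 1 / 2 ≤ Real.cos (c + 1 - r) :=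
  half_le_cos (by rw [abs_le]; constructor <;> linarith [hr.1, hr.2, Real.pi_gt_three])

/-- Cutting the angles at t corresponds to cutting the plane by a line through v⁺(t). Edges up to t
lie on one side and later edges on the other, except for the point v⁺(t) itself, which has length
zero. Measurability of the half-plane then gives Carathéodory's condition. -/
theorem borel_le_caratheodory_surfaceOuter (K : Body) (c : ℝ) :
    borel ℝ ≤ (surfaceOuter K c).caratheodory := by
  have hpi := Real.pi_gt_three
  rw [borel_eq_generateFrom_Iic]
  refine MeasurableSpace.generateFrom_le ?_
  rintro _ ⟨t, rfl⟩
  refine (OuterMeasure.isCaratheodory_iff_le _).2 fun X => ?_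
  simp only [surfaceOuter_apply]
  rcases le_or_gt t c with htc | htc
  · have h1 : X ∩ Iic t ∩ Ioc c (c + 2) = ∅ := by
      ext r; simp only [mem_inter_iff, mem_Iic, mem_Ioc, mem_empty_iff_false, iff_false]
      rintro ⟨⟨-, h⟩, h', -⟩
      linarith
    rw [h1]
    simp only [surfaceArea, mem_empty_iff_false, iUnion_of_empty, iUnion_empty, measure_empty,
      zero_add]
    refine measure_mono (biUnion_subset_biUnion_left ?_)
    exact inter_subset_inter_left _ sdiff_subset
  rcases lt_or_ge (c + 2) t with htc' | htc'
  · have h1 : (X \ Iic t) ∩ Ioc c (c + 2) = ∅ := by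
      ext r; simp only [mem_inter_iff, Set.mem_sdiff, mem_Iic, mem_Ioc, mem_empty_iff_false, iff_false]
      rintro ⟨⟨-, h⟩, -, h'⟩
      exact h (h'.trans htc'.le)
    rw [h1]
    simp only [surfaceArea, mem_empty_iff_false, iUnion_of_empty, iUnion_empty, measure_empty,
      add_zero]
    refine measure_mono (biUnion_subset_biUnion_left ?_)
    exact inter_subset_inter_left _ inter_subset_left
  set w := vertexPos K t
  set W : Set Plane := {z | inner ℝ z (v (c + 1)) ≤ inner ℝ w (v (c + 1))} with hW
  have hWm : MeasurableSet W :=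
    (isClosed_le (f := fun z : Plane => inner ℝ z (v (c + 1))) (by fun_prop)
      continuous_const).measurableSet
  have hct := half_le_cos_of_mem ⟨htc.le, htc'⟩
  set E := ⋃ r ∈ X ∩ Ioc c (c + 2), edge K r with hE
  have hlow : (⋃ r ∈ X ∩ Iic t ∩ Ioc c (c + 2), edge K r) ⊆ E ∩ W := by
    intro z hz
    obtain ⟨r, ⟨⟨hrX, hrt⟩, hr⟩, hz⟩ := mem_iUnion₂.1 hz
    refine ⟨mem_iUnion₂.2 ⟨r, ⟨hrX, hr⟩, hz⟩, ?_⟩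
    exact inner_le_inner_vertexPos hz hrt (by linarith [hr.1])
      ((half_le_cos_of_mem ⟨hr.1.le, hr.2⟩).trans' (by norm_num)) (hct.trans' (by norm_num))
  have hhigh : (⋃ r ∈ (X \ Iic t) ∩ Ioc c (c + 2), edge K r) ⊆ (E \ W) ∪ {w} := by
    intro z hz
    obtain ⟨r, ⟨⟨hrX, hrt⟩, hr⟩, hz⟩ := mem_iUnion₂.1 hz
    rw [mem_Iic, not_le] at hrt
    by_cases hzW : z ∈ W
    · right
      have h1 := norm_sub_le_of_edge_lt (m := c + 1) (vertexPos_mem K t) hz hrt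
        (by linarith [hr.2]) (c := 1 / 2) (by norm_num) hct (half_le_cos_of_mem ⟨hr.1.le, hr.2⟩)
      rw [inner_sub_left] at h1
      have h2 : inner ℝ z (v (c + 1)) ≤ inner ℝ w (v (c + 1)) := hzW
      have h3 : ‖z - w‖ ≤ 0 := by linarith
      exact sub_eq_zero.1 (norm_le_zero_iff.1 h3)
    · exact Or.inl ⟨mem_iUnion₂.2 ⟨r, ⟨hrX, hr⟩, hz⟩, hzW⟩
  have : NullSingletonClass (Measure.hausdorffMeasure 1 : Measure Plane) :=
    Measure.nullSingletonClass_hausdorff Plane zero_lt_one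
  calc surfaceArea K (X ∩ Iic t ∩ Ioc c (c + 2)) + surfaceArea K ((X \ Iic t) ∩ Ioc c (c + 2))
      ≤ Measure.hausdorffMeasure 1 (E ∩ W) + Measure.hausdorffMeasure 1 ((E \ W) ∪ {w}) :=
        add_le_add (measure_mono hlow) (measure_mono hhigh)
    _ ≤ Measure.hausdorffMeasure 1 (E ∩ W) + (Measure.hausdorffMeasure 1 (E \ W) + 0) := by
        gcongr
        exact (measure_union_le _ _).trans_eq (by rw [measure_singleton])
    _ = Measure.hausdorffMeasure 1 E := by rw [add_zero, measure_inter_add_sdiff E hWm]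

/-- The surface area measure, restricted to normal angles in `(c, c + 2]`. -/
def surfaceMeasure (K : Body) (c : ℝ) : Measure ℝ :=
  (surfaceOuter K c).toMeasure
    ((BorelSpace.measurable_eq (α := ℝ)).le.trans (borel_le_caratheodory_surfaceOuter K c))

theorem surfaceMeasure_apply (K : Body) (c : ℝ) {X : Set ℝ} (hX : MeasurableSet X) :
    surfaceMeasure K c X = surfaceArea K (X ∩ Ioc c (c + 2)) := by
  rw [surfaceMeasure, toMeasure_apply _ _ hX, surfaceOuter_apply]

theorem surfaceMeasure_of_subset (K : Body) {c : ℝ} {X : Set ℝ} (hX : MeasurableSet X)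
    (h : X ⊆ Ioc c (c + 2)) : surfaceMeasure K c X = surfaceArea K X := by
  rw [surfaceMeasure_apply K c hX, inter_eq_left.2 h]

instance isFiniteMeasure_surfaceMeasure (K : Body) (c : ℝ) :
    IsFiniteMeasure (surfaceMeasure K c) := by
  refine ⟨?_⟩
  rw [surfaceMeasure_apply K c MeasurableSet.univ, univ_inter]
  refine (surfaceArea_Ioc_le (m := c + 1) (c := 1 / 2) (by linarith [Real.pi_gt_three])
    (by norm_num) fun r hr => half_le_cos_of_mem hr).trans_lt ENNReal.ofReal_lt_top

/-- Over a short interval the measure is the displacement of the vertex along v_s up to a factor cos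
(t - s). That displacement is linear under Minkowski combinations, which is how linearity of the
measure is obtained. -/
theorem surfaceMeasure_real_Ioc_bounds (K : Body) {c s t : ℝ} (hcs : c ≤ s) (hst : s ≤ t)
    (htc : t ≤ c + 2) (h : t - s ≤ 1) :
    inner ℝ (vertexPos K t) (v s) - inner ℝ (vertexPos K s) (v s) ≤
        (surfaceMeasure K c).real (Ioc s t) ∧
      (surfaceMeasure K c).real (Ioc s t) * Real.cos (t - s) ≤
        inner ℝ (vertexPos K t) (v s) - inner ℝ (vertexPos K s) (v s) := by
  have hpi := Real.pi_gt_three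
  have hc : 1 / 2 ≤ Real.cos (t - s) := half_le_cos (by rw [abs_of_nonneg] <;> linarith)
  have e : surfaceMeasure K c (Ioc s t) = surfaceArea K (Ioc s t) :=
    surfaceMeasure_of_subset K measurableSet_Ioc (Ioc_subset_Ioc hcs htc)
  have h1 := ofReal_le_surfaceArea_Ioc (K := K) (m := s) hst (by simp)
  have h2 := surfaceArea_Ioc_le (K := K) (s := s) (t := t) (m := s) (c := Real.cos (t - s))
    (by linarith) (by linarith) fun r hr => by
      rw [← Real.cos_neg (s - r), neg_sub]
      exact Real.cos_le_cos_of_nonneg_of_le_pi (by linarith [hr.1]) (by linarith) (by linarith [hr.2])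
  have h0 := inner_le_inner_vertexPos (m := s) (vertexPos_mem K s) hst (by linarith) (by simp)
    (by rw [← Real.cos_neg, neg_sub]; linarith)
  rw [← e] at h1 h2
  refine ⟨(ENNReal.ofReal_le_iff_le_toReal (measure_ne_top _ _)).1 h1, ?_⟩
  rw [← le_div_iff₀ (by linarith)]
  exact ENNReal.toReal_le_of_le_ofReal (div_nonneg (by linarith) (by linarith)) h2

theorem surfaceMeasure_real_Ioc_comb {K L : Body} {l c s t : ℝ} (hl : l ∈ Icc (0 : ℝ) 1)
    (hcs : c ≤ s) (hst : s ≤ t) (htc : t ≤ c + 2) :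
    (surfaceMeasure (comb l K L) c).real (Ioc s t) =
      (1 - l) * (surfaceMeasure K c).real (Ioc s t) + l * (surfaceMeasure L c).real (Ioc s t) := by
  have hadd : ∀ (M : Body) (r r' : ℝ), s ≤ r → r ≤ r' →
      (surfaceMeasure M c).real (Ioc s r') - (surfaceMeasure M c).real (Ioc s r) =
        (surfaceMeasure M c).real (Ioc r r') := by
    intro M r r' hr hrr'
    rw [← Ioc_union_Ioc_eq_Ioc hr hrr', measureReal_union (Ioc_disjoint_Ioc_of_le le_rfl)
      measurableSet_Ioc]
    ring
  have key := eq_of_forall_abs_sub_le (a := s) (b := t)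
    (ψ := fun r => (surfaceMeasure (comb l K L) c).real (Ioc s r) -
      ((1 - l) * (surfaceMeasure K c).real (Ioc s r) + l * (surfaceMeasure L c).real (Ioc s r)))
    (ω := fun r => (surfaceMeasure (comb l K L) c).real (Ioc s r)) hst ?_
  · simp only [Ioc_self, measureReal_empty] at key
    linarith
  intro ε hε
  -- With this δ, 1 - cos (r' - r) ≤ (r' - r)²/2 ≤ ε/2, the relative error of both comparisons.
  refine ⟨min 1 ε, by positivity, fun r r' hr hrr' hr' hδ => ?_⟩
  have hδ1 := hδ.trans (min_le_left _ _)
  have hδ2 := hδ.trans (min_le_right _ _)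
  have a1 := hadd (comb l K L) r r' hr hrr'
  have a2 := hadd K r r' hr hrr'
  have a3 := hadd L r r' hr hrr'
  obtain ⟨b1, b1'⟩ := surfaceMeasure_real_Ioc_bounds (comb l K L) (hcs.trans hr) hrr'
    (hr'.trans htc) hδ1
  obtain ⟨b2, b2'⟩ := surfaceMeasure_real_Ioc_bounds K (hcs.trans hr) hrr' (hr'.trans htc) hδ1
  obtain ⟨b3, b3'⟩ := surfaceMeasure_real_Ioc_bounds L (hcs.trans hr) hrr' (hr'.trans htc) hδ1
  have e1 : inner ℝ (vertexPos (comb l K L) r') (v r) - inner ℝ (vertexPos (comb l K L) r) (v r) =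
      (1 - l) * (inner ℝ (vertexPos K r') (v r) - inner ℝ (vertexPos K r) (v r)) +
        l * (inner ℝ (vertexPos L r') (v r) - inner ℝ (vertexPos L r) (v r)) := by
    rw [vertexPos_comb hl, vertexPos_comb hl, inner_add_left, inner_add_left, inner_smul_left,
      inner_smul_left, inner_smul_left, inner_smul_left]
    simp only [conj_trivial]
    ring
  have hcos := Real.one_sub_sq_div_two_le_cos (x := r' - r)
  have hcos' : 1 / 2 ≤ Real.cos (r' - r) :=
    half_le_cos (by rw [abs_of_nonneg] <;> linarith [Real.pi_gt_three])
  rw [e1] at b1 b1'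
  set A := (surfaceMeasure (comb l K L) c).real (Ioc r r')
  set AK := (surfaceMeasure K c).real (Ioc r r')
  set AL := (surfaceMeasure L c).real (Ioc r r')
  set BK := inner ℝ (vertexPos K r') (v r) - inner ℝ (vertexPos K r) (v r)
  set BL := inner ℝ (vertexPos L r') (v r) - inner ℝ (vertexPos L r) (v r)
  set B := (1 - l) * BK + l * BL
  set A' := (1 - l) * AK + l * AL with hA'
  have c1 : B ≤ A' :=
    add_le_add (mul_le_mul_of_nonneg_left b2 (by linarith [hl.2])) (mul_le_mul_of_nonneg_left b3 hl.1)
  have c2 : A' * Real.cos (r' - r) ≤ B := by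
    have := add_le_add (mul_le_mul_of_nonneg_left b2' (by linarith [hl.2] : 0 ≤ 1 - l))
      (mul_le_mul_of_nonneg_left b3' hl.1)
    simp only [hA', B]
    linarith
  have hd0 : 0 ≤ r' - r := by linarith
  have hsq : (r' - r) ^ 2 ≤ r' - r := by nlinarith
  have hA0 : 0 ≤ A := measureReal_nonneg
  have hA'0 : 0 ≤ A' := add_nonneg
    (mul_nonneg (by linarith [hl.2]) measureReal_nonneg) (mul_nonneg hl.1 measureReal_nonneg)
  have hB0 : 0 ≤ B := (mul_nonneg hA'0 (by linarith)).trans c2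
  have d1 : A - B ≤ ε * A := by
    have : A * (1 - Real.cos (r' - r)) ≤ A * ε := mul_le_mul_of_nonneg_left (by linarith) hA0
    linarith
  have d2 : A' - B ≤ ε * A := by
    have h1 : A' ≤ 2 * B := by nlinarith
    have h2 : A' * (1 - Real.cos (r' - r)) ≤ 2 * B * (ε / 2) :=
      mul_le_mul h1 (by linarith) (by linarith [Real.cos_le_one (r' - r)]) (by linarith)
    have h3 := mul_le_mul_of_nonneg_left b1 hε.le
    linarith
  have e2 : (1 - l) * (surfaceMeasure K c).real (Ioc s r') +
      l * (surfaceMeasure L c).real (Ioc s r') -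
      ((1 - l) * (surfaceMeasure K c).real (Ioc s r) + l * (surfaceMeasure L c).real (Ioc s r)) =
      A' := by
    rw [hA', ← a2, ← a3]
    ring
  rw [a1, abs_le]
  constructor <;> linarith

theorem surfaceMeasure_comb {K L : Body} {l : ℝ} (hl : l ∈ Icc (0 : ℝ) 1) (c : ℝ) :
    surfaceMeasure (comb l K L) c =
      ENNReal.ofReal (1 - l) • surfaceMeasure K c + ENNReal.ofReal l • surfaceMeasure L c := by
  have hl' : 0 ≤ 1 - l := by linarith [hl.2]
  refine Measure.ext_of_Ioc _ _ fun a b hab => ?_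
  have key : ∀ M : Body, surfaceMeasure M c (Ioc a b) =
      surfaceMeasure M c (Ioc (max a c) (min b (c + 2))) := fun M => by
    rw [surfaceMeasure_apply _ _ measurableSet_Ioc, surfaceMeasure_apply _ _ measurableSet_Ioc,
      Ioc_inter_Ioc, Ioc_inter_Ioc]
    simp
  rw [Measure.add_apply, Measure.smul_apply, Measure.smul_apply, key, key K, key L, smul_eq_mul,
    smul_eq_mul]
  rcases le_total (min b (c + 2)) (max a c) with h | h
  · rw [Ioc_eq_empty (not_lt.2 h)]; simp
  · have := surfaceMeasure_real_Ioc_comb (K := K) (L := L) hl (le_max_right a c) h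
      (min_le_right b (c + 2))
    rw [← ofReal_measureReal, ← ofReal_measureReal (μ := surfaceMeasure K c),
      ← ofReal_measureReal (μ := surfaceMeasure L c), this, ← ENNReal.ofReal_mul hl',
      ← ENNReal.ofReal_mul hl.1, ENNReal.ofReal_add (mul_nonneg hl' measureReal_nonneg)
      (mul_nonneg hl.1 measureReal_nonneg)]

theorem surfaceArea_comb {K L : Body} {l c : ℝ} (hl : l ∈ Icc (0 : ℝ) 1) {X : Set ℝ}
    (hX : MeasurableSet X) (h : X ⊆ Ioc c (c + 2)) :
    surfaceArea (comb l K L) X =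
      ENNReal.ofReal (1 - l) * surfaceArea K X + ENNReal.ofReal l * surfaceArea L X := by
  rw [← surfaceMeasure_of_subset _ hX h, ← surfaceMeasure_of_subset _ hX h,
    ← surfaceMeasure_of_subset _ hX h, surfaceMeasure_comb hl]
  simp

theorem lintegral_comb {l : ℝ} {r s : ℝ → ℝ≥0} (hr : Measurable r) (hs : Measurable s)
    (X : Set ℝ) : ∫⁻ t in X, ((Real.toNNReal (1 - l) * r t + Real.toNNReal l * s t : ℝ≥0) : ℝ≥0∞) =
      ENNReal.ofReal (1 - l) * (∫⁻ t in X, r t) + ENNReal.ofReal l * ∫⁻ t in X, s t := by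
  simp only [ENNReal.coe_add, ENNReal.coe_mul]
  rw [lintegral_add_left (by fun_prop), lintegral_const_mul _ (by fun_prop),
    lintegral_const_mul _ (by fun_prop)]
  rfl

/-! ### Closure of the injectivity condition -/

theorem innerCorner_comb {K L : Body} {l : ℝ} (hl : l ∈ Icc (0 : ℝ) 1) :
    innerCorner (comb l K L) = fun t => (1 - l) • innerCorner K t + l • innerCorner L t := by
  funext t
  simp only [innerCorner, supp_comb hl]
  module

theorem differentiableAt_innerCorner {K : Body} (hK : InjectivityCondition K) {t : ℝ}
    (ht : t ∈ Ioo 0 (Real.pi / 2)) : DifferentiableAt ℝ (innerCorner K) t :=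
  ((hK.contDiff_corner.contDiffAt (Icc_mem_nhds ht.1 ht.2)).differentiableAt (by norm_num))

theorem InjectivityCondition.comb {K L : Body} (hK : InjectivityCondition K)
    (hL : InjectivityCondition L) {l : ℝ} (hl : l ∈ Icc (0 : ℝ) 1) :
    InjectivityCondition (comb l K L) := by
  have hpi := Real.pi_gt_three
  have hpi' := Real.pi_lt_d2
  constructor
  · obtain ⟨r, hr, hrK⟩ := hK.density_right
    obtain ⟨s, hs, hsL⟩ := hL.density_right
    refine ⟨fun t => Real.toNNReal (1 - l) * r t + Real.toNNReal l * s t, by fun_prop,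
      fun X hX hXm => ?_⟩
    -- The window is open on the left, so it must begin before 0; (-1/4, 7/4] contains [0, π/2).
    rw [surfaceArea_comb (c := -(1 / 4)) hl hXm
      (fun t ht => ⟨by linarith [(hX ht).1], by linarith [(hX ht).2]⟩),
      hrK X hX hXm, hsL X hX hXm]
    exact (lintegral_comb hr hs X).symm
  · obtain ⟨r, hr, hrK⟩ := hK.density_left
    obtain ⟨s, hs, hsL⟩ := hL.density_left
    refine ⟨fun t => Real.toNNReal (1 - l) * r t + Real.toNNReal l * s t, by fun_prop,
      fun X hX hXm => ?_⟩
    rw [surfaceArea_comb (c := Real.pi / 2) hl hXm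
      (fun t ht => ⟨by linarith [(hX ht).1], by linarith [(hX ht).2]⟩),
      hrK X hX hXm, hsL X hX hXm]
    exact (lintegral_comb (hr.comp (measurable_id.sub_const _))
      (hs.comp (measurable_id.sub_const _)) X).symm
  · rw [innerCorner_comb hl]
    exact (hK.contDiff_corner.const_smul _).add (hL.contDiff_corner.const_smul _)
  · intro t ht
    have hd : deriv (innerCorner (Sofa.comb l K L)) t =
        (1 - l) • deriv (innerCorner K) t + l • deriv (innerCorner L) t := by
      rw [innerCorner_comb hl]
      exact (((differentiableAt_innerCorner hK ht).hasDerivAt.const_smul (1 - l)).add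
        ((differentiableAt_innerCorner hL ht).hasDerivAt.const_smul l)).deriv
    obtain ⟨hK1, hK2⟩ := hK.deriv_corner t ht
    obtain ⟨hL1, hL2⟩ := hL.deriv_corner t ht
    rw [hd, inner_add_left, inner_add_left, inner_smul_left, inner_smul_left, inner_smul_left,
      inner_smul_left]
    simp only [conj_trivial]
    -- Strictness comes from the second body when l > 0 and from the first when l = 0.
    rcases hl.1.eq_or_lt with rfl | hl0
    · simpa using ⟨hK1, hK2⟩
    · have h1 : 0 ≤ 1 - l := by linarith [hl.2]
      constructor <;> nlinarith [mul_pos hl0 hL2, mul_neg_of_pos_of_neg hl0 hL1,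
        mul_nonneg h1 hK2.le, mul_nonneg h1 (neg_nonneg.2 hK1.le)]

/-! ### The area of the inner corner curve -/

theorem norm_sub_le_of_hasDeriv_right {x x' : ℝ → Plane} {M : ℝ} (hx : Continuous x)
    (hd : ∀ t, HasDerivWithinAt x (x' t) (Ioi t) t) (hM : ∀ t, ‖x' t‖ ≤ M) {s t : ℝ}
    (hst : s ≤ t) : ‖x t - x s‖ ≤ M * (t - s) :=
  norm_image_sub_le_of_norm_deriv_right_le_segment hx.continuousOn
    (fun r _ => (hd r).Ici_of_Ioi) (fun r _ => hM r) t ⟨hst, le_rfl⟩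

theorem cross_self (p : Plane) : cross p p = 0 := by
  rw [cross_apply]; ring

/-- A bounded right derivative makes the curve Lipschitz, hence of bounded variation, and ∫ x × x'
has the increments required by `two_mul_curveArea_eq`. Right derivatives suffice, so the inner
corner formula holds for every body. -/
theorem two_mul_curveArea_of_hasDeriv_right {x x' : ℝ → Plane} {a b M : ℝ} (hab : a ≤ b)
    (hx : Continuous x) (hx' : Measurable x')
    (hd : ∀ t, HasDerivWithinAt x (x' t) (Ioi t) t) (hM : ∀ t, ‖x' t‖ ≤ M) :
    2 * curveArea a b x = ∫ t in a..b, cross (x t) (x' t) := by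
  have hM0 : 0 ≤ M := (norm_nonneg _).trans (hM 0)
  have hlip : LipschitzWith M.toNNReal x := LipschitzWith.of_dist_le_mul fun s t => by
    rw [dist_eq_norm, Real.dist_eq, Real.coe_toNNReal _ hM0]
    rcases le_total s t with h | h
    · rw [norm_sub_rev, abs_sub_comm, abs_of_nonneg (sub_nonneg.2 h)]
      exact norm_sub_le_of_hasDeriv_right hx hd hM h
    · rw [abs_of_nonneg (sub_nonneg.2 h)]
      exact norm_sub_le_of_hasDeriv_right hx hd hM h
  have hbv : BoundedVariationOn x (Icc a b) := by
    have := (hlip.lipschitzOnWith (s := Icc a b)).locallyBoundedVariationOn a b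
      (left_mem_Icc.2 hab) (right_mem_Icc.2 hab)
    rwa [inter_self] at this
  have hbound : ∀ p t, |cross p (x' t)| ≤ ‖cross‖ * ‖p‖ * M := fun p t =>
    (cross.le_opNorm₂ p (x' t)).trans (mul_le_mul_of_nonneg_left (hM t) (by positivity))
  have hint : ∀ (y : ℝ → Plane), Continuous y → ∀ s t,
      IntervalIntegrable (fun r => cross (y r) (x' r)) volume s t := by
    intro y hy s t
    obtain ⟨C, hC⟩ := (isCompact_uIcc (a := s) (b := t)).exists_bound_of_continuousOn hy.continuousOn
    have hm : Measurable fun r => cross (y r) (x' r) := by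
      simp only [cross_apply]
      fun_prop
    refine (intervalIntegrable_const (c := ‖cross‖ * C * M)).mono_fun
      hm.aestronglyMeasurable ?_
    refine (ae_restrict_mem measurableSet_uIoc).mono fun r hr => ?_
    refine (hbound (y r) r).trans (le_trans ?_ (le_abs_self _))
    gcongr
    exact hC r (uIoc_subset_uIcc hr)
  have := two_mul_curveArea_eq (F := fun t => ∫ r in a..t, cross (x r) (x' r)) hab hx.continuousOn
    hbv ?_
  · simpa using this
  intro ε hε
  refine ⟨ε / (‖cross‖ * M * M + 1), by positivity, fun s t _ hst _ hδ => ?_⟩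
  -- The function r ↦ x(s) × x(r) vanishes at r = s.
  have e1 : (∫ r in s..t, cross (x s) (x' r)) = cross (x s) (x t) := by
    rw [intervalIntegral.integral_eq_sub_of_hasDeriv_right_of_le (f := fun r => cross (x s) (x r))
      hst (by fun_prop) (fun r _ => (cross (x s)).hasFDerivAt.comp_hasDerivWithinAt r (hd r))
      (hint _ continuous_const s t), cross_self, sub_zero]
  have e2 : (∫ r in a..t, cross (x r) (x' r)) - (∫ r in a..s, cross (x r) (x' r)) -
      cross (x s) (x t) = ∫ r in s..t, cross (x r - x s) (x' r) := by
    rw [intervalIntegral.integral_interval_sub_left (hint x hx _ _) (hint x hx _ _), ← e1,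
      ← intervalIntegral.integral_sub (hint x hx _ _) (hint _ continuous_const _ _)]
    simp only [map_sub, sub_apply]
  rw [e2]
  have e3 : ‖∫ r in s..t, cross (x r - x s) (x' r)‖ ≤ ε * |t - s| := by
    refine intervalIntegral.norm_integral_le_of_norm_le_const fun r hr => ?_
    rw [uIoc_of_le hst] at hr
    have h1 := norm_sub_le_of_hasDeriv_right hx hd hM hr.1.le
    rw [le_div_iff₀ (by positivity)] at hδ
    have h2 : ‖x r - x s‖ ≤ M * (t - s) :=
      h1.trans (mul_le_mul_of_nonneg_left (by linarith [hr.2]) hM0)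
    calc _ ≤ ‖cross‖ * ‖x r - x s‖ * M := hbound _ _
      _ ≤ ‖cross‖ * (M * (t - s)) * M := by gcongr
      _ = (t - s) * (‖cross‖ * M * M) := by ring
      _ ≤ ε := by linarith
  rw [Real.norm_eq_abs, abs_of_nonneg (sub_nonneg.2 hst)] at e3
  have : 0 ≤ ε * ‖x t - x s‖ := by positivity
  linarith

/-- The right derivative of the inner corner. -/
def innerCornerDeriv (K : Body) (t : ℝ) : Plane :=
  (suppDeriv K t - (supp K (t + Real.pi / 2) - 1)) • u t +
    (suppDeriv K (t + Real.pi / 2) + (supp K t - 1)) • v t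

theorem hasDerivWithinAt_comp_add_const {f : ℝ → ℝ} {f' c t : ℝ}
    (h : HasDerivWithinAt f f' (Ioi (t + c)) (t + c)) :
    HasDerivWithinAt (fun s => f (s + c)) f' (Ioi t) t := by
  have := h.comp t ((hasDerivWithinAt_id t (Ioi t)).add_const c)
    (fun s (hs : t < s) => show t + c < s + c by linarith)
  rwa [mul_one] at this

theorem hasDerivWithinAt_innerCorner (K : Body) (t : ℝ) :
    HasDerivWithinAt (innerCorner K) (innerCornerDeriv K t) (Ioi t) t := by
  have h1 := ((hasDerivWithinAt_supp K t).sub_const 1).smul (hasDerivAt_u t).hasDerivWithinAt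
  have h2 := ((hasDerivWithinAt_comp_add_const (hasDerivWithinAt_supp K (t + Real.pi / 2))).sub_const
    1).smul (hasDerivAt_v t).hasDerivWithinAt
  convert! h1.add h2 using 1
  rw [innerCornerDeriv]
  module

theorem two_mul_curveArea_innerCorner (K : Body) {a b : ℝ} (hab : a ≤ b) :
    2 * curveArea a b (innerCorner K) =
      ∫ t in a..b, ((supp K t - 1) ^ 2 + (supp K (t + Real.pi / 2) - 1) ^ 2 +
        (supp K t - 1) * suppDeriv K (t + Real.pi / 2) -
        (supp K (t + Real.pi / 2) - 1) * suppDeriv K t) := by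
  obtain ⟨R, hR0, hR⟩ := exists_norm_le K
  have hc := continuous_supp K
  have hm := measurable_suppDeriv K
  have hu := continuous_u
  have hv := continuous_v
  rw [two_mul_curveArea_of_hasDeriv_right (x := innerCorner K) (M := 4 * R + 2) hab
    (by unfold innerCorner; fun_prop)
    (by
      unfold innerCornerDeriv
      have := hu.measurable
      have := hv.measurable
      have := hc.measurable
      fun_prop)
    (hasDerivWithinAt_innerCorner K) (fun t => ?_)]
  · refine intervalIntegral.integral_congr fun t _ => ?_
    beta_reduce
    rw [cross_frame _ _ t, innerCorner, innerCornerDeriv, inner_frame_u, inner_frame_u,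
      inner_frame_v, inner_frame_v]
    ring
  · have h1 := abs_le.1 (abs_supp_le hR t)
    have h2 := abs_le.1 (abs_supp_le hR (t + Real.pi / 2))
    have h3 := abs_le.1 (abs_suppDeriv_le hR t)
    have h4 := abs_le.1 (abs_suppDeriv_le hR (t + Real.pi / 2))
    refine (norm_add_le _ _).trans ?_
    rw [norm_smul, norm_smul, norm_u, norm_v, mul_one, mul_one, Real.norm_eq_abs, Real.norm_eq_abs]
    have h5 : |suppDeriv K t - (supp K (t + Real.pi / 2) - 1)| ≤ 2 * R + 1 := by
      rw [abs_le]; constructor <;> linarith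
    have h6 : |suppDeriv K (t + Real.pi / 2) + (supp K t - 1)| ≤ 2 * R + 1 := by
      rw [abs_le]; constructor <;> linarith
    linarith

/-! ### Functions with a bounded right derivative -/

/-- `k` is continuous and has the bounded measurable right derivative `k'`. -/
structure IsProfile (k k' : ℝ → ℝ) : Prop where
  continuous : Continuous k
  measurable : Measurable k'
  bounded : ∃ M, ∀ t, |k' t| ≤ M
  hasDeriv : ∀ t, HasDerivWithinAt k (k' t) (Ioi t) t

theorem isProfile_supp (K : Body) : IsProfile (supp K) (suppDeriv K) := by
  obtain ⟨R, -, hR⟩ := exists_norm_le K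
  exact ⟨continuous_supp K, measurable_suppDeriv K, ⟨R, abs_suppDeriv_le hR⟩,
    hasDerivWithinAt_supp K⟩

namespace IsProfile

variable {k k' l l' : ℝ → ℝ}

theorem zero : IsProfile 0 0 :=
  ⟨continuous_const, measurable_const, ⟨0, by simp⟩, fun t => hasDerivWithinAt_const t _ 0⟩

theorem add (hk : IsProfile k k') (hl : IsProfile l l') : IsProfile (k + l) (k' + l') := by
  obtain ⟨M, hM⟩ := hk.bounded
  obtain ⟨N, hN⟩ := hl.bounded
  exact ⟨hk.continuous.add hl.continuous, hk.measurable.add hl.measurable,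
    ⟨M + N, fun t => (abs_add_le _ _).trans (add_le_add (hM t) (hN t))⟩,
    fun t => (hk.hasDeriv t).add (hl.hasDeriv t)⟩

theorem smul (hk : IsProfile k k') (c : ℝ) : IsProfile (c • k) (c • k') := by
  obtain ⟨M, hM⟩ := hk.bounded
  refine ⟨hk.continuous.const_smul c, hk.measurable.const_smul c, ⟨|c| * M, fun t => ?_⟩,
    fun t => (hk.hasDeriv t).const_smul c⟩
  rw [Pi.smul_apply, smul_eq_mul, abs_mul]
  exact mul_le_mul_of_nonneg_left (hM t) (abs_nonneg c)

theorem sub_const (hk : IsProfile k k') (c : ℝ) : IsProfile (fun t => k t - c) k' :=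
  ⟨hk.continuous.sub continuous_const, hk.measurable, hk.bounded,
    fun t => (hk.hasDeriv t).sub_const c⟩

theorem comp_add_const (hk : IsProfile k k') (c : ℝ) :
    IsProfile (fun t => k (t + c)) fun t => k' (t + c) := by
  obtain ⟨M, hM⟩ := hk.bounded
  exact ⟨hk.continuous.comp (by fun_prop), hk.measurable.comp (by fun_prop),
    ⟨M, fun t => hM (t + c)⟩, fun t => hasDerivWithinAt_comp_add_const (hk.hasDeriv (t + c))⟩

theorem exists_lipschitz (hk : IsProfile k k') : ∃ M, 0 ≤ M ∧ ∀ s t, |k t - k s| ≤ M * |t - s| := by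
  obtain ⟨M, hM⟩ := hk.bounded
  have key : ∀ s t, s ≤ t → |k t - k s| ≤ M * (t - s) := fun s t hst =>
    norm_image_sub_le_of_norm_deriv_right_le_segment hk.continuous.continuousOn
      (fun r _ => (hk.hasDeriv r).Ici_of_Ioi) (fun r _ => hM r) t ⟨hst, le_rfl⟩
  refine ⟨M, (abs_nonneg _).trans (hM 0), fun s t => ?_⟩
  rcases le_total s t with h | h
  · rw [abs_of_nonneg (sub_nonneg.2 h)]; exact key s t h
  · rw [abs_sub_comm, abs_sub_comm t s, abs_of_nonneg (sub_nonneg.2 h)]; exact key t s h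

end IsProfile

/-- This is x ≤ tan x without division; it controls the pole of the cotangent by |x|⁻¹. -/
theorem abs_mul_cos_le_abs_sin {x : ℝ} (hx : |x| ≤ Real.pi / 2) :
    |x| * Real.cos x ≤ |Real.sin x| := by
  have hs : |Real.sin x| = |Real.sin (|x|)| := by
    rcases abs_choice x with h | h <;> rw [h]
    rw [Real.sin_neg, abs_neg]
  rw [← Real.cos_abs, hs]
  have h0 := abs_nonneg x
  rcases h0.eq_or_lt with h | h
  · rw [← h]; simp
  refine le_trans ?_ (le_abs_self _)
  rcases hx.eq_or_lt with h' | h'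
  · rw [h']; simp
  · have hc : 0 < Real.cos |x| := Real.cos_pos_of_mem_Ioo ⟨by linarith, h'⟩
    have := Real.lt_tan h h'
    rw [Real.tan_eq_sin_div_cos, lt_div_iff₀ hc] at this
    exact this.le

theorem hasDerivAt_neg_cot {c r : ℝ} (h : Real.sin (r - c) ≠ 0) :
    HasDerivAt (fun r => -(Real.cos (r - c) / Real.sin (r - c)))
      (1 + (-(Real.cos (r - c) / Real.sin (r - c))) ^ 2) r := by
  have h1 := (Real.hasDerivAt_cos (r - c)).comp r ((hasDerivAt_id r).sub_const c)
  have h2 := (Real.hasDerivAt_sin (r - c)).comp r ((hasDerivAt_id r).sub_const c)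
  convert! (h1.div h2 h).neg using 1
  simp only [Function.comp_apply, id]
  field_simp
  ring

/-- Measurable functions that are bounded on compact intervals. -/
def IsLocBdd (f : ℝ → ℝ) : Prop := Measurable f ∧ ∀ a b, ∃ M, ∀ t ∈ uIcc a b, |f t| ≤ M

namespace IsLocBdd

variable {f g : ℝ → ℝ}

theorem mul (hf : IsLocBdd f) (hg : IsLocBdd g) : IsLocBdd fun t => f t * g t := by
  refine ⟨hf.1.mul hg.1, fun a b => ?_⟩
  obtain ⟨M, hM⟩ := hf.2 a b
  obtain ⟨N, hN⟩ := hg.2 a b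
  refine ⟨M * N, fun t ht => ?_⟩
  rw [abs_mul]
  exact mul_le_mul (hM t ht) (hN t ht) (abs_nonneg _) ((abs_nonneg _).trans (hM t ht))

theorem intervalIntegrable (hf : IsLocBdd f) (a b : ℝ) : IntervalIntegrable f volume a b := by
  obtain ⟨M, hM⟩ := hf.2 a b
  refine (intervalIntegrable_const (c := M)).mono_fun hf.1.aestronglyMeasurable ?_
  refine (ae_restrict_mem measurableSet_uIoc).mono fun t ht => ?_
  exact (hM t (uIoc_subset_uIcc ht)).trans (le_abs_self _)

end IsLocBdd

namespace IsProfile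

variable {k k' l l' : ℝ → ℝ}

theorem isLocBdd (hk : IsProfile k k') : IsLocBdd k :=
  ⟨hk.continuous.measurable, fun a b => by
    obtain ⟨M, hM⟩ := (isCompact_uIcc (a := a) (b := b)).exists_bound_of_continuousOn
      hk.continuous.continuousOn
    exact ⟨M, hM⟩⟩

theorem isLocBdd_deriv (hk : IsProfile k k') : IsLocBdd k' :=
  ⟨hk.measurable, fun _ _ => hk.bounded.imp fun _ h t _ => h t⟩

theorem intervalIntegrable_sq_sub (hk : IsProfile k k') (a b : ℝ) :
    IntervalIntegrable (fun t => k t ^ 2 - k' t ^ 2) volume a b := by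
  simp only [sq]
  exact ((hk.isLocBdd.mul hk.isLocBdd).intervalIntegrable a b).sub
    ((hk.isLocBdd_deriv.mul hk.isLocBdd_deriv).intervalIntegrable a b)

/-! ### Riccati inequalities -/

/-- The right derivative of w k² exceeds k² - k'² by the square (w k + k')². The Riccati equation is
needed only in the open interval, so w may have a pole at an end where k vanishes, provided w k²
stays continuous. -/
theorem integral_sq_sub_sq_le (hk : IsProfile k k') {w : ℝ → ℝ} {s t : ℝ} (hst : s ≤ t)
    (hw : ∀ r ∈ Ioo s t, HasDerivAt w (1 + w r ^ 2) r)
    (hc : ContinuousOn (fun r => w r * k r ^ 2) (Icc s t)) :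
    ∫ r in s..t, (k r ^ 2 - k' r ^ 2) ≤ w t * k t ^ 2 - w s * k s ^ 2 := by
  refine intervalIntegral.integral_le_sub_of_hasDeriv_right_of_le hst hc
    (fun r hr => (hw r hr).hasDerivWithinAt.mul ((hk.hasDeriv r).pow 2))
    ((intervalIntegrable_iff_integrableOn_Icc_of_le hst).1 (hk.intervalIntegrable_sq_sub s t))
    fun r _ => ?_
  have := sq_nonneg (w r * k r + k' r)
  simp only [Nat.cast_ofNat, Nat.add_one_sub_one, pow_one]
  linarith

theorem integral_sq_sub_sq_le_tan (hk : IsProfile k k') {c s t : ℝ} (hst : s ≤ t)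
    (hs : c - Real.pi / 2 < s) (ht : t < c + Real.pi / 2) :
    ∫ r in s..t, (k r ^ 2 - k' r ^ 2) ≤ Real.tan (t - c) * k t ^ 2 - Real.tan (s - c) * k s ^ 2 := by
  have hd : ∀ r ∈ Icc s t, HasDerivAt (fun r => Real.tan (r - c)) (1 + Real.tan (r - c) ^ 2) r := by
    intro r hr
    have hcos : Real.cos (r - c) ≠ 0 :=
      (Real.cos_pos_of_mem_Ioo ⟨by linarith [hr.1], by linarith [hr.2]⟩).ne'
    have := (Real.hasDerivAt_tan hcos).comp r ((hasDerivAt_id r).sub_const c)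
    convert! this using 1
    rw [mul_one, eq_div_iff (pow_ne_zero 2 hcos)]
    exact Real.one_add_tan_sq_mul_cos_sq_eq_one hcos
  refine hk.integral_sq_sub_sq_le (w := fun r => Real.tan (r - c)) hst
    (fun r hr => hd r ⟨hr.1.le, hr.2.le⟩) ?_
  exact ContinuousOn.mul (fun r hr => (hd r hr).continuousAt.continuousWithinAt)
    (hk.continuous.pow 2).continuousOn

/-- Away from c nothing is singular. At c, k is Lipschitz and vanishes, so cot · k² is O(|r - c|).
-/
theorem continuousOn_cot_mul_sq (hk : IsProfile k k') {c : ℝ} (hkc : k c = 0) :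
    ContinuousOn (fun r => -(Real.cos (r - c) / Real.sin (r - c)) * k r ^ 2)
      (Icc (c - Real.pi / 2) (c + Real.pi / 2)) := by
  have hpi := Real.pi_pos
  intro r hr
  rcases eq_or_ne r c with rfl | hrc
  · obtain ⟨M, hM0, hM⟩ := hk.exists_lipschitz
    have hlim : Tendsto (fun s => M ^ 2 * |s - r|) (𝓝[Icc (r - Real.pi / 2) (r + Real.pi / 2)] r)
        (𝓝 0) := by
      have : Continuous fun s => M ^ 2 * |s - r| := by fun_prop
      exact (this.tendsto' r 0 (by simp)).mono_left nhdsWithin_le_nhds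
    rw [ContinuousWithinAt, hkc]
    simp only [ne_eq, OfNat.ofNat_ne_zero, not_false_eq_true, zero_pow, mul_zero]
    refine squeeze_zero_norm' ?_ hlim
    filter_upwards [self_mem_nhdsWithin] with s hs
    have hx : |s - r| ≤ Real.pi / 2 := by rw [abs_le]; constructor <;> linarith [hs.1, hs.2]
    have h1 := abs_mul_cos_le_abs_sin hx
    have hcos : 0 ≤ Real.cos (s - r) := by
      rw [← Real.cos_abs]
      exact Real.cos_nonneg_of_mem_Icc ⟨by linarith [abs_nonneg (s - r)], hx⟩
    have h2 := hM r s
    rw [hkc, sub_zero] at h2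
    rw [norm_mul, norm_neg, norm_div, norm_pow, Real.norm_eq_abs, Real.norm_eq_abs,
      Real.norm_eq_abs, abs_of_nonneg hcos]
    rcases (abs_nonneg (Real.sin (s - r))).eq_or_lt with h0 | h0
    · rw [← h0]; simp; positivity
    · rw [div_mul_eq_mul_div, div_le_iff₀ h0]
      have h3 : |k s| ^ 2 ≤ (M * |s - r|) ^ 2 := by gcongr
      calc Real.cos (s - r) * |k s| ^ 2 ≤ Real.cos (s - r) * (M * |s - r|) ^ 2 := by gcongr
        _ = M ^ 2 * |s - r| * (|s - r| * Real.cos (s - r)) := by ring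
        _ ≤ _ := by gcongr
  · have hsin : Real.sin (r - c) ≠ 0 := by
      rcases lt_or_gt_of_ne hrc with h | h
      · exact (Real.sin_neg_of_neg_of_neg_pi_lt (by linarith) (by linarith [hr.1])).ne
      · exact (Real.sin_pos_of_pos_of_lt_pi (by linarith) (by linarith [hr.2])).ne'
    have := hk.continuous.continuousAt (x := r)
    refine ContinuousAt.continuousWithinAt ?_
    fun_prop (disch := exact hsin)

theorem integral_sq_sub_sq_le_right (hk : IsProfile k k') {c s : ℝ} (hkc : k c = 0) (hs : c ≤ s)
    (hs' : s ≤ c + Real.pi / 2) :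
    ∫ r in c..s, (k r ^ 2 - k' r ^ 2) ≤ -(Real.cos (s - c) / Real.sin (s - c)) * k s ^ 2 := by
  have := hk.integral_sq_sub_sq_le hs
    (fun r hr => hasDerivAt_neg_cot (c := c)
      (Real.sin_pos_of_pos_of_lt_pi (by linarith [hr.1])
        (by linarith [hr.2, Real.pi_pos])).ne')
    ((hk.continuousOn_cot_mul_sq hkc).mono
      (Icc_subset_Icc (by linarith [Real.pi_pos]) hs'))
  rw [hkc] at this
  linarith

theorem integral_sq_sub_sq_le_left (hk : IsProfile k k') {c s : ℝ} (hkc : k c = 0) (hs : s ≤ c)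
    (hs' : c - Real.pi / 2 ≤ s) :
    ∫ r in s..c, (k r ^ 2 - k' r ^ 2) ≤ -(Real.cos (c - s) / Real.sin (c - s)) * k s ^ 2 := by
  have := hk.integral_sq_sub_sq_le hs
    (fun r hr => hasDerivAt_neg_cot (c := c)
      (Real.sin_neg_of_neg_of_neg_pi_lt (by linarith [hr.2])
        (by linarith [hr.1, Real.pi_pos])).ne)
    ((hk.continuousOn_cot_mul_sq hkc).mono
      (Icc_subset_Icc hs' (by linarith [Real.pi_pos])))
  rw [hkc, ← neg_sub c s, Real.cos_neg, Real.sin_neg] at this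
  rw [div_neg] at this
  linarith

end IsProfile

/-! ### Quadratic functions on vector spaces -/

/-- Diagonals of bilinear forms. -/
def IsQuadratic {E : Type*} [AddCommGroup E] [Module ℝ E] (f : E → ℝ) : Prop :=
  ∃ g : E →ₗ[ℝ] E →ₗ[ℝ] ℝ, ∀ p, f p = g p p

namespace IsQuadratic

variable {E F : Type*} [AddCommGroup E] [Module ℝ E] [AddCommGroup F] [Module ℝ F] {f f' : E → ℝ}

theorem add (hf : IsQuadratic f) (hf' : IsQuadratic f') : IsQuadratic fun p => f p + f' p := by
  obtain ⟨g, hg⟩ := hf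
  obtain ⟨g', hg'⟩ := hf'
  exact ⟨g + g', fun p => by simp [hg, hg']⟩

theorem sub (hf : IsQuadratic f) (hf' : IsQuadratic f') : IsQuadratic fun p => f p - f' p := by
  obtain ⟨g, hg⟩ := hf
  obtain ⟨g', hg'⟩ := hf'
  exact ⟨g - g', fun p => by simp [hg, hg']⟩

theorem comp (hf : IsQuadratic f) (π : F →ₗ[ℝ] E) : IsQuadratic fun p => f (π p) := by
  obtain ⟨g, hg⟩ := hf
  exact ⟨(g.comp π).compl₂ π, fun p => hg _⟩

theorem mul (l m : E →ₗ[ℝ] ℝ) : IsQuadratic fun p => l p * m p := ⟨l.smulRight m, fun _ => rfl⟩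

theorem integral {a b : ℝ} (g : ℝ → E →ₗ[ℝ] E →ₗ[ℝ] ℝ)
    (hg : ∀ p q, IntervalIntegrable (fun t => g t p q) volume a b) :
    IsQuadratic fun p => ∫ t in a..b, g t p p :=
  ⟨LinearMap.mk₂ ℝ (fun p q => ∫ t in a..b, g t p q)
    (fun p p' q => by
      simp only [map_add, LinearMap.add_apply]
      exact intervalIntegral.integral_add (hg p q) (hg p' q))
    (fun c p q => by
      simp only [map_smul, LinearMap.smul_apply]
      exact intervalIntegral.integral_smul c _)
    (fun p q q' => by
      simp only [map_add]
      exact intervalIntegral.integral_add (hg p q) (hg p q'))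
    (fun c p q => by
      simp only [map_smul]
      exact intervalIntegral.integral_smul c _), fun _ => rfl⟩

/-- This identity reduces concavity of a quadratic form on a convex set to its sign on differences.
-/
theorem apply_comb (hf : IsQuadratic f) (l : ℝ) (p q : E) :
    f ((1 - l) • p + l • q) = (1 - l) * f p + l * f q - l * (1 - l) * f (p - q) := by
  obtain ⟨g, hg⟩ := hf
  simp only [hg, map_add, map_sub, map_smul, LinearMap.add_apply, LinearMap.sub_apply,
    LinearMap.smul_apply, smul_eq_mul]
  ring

end IsQuadratic

/-! ### The energy of a configuration of profiles -/

/-- The vector space of profiles together with their right derivatives. -/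
def profiles : Submodule ℝ ((ℝ → ℝ) × (ℝ → ℝ)) where
  carrier := {p | IsProfile p.1 p.2}
  add_mem' hp hq := hp.add hq
  zero_mem' := IsProfile.zero
  smul_mem' c _ hp := hp.smul c

theorem isProfile_coe (p : profiles) : IsProfile p.1.1 p.1.2 := p.2

/-- The value of a profile at `t`. -/
def profileEval (t : ℝ) : profiles →ₗ[ℝ] ℝ :=
  LinearMap.proj t ∘ₗ LinearMap.fst ℝ (ℝ → ℝ) (ℝ → ℝ) ∘ₗ profiles.subtype

/-- The right derivative of a profile at `t`. -/
def profileDeriv (t : ℝ) : profiles →ₗ[ℝ] ℝ :=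
  LinearMap.proj t ∘ₗ LinearMap.snd ℝ (ℝ → ℝ) (ℝ → ℝ) ∘ₗ profiles.subtype

/-- `∫ (k² - k'²)` over `[a, b]`. -/
def areaForm (a b : ℝ) (p : profiles) : ℝ := ∫ t in a..b, (p.1.1 t ^ 2 - p.1.2 t ^ 2)

/-- Twice the area functional of a curve with coordinates `k(t)` and `k(t + π / 2)` in the frame
`u_t, v_t`. -/
def cornerForm (a b : ℝ) (p : profiles) : ℝ :=
  ∫ t in a..b, (p.1.1 t ^ 2 + p.1.1 (t + Real.pi / 2) ^ 2 + p.1.1 t * p.1.2 (t + Real.pi / 2) -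
    p.1.1 (t + Real.pi / 2) * p.1.2 t)

theorem isQuadratic_areaForm (a b : ℝ) : IsQuadratic (areaForm a b) := by
  have := IsQuadratic.integral (a := a) (b := b)
    (fun t => (profileEval t).smulRight (profileEval t) -
      (profileDeriv t).smulRight (profileDeriv t)) fun p q => by
    have h1 := (isProfile_coe p).isLocBdd.mul (isProfile_coe q).isLocBdd
    have h2 := (isProfile_coe p).isLocBdd_deriv.mul (isProfile_coe q).isLocBdd_deriv
    exact (h1.intervalIntegrable a b).sub (h2.intervalIntegrable a b)
  convert! this using 2 with p
  refine intervalIntegral.integral_congr fun t _ => ?_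
  simp [profileEval, profileDeriv, sq]

theorem isQuadratic_cornerForm (a b : ℝ) : IsQuadratic (cornerForm a b) := by
  have := IsQuadratic.integral (a := a) (b := b)
    (fun t => (profileEval t).smulRight (profileEval t) +
      (profileEval (t + Real.pi / 2)).smulRight (profileEval (t + Real.pi / 2)) +
      (profileEval t).smulRight (profileDeriv (t + Real.pi / 2)) -
      (profileEval (t + Real.pi / 2)).smulRight (profileDeriv t)) fun p q => by
    have h1 := (isProfile_coe p).isLocBdd
    have h2 := ((isProfile_coe p).comp_add_const (Real.pi / 2)).isLocBdd
    have h3 := (isProfile_coe q).isLocBdd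
    have h4 := ((isProfile_coe q).comp_add_const (Real.pi / 2)).isLocBdd
    have h5 := (isProfile_coe q).isLocBdd_deriv
    have h6 := ((isProfile_coe q).comp_add_const (Real.pi / 2)).isLocBdd_deriv
    exact ((((h1.mul h3).intervalIntegrable a b).add ((h2.mul h4).intervalIntegrable a b)).add
      ((h1.mul h6).intervalIntegrable a b)).sub ((h2.mul h5).intervalIntegrable a b)
  convert! this using 2 with p
  refine intervalIntegral.integral_congr fun t _ => ?_
  simp [profileEval, profileDeriv, sq]

/-- Profiles of a cap, of the cap shifted by one unit, and of the two bodies `B` and `D`. -/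
abbrev Config := profiles × profiles × profiles × profiles

/-- The quadratic form that computes `2𝒬`. -/
def energy (φ : ℝ) (x : Config) : ℝ :=
  areaForm 0 Real.pi x.1 +
    areaForm (3 * Real.pi / 2) (3 * Real.pi / 2 + (Real.pi / 2 - φ)) x.2.2.2 +
    areaForm (Real.pi + φ) (3 * Real.pi / 2) x.2.2.1 -
    cornerForm φ (Real.pi / 2 - φ) x.2.1 -
    profileEval (Real.pi / 2 - φ) x.2.1 * profileEval (Real.pi / 2 + (Real.pi / 2 - φ)) x.2.1 -
    profileEval φ x.2.1 * profileEval (φ + Real.pi / 2) x.2.1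

theorem isQuadratic_energy (φ : ℝ) : IsQuadratic (energy φ) := by
  let π₁ : Config →ₗ[ℝ] profiles := LinearMap.fst ℝ _ _
  let π₂ : Config →ₗ[ℝ] profiles := LinearMap.fst ℝ _ _ ∘ₗ LinearMap.snd ℝ _ _
  let π₃ : Config →ₗ[ℝ] profiles := LinearMap.fst ℝ _ _ ∘ₗ LinearMap.snd ℝ _ _ ∘ₗ LinearMap.snd ℝ _ _
  let π₄ : Config →ₗ[ℝ] profiles := LinearMap.snd ℝ _ _ ∘ₗ LinearMap.snd ℝ _ _ ∘ₗ LinearMap.snd ℝ _ _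
  exact ((((((isQuadratic_areaForm _ _).comp π₁).add ((isQuadratic_areaForm _ _).comp π₄)).add
    ((isQuadratic_areaForm _ _).comp π₃)).sub ((isQuadratic_cornerForm _ _).comp π₂)).sub
    (IsQuadratic.mul (profileEval _ ∘ₗ π₂) (profileEval _ ∘ₗ π₂))).sub
    (IsQuadratic.mul (profileEval _ ∘ₗ π₂) (profileEval _ ∘ₗ π₂))

/-! ### Negativity -/

theorem areaForm_add_areaForm (p : profiles) (a b c : ℝ) :
    areaForm a b p + areaForm b c p = areaForm a c p :=
  intervalIntegral.integral_add_adjacent_intervals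
    ((isProfile_coe p).intervalIntegrable_sq_sub _ _)
    ((isProfile_coe p).intervalIntegrable_sq_sub _ _)

/-- The weight -cot (t - π/2) vanishes at 0 and π, so the Riccati bounds on the two halves are both
zero. -/
theorem areaForm_nonpos {p : profiles} (h : p.1.1 (Real.pi / 2) = 0) :
    areaForm 0 Real.pi p ≤ 0 := by
  have hpi := Real.pi_pos
  rw [← areaForm_add_areaForm p 0 (Real.pi / 2) Real.pi]
  have h1 := (isProfile_coe p).integral_sq_sub_sq_le_left h (s := 0) (by positivity) (by simp)
  have h2 := (isProfile_coe p).integral_sq_sub_sq_le_right h (s := Real.pi) (by linarith)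
    (by linarith)
  rw [sub_zero, Real.cos_pi_div_two] at h1
  rw [sub_half, Real.cos_pi_div_two] at h2
  simp only [zero_div, neg_zero, zero_mul] at h1 h2
  exact add_nonpos h1 h2

/-- With l(t) = k(t + π/2), the end terms are the integral of (k l)', and the combined integrand is
-(k' - l)². -/
theorem cornerForm_add_le {p : profiles} {a b : ℝ} (hab : a ≤ b) :
    areaForm a b p - cornerForm a b p -
        p.1.1 a * p.1.1 (a + Real.pi / 2) + p.1.1 b * p.1.1 (b + Real.pi / 2) ≤ 0 := by
  have hp := isProfile_coe p
  have hq := hp.comp_add_const (Real.pi / 2)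
  have i1 := hp.intervalIntegrable_sq_sub a b
  have i2 : IntervalIntegrable (fun t => p.1.1 t ^ 2 + p.1.1 (t + Real.pi / 2) ^ 2 +
      p.1.1 t * p.1.2 (t + Real.pi / 2) - p.1.1 (t + Real.pi / 2) * p.1.2 t) volume a b := by
    simp only [sq]
    exact ((((hp.isLocBdd.mul hp.isLocBdd).intervalIntegrable a b).add
      ((hq.isLocBdd.mul hq.isLocBdd).intervalIntegrable a b)).add
      ((hp.isLocBdd.mul hq.isLocBdd_deriv).intervalIntegrable a b)).sub
      ((hq.isLocBdd.mul hp.isLocBdd_deriv).intervalIntegrable a b)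
  have i3 := ((hp.isLocBdd_deriv.mul hq.isLocBdd).intervalIntegrable a b).add
    ((hp.isLocBdd.mul hq.isLocBdd_deriv).intervalIntegrable a b)
  have e1 := intervalIntegral.integral_eq_sub_of_hasDeriv_right_of_le hab
    (hp.continuous.mul hq.continuous).continuousOn
    (fun t _ => (hp.hasDeriv t).mul (hq.hasDeriv t)) i3
  have e2 := intervalIntegral.integral_add i1 i3
  have e3 := intervalIntegral.integral_mono_on hab (i1.add i3) i2 fun t _ => by
    have := sq_nonneg (p.1.2 t - p.1.1 (t + Real.pi / 2))
    linarith
  simp only [Pi.mul_apply] at e1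
  rw [areaForm, cornerForm]
  linarith

/-- The cap's tangent bounds near 0 and π cancel exactly against the cotangent bounds for b and d.
In the middle, two cotangent bounds and `cornerForm_add_le` leave the negative of a perfect square.
-/
theorem energy_nonpos {φ : ℝ} (h0 : 0 < φ) (h1 : φ < Real.pi / 4) {k b d : profiles}
    (hk : k.1.1 (Real.pi / 2) = 0) (hb : b.1.1 (3 * Real.pi / 2) = 0)
    (hb' : b.1.1 (Real.pi + φ) = -k.1.1 φ) (hd : d.1.1 (3 * Real.pi / 2) = 0)
    (hd' : d.1.1 (3 * Real.pi / 2 + (Real.pi / 2 - φ)) =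
      -k.1.1 (Real.pi / 2 + (Real.pi / 2 - φ))) : energy φ (k, k, b, d) ≤ 0 := by
  have hpi := Real.pi_pos
  have hk' := isProfile_coe k
  set C := Real.cos φ / Real.sin φ
  set T := Real.sin φ / Real.cos φ with hT
  have hs : 0 < Real.sin φ := Real.sin_pos_of_pos_of_lt_pi h0 (by linarith)
  have hc : 0 < Real.cos φ := Real.cos_pos_of_mem_Ioo ⟨by linarith, by linarith⟩
  -- the part of the cap near the two ends against the bodies `B` and `D`
  have b1 := hk'.integral_sq_sub_sq_le_tan (c := 0) (s := 0) (t := φ) h0.le (by linarith)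
    (by linarith)
  have b2 := (isProfile_coe b).integral_sq_sub_sq_le_left hb (s := Real.pi + φ) (by linarith)
    (by linarith)
  have d1 := hk'.integral_sq_sub_sq_le_tan (c := Real.pi) (s := Real.pi / 2 + (Real.pi / 2 - φ))
    (t := Real.pi) (by linarith) (by linarith) (by linarith)
  have d2 := (isProfile_coe d).integral_sq_sub_sq_le_right hd
    (s := 3 * Real.pi / 2 + (Real.pi / 2 - φ)) (by linarith) (by linarith)
  -- the middle part of the cap
  have m1 := hk'.integral_sq_sub_sq_le_left hk (s := Real.pi / 2 - φ) (by linarith) (by linarith)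
  have m2 := hk'.integral_sq_sub_sq_le_right hk (s := Real.pi / 2 + (Real.pi / 2 - φ))
    (by linarith) (by linarith)
  have m3 := cornerForm_add_le (p := k) (a := φ) (b := Real.pi / 2 - φ) (by linarith)
  rw [sub_zero, sub_zero, Real.tan_zero, Real.tan_eq_sin_div_cos, ← hT] at b1
  rw [show 3 * Real.pi / 2 - (Real.pi + φ) = Real.pi / 2 - φ by ring, Real.cos_pi_div_two_sub,
    Real.sin_pi_div_two_sub, ← hT, hb'] at b2
  rw [sub_self, Real.tan_zero, show Real.pi / 2 + (Real.pi / 2 - φ) - Real.pi = -φ by ring,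
    Real.tan_neg, Real.tan_eq_sin_div_cos, ← hT] at d1
  rw [add_sub_cancel_left, Real.cos_pi_div_two_sub, Real.sin_pi_div_two_sub, ← hT, hd'] at d2
  rw [sub_sub_cancel] at m1
  rw [add_sub_cancel_left, Real.cos_pi_div_two_sub, Real.sin_pi_div_two_sub, ← hT] at m2
  rw [add_comm (Real.pi / 2 - φ)] at m3
  change areaForm _ _ _ ≤ _ at b1 b2 d1 d2 m1 m2
  have a1 := areaForm_add_areaForm k 0 φ Real.pi
  have a2 := areaForm_add_areaForm k φ (Real.pi / 2 - φ) Real.pi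
  have a3 := areaForm_add_areaForm k (Real.pi / 2 - φ) (Real.pi / 2) Real.pi
  have a4 := areaForm_add_areaForm k (Real.pi / 2) (Real.pi / 2 + (Real.pi / 2 - φ)) Real.pi
  -- Since T C = 1, the right side is T (C x + y)², with x and y the values of k at π/2 - φ and π -
  -- φ.
  have hsq : 0 ≤ C * k.1.1 (Real.pi / 2 - φ) ^ 2 + T * k.1.1 (Real.pi / 2 + (Real.pi / 2 - φ)) ^ 2 +
      2 * (k.1.1 (Real.pi / 2 - φ) * k.1.1 (Real.pi / 2 + (Real.pi / 2 - φ))) := by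
    have hTC : T * C = 1 := by
      simp only [C, hT]
      field_simp
    have : T * (C * k.1.1 (Real.pi / 2 - φ) + k.1.1 (Real.pi / 2 + (Real.pi / 2 - φ))) ^ 2 =
        C * k.1.1 (Real.pi / 2 - φ) ^ 2 + T * k.1.1 (Real.pi / 2 + (Real.pi / 2 - φ)) ^ 2 +
        2 * (k.1.1 (Real.pi / 2 - φ) * k.1.1 (Real.pi / 2 + (Real.pi / 2 - φ))) := by
      linear_combination (C * k.1.1 (Real.pi / 2 - φ) ^ 2 +
        2 * (k.1.1 (Real.pi / 2 - φ) * k.1.1 (Real.pi / 2 + (Real.pi / 2 - φ)))) * hTC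
    rw [← this]
    positivity
  change areaForm 0 Real.pi k + _ + _ - _ - k.1.1 _ * k.1.1 _ - k.1.1 _ * k.1.1 _ ≤ 0
  linarith

/-! ### The functional as a quadratic form -/

theorem u_add_pi (t : ℝ) : u (Real.pi + t) = -u t := by
  ext i; fin_cases i <;> simp [u, add_comm Real.pi, Real.cos_add_pi, Real.sin_add_pi]

theorem v_add_pi (t : ℝ) : v (Real.pi + t) = -v t := by
  ext i; fin_cases i <;> simp [v, add_comm Real.pi, Real.cos_add_pi, Real.sin_add_pi]

theorem u_add_three_pi_div_two (t : ℝ) : u (3 * Real.pi / 2 + t) = -v t := by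
  rw [show 3 * Real.pi / 2 + t = Real.pi + (t + Real.pi / 2) by ring, u_add_pi]
  ext i; fin_cases i <;> simp [u, v, Real.cos_add_pi_div_two, Real.sin_add_pi_div_two]

theorem v_add_three_pi_div_two (t : ℝ) : v (3 * Real.pi / 2 + t) = u t := by
  rw [show 3 * Real.pi / 2 + t = Real.pi + (t + Real.pi / 2) by ring, v_add_pi]
  ext i; fin_cases i <;> simp [u, v, Real.cos_add_pi_div_two, Real.sin_add_pi_div_two]

/-- The support function of a body as a profile. -/
def suppProfile (K : Body) : profiles := ⟨(supp K, suppDeriv K), isProfile_supp K⟩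

/-- The profile `h_K - 1`. -/
def suppProfileSubOne (K : Body) : profiles :=
  ⟨(fun t => supp K t - 1, suppDeriv K), (isProfile_supp K).sub_const 1⟩

/-- The configuration of profiles of a triple of bodies. -/
def config (P : Triple) : Config :=
  (suppProfile P.1, suppProfileSubOne P.1, suppProfile P.2.1, suppProfile P.2.2)

/-- At 3π/2 both h_B and h_D vanish. At the other ends the prescribed equalities turn h_B and h_D
into 1 - h_K, so the terms with the one-sided derivatives of B and D cancel between the arcs and the
segments. Only products of values of h_K - 1 survive. -/
theorem two_mul_Q {φ : ℝ} (h0 : 0 < φ) (h1 : φ < Real.pi / 4) (P : Domain φ) :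
    2 * Q φ P = energy φ (config P.1) := by
  obtain ⟨⟨K, B, D⟩, h⟩ := P
  have hpi := Real.pi_pos
  dsimp only at h
  have eK := two_mul_area h.injectiveCap.1
  have eD := two_mul_convexArcArea D (a := 3 * Real.pi / 2)
    (b := 3 * Real.pi / 2 + (Real.pi / 2 - φ)) (by linarith) (by linarith)
  have eB := two_mul_convexArcArea B (a := Real.pi + φ) (b := 3 * Real.pi / 2) (by linarith)
    (by linarith)
  have eC := two_mul_curveArea_innerCorner K (a := φ) (b := Real.pi / 2 - φ) (by linarith)
  have hK := h.injectiveCap.1.1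
  have hD0 : supp D (3 * Real.pi / 2) = 0 := by linarith [h.D_eq_start]
  have hB0 : supp B (3 * Real.pi / 2) = 0 := by
    have := h.B_eq_end
    rw [show Real.pi + Real.pi / 2 = 3 * Real.pi / 2 by ring] at this
    linarith
  have hB1 : supp B (Real.pi + φ) = -(supp K φ - 1) := by linarith [h.B_eq_start]
  have hD1 : supp D (3 * Real.pi / 2 + (Real.pi / 2 - φ)) =
      -(supp K (Real.pi / 2 + (Real.pi / 2 - φ)) - 1) := by linarith [h.D_eq_end]
  have s1 : 2 * segArea (vertexNeg D (3 * Real.pi / 2 + (Real.pi / 2 - φ)))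
      (innerCorner K (Real.pi / 2 - φ)) =
      (suppDerivNeg D (3 * Real.pi / 2 + (Real.pi / 2 - φ)) - (supp K (Real.pi / 2 - φ) - 1)) *
        (supp K (Real.pi / 2 + (Real.pi / 2 - φ)) - 1) := by
    rw [segArea, vertexNeg_eq, u_add_three_pi_div_two, v_add_three_pi_div_two, innerCorner,
      cross_frame _ _ (Real.pi / 2 - φ), smul_neg, ← neg_smul, add_comm (_ • v _), inner_frame_u,
      inner_frame_u, inner_frame_v, inner_frame_v, hD1, add_comm (Real.pi / 2 - φ)]
    ring
  have s2 : 2 * segArea (innerCorner K φ) (vertexPos B (Real.pi + φ)) =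
      -((supp K φ - 1) * suppDeriv B (Real.pi + φ)) -
        (supp K (φ + Real.pi / 2) - 1) * (supp K φ - 1) := by
    rw [segArea, vertexPos_eq, u_add_pi, v_add_pi, innerCorner, cross_frame _ _ φ, smul_neg,
      ← neg_smul, smul_neg, ← neg_smul, inner_frame_u, inner_frame_u, inner_frame_v, inner_frame_v,
      hB1]
    ring
  rw [hD0, hD1] at eD
  rw [hB0, hB1] at eB
  change _ = (∫ t in (0 : ℝ)..Real.pi, (supp K t ^ 2 - suppDeriv K t ^ 2)) +
    (∫ t in (3 * Real.pi / 2)..(3 * Real.pi / 2 + (Real.pi / 2 - φ)),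
      (supp D t ^ 2 - suppDeriv D t ^ 2)) +
    (∫ t in (Real.pi + φ)..(3 * Real.pi / 2), (supp B t ^ 2 - suppDeriv B t ^ 2)) -
    (∫ t in φ..(Real.pi / 2 - φ), ((supp K t - 1) ^ 2 + (supp K (t + Real.pi / 2) - 1) ^ 2 +
        (supp K t - 1) * suppDeriv K (t + Real.pi / 2) -
        (supp K (t + Real.pi / 2) - 1) * suppDeriv K t)) -
    (supp K (Real.pi / 2 - φ) - 1) * (supp K (Real.pi / 2 + (Real.pi / 2 - φ)) - 1) -
    (supp K φ - 1) * (supp K (φ + Real.pi / 2) - 1)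
  rw [← eK, ← eC]
  simp only [Q]
  linarith

/-! ### Minkowski combinations of admissible triples -/

theorem suppProfile_comb {l : ℝ} (hl : l ∈ Icc (0 : ℝ) 1) (K L : Body) :
    suppProfile (comb l K L) = (1 - l) • suppProfile K + l • suppProfile L := by
  refine Subtype.ext (Prod.ext (funext fun t => ?_) (funext fun t => ?_))
  · exact supp_comb hl K L t
  · exact suppDeriv_comb hl K L t

theorem suppProfileSubOne_comb {l : ℝ} (hl : l ∈ Icc (0 : ℝ) 1) (K L : Body) :
    suppProfileSubOne (comb l K L) = (1 - l) • suppProfileSubOne K + l • suppProfileSubOne L := by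
  refine Subtype.ext (Prod.ext (funext fun t => ?_) (funext fun t => ?_))
  · change supp (comb l K L) t - 1 = (1 - l) * (supp K t - 1) + l * (supp L t - 1)
    rw [supp_comb hl]
    ring
  · exact suppDeriv_comb hl K L t

/-- The shift h - 1 is only affine in h, which is why it occupies its own coordinate; it is
respected here because the weights sum to 1. -/
theorem config_minkowskiComb {l : ℝ} (hl : l ∈ Icc (0 : ℝ) 1) (P P' : Triple) :
    config (minkowskiComb l P P') = (1 - l) • config P + l • config P' :=
  Prod.ext (suppProfile_comb hl _ _) (Prod.ext (suppProfileSubOne_comb hl _ _)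
    (Prod.ext (suppProfile_comb hl _ _) (suppProfile_comb hl _ _)))

theorem suppProfile_injective : Function.Injective suppProfile := fun _ _ h =>
  eq_of_supp_eq fun t => congrFun (congrArg (fun p : profiles => p.1.1) h) t

theorem config_injective : Function.Injective config := fun _ _ h =>
  Prod.ext (suppProfile_injective (congrArg Prod.fst h))
    (Prod.ext (suppProfile_injective (congrArg (fun x : Config => x.2.2.1) h))
      (suppProfile_injective (congrArg (fun x : Config => x.2.2.2) h)))

/-- All caps have h(π/2) = 1, so the difference of two support functions vanishes there and
`areaForm_nonpos` applies to it. -/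
theorem IsCap.le_area_comb {K L : Body} (hK : IsCap K) (hL : IsCap L) {l : ℝ}
    (hl : l ∈ Icc (0 : ℝ) 1) : (1 - l) * area K + l * area L ≤ area (Sofa.comb l K L) := by
  have h := (isQuadratic_areaForm 0 Real.pi).apply_comb l (suppProfile K) (suppProfile L)
  rw [← suppProfile_comb hl] at h
  have hn : areaForm 0 Real.pi (suppProfile K - suppProfile L) ≤ 0 :=
    areaForm_nonpos (sub_eq_zero.2 (hK.1.trans hL.1.symm))
  have e1 := two_mul_area hK
  have e2 := two_mul_area hL
  have e3 := two_mul_area (hK.comb hL hl)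
  change _ = areaForm 0 Real.pi (suppProfile _) at e1 e2 e3
  have := mul_nonneg (mul_nonneg hl.1 (sub_nonneg.2 hl.2)) (neg_nonneg.2 hn)
  rw [← e1, ← e2, ← e3] at h
  linarith

theorem IsInjectiveCap.comb {K L : Body} (hK : IsInjectiveCap K) (hL : IsInjectiveCap L) {l : ℝ}
    (hl : l ∈ Icc (0 : ℝ) 1) : IsInjectiveCap (Sofa.comb l K L) := by
  refine ⟨hK.1.comb hL.1 hl, hK.2.1.comb hL.2.1 hl, ?_⟩
  have h1 := mul_le_mul_of_nonneg_left hK.2.2 (sub_nonneg.2 hl.2)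
  have h2 := mul_le_mul_of_nonneg_left hL.2.2 hl.1
  have := hK.1.le_area_comb hL.1 hl
  linarith

theorem comb_subset_comb {K L K' L' : Body} {l : ℝ} (h : (K : Set Plane) ⊆ K')
    (h' : (L : Set Plane) ⊆ L') : (comb l K L : Set Plane) ⊆ comb l K' L' := by
  intro p hp
  obtain ⟨a, ha, b, hb, e⟩ := mem_comb.1 hp
  exact mem_comb.2 ⟨a, h ha, b, h' hb, e⟩

theorem IsAdmissible.comb {φ : ℝ} {K B D K' B' D' : Body} (h : IsAdmissible φ K B D)
    (h' : IsAdmissible φ K' B' D') {l : ℝ} (hl : l ∈ Icc (0 : ℝ) 1) :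
    IsAdmissible φ (Sofa.comb l K K') (Sofa.comb l B B') (Sofa.comb l D D') := by
  have hl' : 0 ≤ 1 - l := sub_nonneg.2 hl.2
  have key : ∀ {x y z w : ℝ}, x + y ≤ 1 → z + w ≤ 1 →
      (1 - l) * x + l * z + ((1 - l) * y + l * w) ≤ 1 := fun h1 h2 => by
    have := mul_le_mul_of_nonneg_left h1 hl'
    have := mul_le_mul_of_nonneg_left h2 hl.1
    linarith
  have key' : ∀ {x y z w : ℝ}, x + y = 1 → z + w = 1 →
      (1 - l) * x + l * z + ((1 - l) * y + l * w) = 1 := fun h1 h2 => by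
    linear_combination (1 - l) * h1 + l * h2
  constructor
  · exact h.injectiveCap.comb h'.injectiveCap hl
  · exact comb_subset_comb h.B_subset h'.B_subset
  · exact comb_subset_comb h.D_subset h'.D_subset
  · intro t ht
    simp only [supp_comb hl]
    exact key (h.B_le t ht) (h'.B_le t ht)
  · simp only [supp_comb hl]
    exact key' h.B_eq_start h'.B_eq_start
  · simp only [supp_comb hl]
    exact key' h.B_eq_end h'.B_eq_end
  · intro t ht
    simp only [supp_comb hl]
    exact key (h.D_le t ht) (h'.D_le t ht)
  · simp only [supp_comb hl]
    exact key' h.D_eq_start h'.D_eq_start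
  · simp only [supp_comb hl]
    exact key' h.D_eq_end h'.D_eq_end

/-- The Minkowski combinations on the space `ℒ`. -/
def domainComb (φ : ℝ) : BarycentricOp (Domain φ) := fun l P P' =>
  ⟨minkowskiComb l P.1 P'.1, P.2.comb P'.2 l.2⟩

theorem config_domainComb {φ : ℝ} (l : unitInterval) (P P' : Domain φ) :
    config (domainComb φ l P P').1 = (1 - (l : ℝ)) • config P.1 + (l : ℝ) • config P'.1 :=
  config_minkowskiComb l.2 P.1 P'.1

/-- In differences the constants cancel: h and h - 1 yield the same profile, and the equality
constraints become the homogeneous boundary conditions of `energy_nonpos`. -/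
theorem energy_config_sub_nonpos {φ : ℝ} (h0 : 0 < φ) (h1 : φ < Real.pi / 4) (P P' : Domain φ) :
    energy φ (config P.1 - config P'.1) ≤ 0 := by
  obtain ⟨⟨K, B, D⟩, h⟩ := P
  obtain ⟨⟨K', B', D'⟩, h'⟩ := P'
  dsimp only at h h'
  have e : config (K, B, D) - config (K', B', D') =
      (suppProfile K - suppProfile K', suppProfile K - suppProfile K',
        suppProfile B - suppProfile B', suppProfile D - suppProfile D') := by
    refine Prod.ext rfl (Prod.ext (Subtype.ext (Prod.ext (funext fun t => ?_) rfl)) rfl)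
    change supp K t - 1 - (supp K' t - 1) = supp K t - supp K' t
    ring
  have hK := h.injectiveCap.1.1
  have hK' := h'.injectiveCap.1.1
  have hBe := h.B_eq_end
  have hBe' := h'.B_eq_end
  rw [show Real.pi + Real.pi / 2 = 3 * Real.pi / 2 by ring] at hBe hBe'
  dsimp only
  rw [e]
  refine energy_nonpos h0 h1 ?_ ?_ ?_ ?_ ?_
  · change supp K _ - supp K' _ = 0
    linarith
  · change supp B _ - supp B' _ = 0
    linarith
  · change supp B _ - supp B' _ = -(supp K _ - supp K' _)
    linarith [h.B_eq_start, h'.B_eq_start]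
  · change supp D _ - supp D' _ = 0
    linarith [h.D_eq_start, h'.D_eq_start]
  · change supp D _ - supp D' _ = -(supp K _ - supp K' _)
    linarith [h.D_eq_end, h'.D_eq_end]

theorem isQuadraticFunctional_Q {φ : ℝ} (h0 : 0 < φ) (h1 : φ < Real.pi / 4) :
    IsQuadraticFunctional (domainComb φ) (Q φ) := by
  obtain ⟨g, hg⟩ := isQuadratic_energy φ
  refine ⟨fun P P' => g (config P.1) (config P'.1) / 2, ⟨fun P l P' P'' => ?_, fun P l P' P'' => ?_⟩,
    fun P => ?_⟩
  · simp only [config_domainComb, map_add, map_smul, smul_eq_mul]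
    ring
  · simp only [config_domainComb, map_add, map_smul, LinearMap.add_apply, LinearMap.smul_apply,
      smul_eq_mul]
    ring
  · have h := two_mul_Q h0 h1 P
    rw [hg] at h
    exact eq_div_of_mul_eq two_ne_zero ((mul_comm _ _).trans h)

theorem isConcaveFunctional_Q {φ : ℝ} (h0 : 0 < φ) (h1 : φ < Real.pi / 4) :
    IsConcaveFunctional (domainComb φ) (Q φ) := by
  intro l P P'
  have h := (isQuadratic_energy φ).apply_comb l (config P.1) (config P'.1)
  rw [← config_domainComb, ← two_mul_Q h0 h1, ← two_mul_Q h0 h1, ← two_mul_Q h0 h1] at h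
  have := mul_nonneg (mul_nonneg l.2.1 (sub_nonneg.2 l.2.2))
    (neg_nonneg.2 (energy_config_sub_nonpos h0 h1 P P'))
  linarith

end Sofa

end

/-! ### The main theorem, with the space of configurations as ambient vector space. -/

theorem mainTheorem4 (φ : ℝ) (hφ₀ : 0 < φ) (hφ₁ : φ < Real.pi / 4) :
    ∃ c : Sofa.BarycentricOp (Sofa.Domain φ),
      (∀ (l : unitInterval) (P P' : Sofa.Domain φ),
        (c l P P').1 = Sofa.minkowskiComb l P.1 P'.1) ∧
      Sofa.IsConvexDomain c ∧
      Sofa.IsQuadraticFunctional c (Sofa.Q φ) ∧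
      Sofa.IsConcaveFunctional c (Sofa.Q φ) :=
  ⟨Sofa.domainComb φ, fun _ _ _ => rfl,
    ⟨Sofa.Config, inferInstance, inferInstance, fun P => Sofa.config P.1,
      fun _ _ h => Subtype.ext (Sofa.config_injective h), Sofa.config_domainComb⟩,
    Sofa.isQuadraticFunctional_Q hφ₀ hφ₁, Sofa.isConcaveFunctional_Q hφ₀ hφ₁⟩
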